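/- Let $I=[0,1]$ and let $\mathrm{Homeo}^+(I)$ be the group of orientation-preserving homeomorphisms of $I$. For $f\in\mathrm{Homeo}^+(I)$ write $\operatorname{supp} f=\{x\in I : f(x)\neq x\}$. Let $$F=\langle A,B \mid [A,(AB)^{-1}B(AB)],\ [A,(AB)^{-2}B(AB)^{2}]\rangle$$ be Thompson's group. A subgroup $G\le \mathrm{Homeo}^+(I)$ is called a *square root of $F$* if $G=\langle f,g\rangle$ for some $f,g\in\mathrm{Homeo}^+(I)$ such that $\langle f^2,g^2\rangle\cong F$ and such that $\operatorname{supp} f$ and $\operatorname{supp} g$ form a two-chain of intervals, that is, both are nonempty open intervals and $\operatorname{supp} f\cap\operatorname{supp} g$ is a nonempty proper subinterval of each of them. **Corollary 1.8.** There exists a square root $G$ of $F$ that admits no faithful action by PL homeomorphisms on any compact one-manifold: for every compact one-dimensional PL manifold $M$ (Hausdorff, possibly with boundary, not necessarily connected) there is no injective homomorphism from $G$ to the group of PL homeomorphisms of $M$. -/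

import Mathlib

open scoped unitInterval NNReal Topology Manifold commutatorElement

/-! ### Thompson's group `F` and its square roots -/

/-- The relators `[A, (AB)⁻ᵏ B (AB)ᵏ]`, `k ∈ {1, 2}`, in the free group on `A = 0`, `B = 1`. -/
def thompsonRelators : Set (FreeGroup (Fin 2)) :=
  {r | ∃ k ∈ ({1, 2} : Set ℕ),
    r = ⁅FreeGroup.of (0 : Fin 2),
      ((FreeGroup.of 0 * FreeGroup.of 1) ^ k)⁻¹ * FreeGroup.of 1 *
        (FreeGroup.of 0 * FreeGroup.of 1) ^ k⁆}

/-- Thompson's group `F = ⟨A, B ∣ [A, (AB)⁻ᵏ B (AB)ᵏ] for k ∈ {1, 2}⟩`. -/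
abbrev ThompsonF : Type := PresentedGroup thompsonRelators

/-- `Homeo⁺(I)`: the group of orientation-preserving (that is, increasing) homeomorphisms of
`I = [0, 1]`, under composition. -/
def HomeoPlus : Subgroup (I ≃ₜ I) where
  carrier := {f | StrictMono f}
  mul_mem' := fun hf hg => hf.comp hg
  one_mem' := strictMono_id
  inv_mem' := by
    intro f hf x y hxy
    have h : f (f⁻¹ x) < f (f⁻¹ y) := by
      have hx : f (f⁻¹ x) = x := f.apply_symm_apply x
      have hy : f (f⁻¹ y) = y := f.apply_symm_apply y
      rwa [hx, hy]
    exact hf.lt_iff_lt.1 h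

/-- The (open) support `{x ∣ f x ≠ x}` of a homeomorphism of `I`. -/
def homeoSupport (f : HomeoPlus) : Set I := {x | (f : I ≃ₜ I) x ≠ x}

/-- Two nonempty open intervals whose intersection is a nonempty proper subinterval of each. -/
def IsTwoChain (J₁ J₂ : Set I) : Prop :=
  (∃ a b : I, a < b ∧ J₁ = Set.Ioo a b) ∧ (∃ a b : I, a < b ∧ J₂ = Set.Ioo a b) ∧
    (J₁ ∩ J₂).Nonempty ∧ J₁ ∩ J₂ ⊂ J₁ ∧ J₁ ∩ J₂ ⊂ J₂

/-- `G ≤ Homeo⁺(I)` is a square root of `F`: it is generated by two elements `f`, `g` whose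
supports form a two-chain of intervals and such that `⟨f², g²⟩` is isomorphic to `F`. -/
def IsSquareRootOfF (G : Subgroup HomeoPlus) : Prop :=
  ∃ f g : HomeoPlus, G = Subgroup.closure {f, g} ∧
    IsTwoChain (homeoSupport f) (homeoSupport g) ∧
    Nonempty (Subgroup.closure ({f ^ 2, g ^ 2} : Set HomeoPlus) ≃* ThompsonF)

/-! ### Piecewise linear one-manifolds

One-manifolds, possibly with boundary, are modelled on the half-line `ℝ≥0 = [0, ∞)`. -/

/-- `f` is piecewise linear near `x`: it is affine on a one-sided neighbourhood of `x` on each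
side of `x`. -/
def IsPLAt (f : ℝ≥0 → ℝ≥0) (x : ℝ≥0) : Prop :=
  (∃ a : ℝ, ∀ᶠ y in 𝓝[≤] x, (f y : ℝ) = f x + a * ((y : ℝ) - x)) ∧
    (∃ b : ℝ, ∀ᶠ y in 𝓝[≥] x, (f y : ℝ) = f x + b * ((y : ℝ) - x))

theorem tendsto_of_affine {f : ℝ≥0 → ℝ≥0} {x : ℝ≥0} {a : ℝ} {s : Set ℝ≥0}
    (h : ∀ᶠ y in 𝓝[s] x, (f y : ℝ) = f x + a * ((y : ℝ) - x)) :
    Filter.Tendsto f (𝓝[s] x) (𝓝 (f x)) := by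
  rw [← NNReal.tendsto_coe]
  have hc : Continuous fun y : ℝ≥0 => (f x : ℝ) + a * ((y : ℝ) - x) := by fun_prop
  have ht : Filter.Tendsto (fun y : ℝ≥0 => (f x : ℝ) + a * ((y : ℝ) - x)) (𝓝[s] x)
      (𝓝 (f x : ℝ)) := by
    have := (hc.tendsto x).mono_left (nhdsWithin_le_nhds (s := s))
    simpa using this
  exact ht.congr' (h.mono fun y hy => hy.symm)

theorem IsPLAt.comp_side {f g : ℝ≥0 → ℝ≥0} {x : ℝ≥0} {a : ℝ} {s : Set ℝ≥0}
    (hs : s = Set.Iic x ∨ s = Set.Ici x)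
    (h : ∀ᶠ y in 𝓝[s] x, (f y : ℝ) = f x + a * ((y : ℝ) - x)) (hg : IsPLAt g (f x)) :
    ∃ c : ℝ, ∀ᶠ y in 𝓝[s] x, (g (f y) : ℝ) = g (f x) + c * ((y : ℝ) - x) := by
  have key : (∀ᶠ y in 𝓝[s] x, f y ≤ f x) ∨ (∀ᶠ y in 𝓝[s] x, f x ≤ f y) := by
    have hmem : ∀ᶠ y in 𝓝[s] x, y ∈ s := eventually_mem_nhdsWithin
    rcases hs with rfl | rfl <;> rcases le_total 0 a with ha | ha
    · left
      filter_upwards [h, hmem] with y hy hyx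
      have : (y : ℝ) ≤ x := hyx
      rw [← NNReal.coe_le_coe]; nlinarith
    · right
      filter_upwards [h, hmem] with y hy hyx
      have : (y : ℝ) ≤ x := hyx
      rw [← NNReal.coe_le_coe]; nlinarith
    · right
      filter_upwards [h, hmem] with y hy hyx
      have : (x : ℝ) ≤ y := hyx
      rw [← NNReal.coe_le_coe]; nlinarith
    · left
      filter_upwards [h, hmem] with y hy hyx
      have : (x : ℝ) ≤ y := hyx
      rw [← NNReal.coe_le_coe]; nlinarith
  have ht := tendsto_of_affine h
  rcases key with hk | hk
  · obtain ⟨b, hb⟩ := hg.1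
    refine ⟨b * a, ?_⟩
    filter_upwards [(tendsto_nhdsWithin_iff.2 ⟨ht, hk⟩).eventually hb, h] with y h1 h2
    rw [h1, h2]; ring
  · obtain ⟨b, hb⟩ := hg.2
    refine ⟨b * a, ?_⟩
    filter_upwards [(tendsto_nhdsWithin_iff.2 ⟨ht, hk⟩).eventually hb, h] with y h1 h2
    rw [h1, h2]; ring

/-- Piecewise linear maps between open subsets of the half-line. -/
def plPregroupoid : Pregroupoid ℝ≥0 where
  property f s := ∀ x ∈ s, IsPLAt f x
  comp := by
    intro f g u v hf hg _ _ _ x hx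
    have h1 := hf x hx.1
    have h2 := hg (f x) hx.2
    exact ⟨h1.1.elim fun _ h => IsPLAt.comp_side (f := f) (g := g) (Or.inl rfl) h h2,
      h1.2.elim fun _ h => IsPLAt.comp_side (f := f) (g := g) (Or.inr rfl) h h2⟩
  id_mem := fun x _ => ⟨⟨1, by simp⟩, ⟨1, by simp⟩⟩
  locality := by
    intro f u _ h x hx
    obtain ⟨v, _, hxv, hv⟩ := h x hx
    exact hv x ⟨hx, hxv⟩
  congr := by
    intro f g u hu hfg hf x hx
    obtain ⟨⟨a, ha⟩, ⟨b, hb⟩⟩ := hf x hx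
    have hmem : ∀ᶠ y in 𝓝 x, y ∈ u := hu.mem_nhds hx
    refine ⟨⟨a, ?_⟩, ⟨b, ?_⟩⟩
    · filter_upwards [ha, hmem.filter_mono nhdsWithin_le_nhds] with y hy hyu
      rw [hfg y hyu, hfg x hx, hy]
    · filter_upwards [hb, hmem.filter_mono nhdsWithin_le_nhds] with y hy hyu
      rw [hfg y hyu, hfg x hx, hy]

/-- The pseudogroup of piecewise linear homeomorphisms between open subsets of the half-line:
both the map and its inverse are piecewise linear. A PL one-manifold is a space `M` with
`[ChartedSpace ℝ≥0 M] [HasGroupoid M plGroupoid]`. -/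
def plGroupoid : StructureGroupoid ℝ≥0 := plPregroupoid.groupoid

/-- A homeomorphism of a PL one-manifold is a PL homeomorphism if it is piecewise linear, with
piecewise linear inverse, in all charts of the atlas. -/
def IsPLHomeo {M : Type*} [TopologicalSpace M] [ChartedSpace ℝ≥0 M] (h : M ≃ₜ M) : Prop :=
  ∀ c c' : OpenPartialHomeomorph M ℝ≥0, c ∈ atlas ℝ≥0 M → c' ∈ atlas ℝ≥0 M →
    c.symm ≫ₕ h.toOpenPartialHomeomorph ≫ₕ c' ∈ plGroupoid

/-! The obstruction is an element conjugate to its own square. In a group of PL homeomorphisms of a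
compact one-manifold the relation `t * a * t⁻¹ = a ^ 2` forces `a` to have finite order
(`exists_pow_eq_one_of_conj_eq_sq`), while a square root of `F` can be built that contains `u` and
`t` with `t * u * t⁻¹ = u ^ 2` and `u` of infinite order (`exists_square_roots`).

Obstruction. The one-sided slopes of a PL homeomorphism at its fixed points form a finite
conjugation-invariant set. The relation makes this set closed under squaring, so every slope is 1,
and near a fixed point every power of `a` is the identity or a reflection. It follows that the set
of periodic points of `a` is open and closed. On its complement, a compact one-manifold preserved by
`a` and `t`, the map `a` has no periodic point, and `exists_periodic_point` shows that this
complement is empty. That lemma is purely topological. Averaging gives a finitely additive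
probability invariant under `a` and `t`. Measured by mass, a power of `a` that returns a small arc
to itself acts as a translation by some `θ`. A power of `t` preserves mass but conjugates this
translation to a power of itself with exponent `R ≥ 2`, so `θ = R θ = 0`, and then an orbit
converges to a fixed point. Compactness finally gives one exponent that kills `a` everywhere.

Construction. Let `A` and `B` be bumps on overlapping intervals `(p, b)` and `(α, r)` with `B (A α)
= b`. They generate a copy of `F`: every element of `F` is a quotient of sorted positive words, and
such words are told apart by their action on suitable test points. A root `f` of `A` is far from
unique: conjugating the half translation `S` by anything that commutes with `A` gives another one.
This freedom lets `f` conjugate an element `k` of `⟨A, B⟩` supported in half a fundamental domain of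
`A` to any prescribed element of the same dynamical type supported in the other half
(`exists_sqrt_conj`). The prescribed element is the map `t` that doubles a linearizing coordinate of
a bump `u` in `⟨A, B⟩`. -/

/-! ### Normal forms in Thompson's group -/

section ThompsonNormalForm

variable {Γ : Type*} [Group Γ]

/-- The relations `xⱼ xᵢ = xᵢ xⱼ₊₁` for `i < j` of the infinite presentation of `F`. -/
def IsThompsonSeq (x : ℕ → Γ) : Prop := ∀ i j, i < j → x j * x i = x i * x (j + 1)

/-- The sequence `AB, B, B^(AB), B^((AB)²), …` of the standard infinite generating set. -/
def thompsonSeq (A B : Γ) : ℕ → Γ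
  | 0 => A * B
  | n + 1 => ((A * B) ^ n)⁻¹ * B * (A * B) ^ n

theorem thompsonSeq_conj (A B : Γ) (j : ℕ) (hj : 1 ≤ j) :
    thompsonSeq A B (j + 1) = (A * B)⁻¹ * thompsonSeq A B j * (A * B) := by
  obtain ⟨n, rfl⟩ : ∃ n, j = n + 1 := ⟨j - 1, by omega⟩
  simp only [thompsonSeq, pow_succ]
  group

theorem thompsonSeq_rel_succ (A B : Γ) {i j : ℕ} (hi : 1 ≤ i) (hj : 1 ≤ j)
    (h : thompsonSeq A B j * thompsonSeq A B i = thompsonSeq A B i * thompsonSeq A B (j + 1)) :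
    thompsonSeq A B (j + 1) * thompsonSeq A B (i + 1) =
      thompsonSeq A B (i + 1) * thompsonSeq A B (j + 1 + 1) := by
  rw [thompsonSeq_conj A B (j + 1) (by omega), thompsonSeq_conj A B j hj,
    thompsonSeq_conj A B i hi]
  rw [thompsonSeq_conj A B j hj] at h
  have : (A * B)⁻¹ * (thompsonSeq A B j * thompsonSeq A B i) * (A * B) =
      (A * B)⁻¹ * (thompsonSeq A B i * ((A * B)⁻¹ * thompsonSeq A B j * (A * B))) * (A * B) := by
    rw [h]
  simp only [mul_assoc, mul_inv_cancel_left] at this ⊢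
  exact this

theorem thompsonSeq_rel_add (A B : Γ) {i j : ℕ} (hi : 1 ≤ i) (hj : 1 ≤ j) (n : ℕ)
    (h : thompsonSeq A B j * thompsonSeq A B i = thompsonSeq A B i * thompsonSeq A B (j + 1)) :
    thompsonSeq A B (j + n) * thompsonSeq A B (i + n) =
      thompsonSeq A B (i + n) * thompsonSeq A B (j + n + 1) := by
  induction n with
  | zero => exact h
  | succ n ih => exact thompsonSeq_rel_succ A B (i := i + n) (j := j + n) (by omega) (by omega) ih

theorem thompsonSeq_rel_one_of_commute (A B : Γ) {j : ℕ} (hj : 1 ≤ j)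
    (h : Commute A (thompsonSeq A B j)) :
    thompsonSeq A B j * thompsonSeq A B 1 = thompsonSeq A B 1 * thompsonSeq A B (j + 1) := by
  rw [thompsonSeq_conj A B j hj]
  have h1 : thompsonSeq A B 1 = B := by simp [thompsonSeq]
  have h2 : A⁻¹ * thompsonSeq A B j * A = thompsonSeq A B j := by
    rw [mul_assoc, ← h.eq, inv_mul_cancel_left]
  rw [h1]
  calc _ = B * B⁻¹ * (A⁻¹ * thompsonSeq A B j * A) * B := by rw [h2]; group
    _ = _ := by group

/-- Conjugation by `A * B` shifts the indices from 1 on, so only the relations with `i = 1` matter.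
The two commutations give `j = 2, 3`; larger `j` follow by induction. -/
theorem isThompsonSeq_thompsonSeq {A B : Γ} (h2 : Commute A (thompsonSeq A B 2))
    (h3 : Commute A (thompsonSeq A B 3)) : IsThompsonSeq (thompsonSeq A B) := by
  have key : ∀ j, 2 ≤ j → thompsonSeq A B j * thompsonSeq A B 1 =
      thompsonSeq A B 1 * thompsonSeq A B (j + 1) := by
    intro j
    induction j using Nat.strong_induction_on with
    | _ j ih =>
      intro hj
      rcases Nat.lt_or_ge j 4 with h4 | h4
      · obtain rfl | rfl : j = 2 ∨ j = 3 := by omega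
        · exact thompsonSeq_rel_one_of_commute A B (by norm_num) h2
        · exact thompsonSeq_rel_one_of_commute A B (by norm_num) h3
      · obtain ⟨m, rfl⟩ : ∃ m, j = m + 4 := ⟨j - 4, by omega⟩
        have e1 := thompsonSeq_rel_add A B (i := 1) (j := m + 2) le_rfl (by omega) 1
          (ih (m + 2) (by omega) (by omega))
        have e2 := thompsonSeq_rel_add A B (i := 1) (j := m + 2) le_rfl (by omega) 2
          (ih (m + 2) (by omega) (by omega))
        have e3 := ih (m + 3) (by omega) (by omega)
        have e4 := ih 2 (by omega) le_rfl
        -- With `x = thompsonSeq A B`: conjugation by `x 1` takes `x 3` to `x 2` and `x (m+4)` to `x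
        -- (m+3)`, hence takes `x (m+5)`, a conjugate of `x (m+4)` by `x 3`, to the conjugate of `x
        -- (m+3)` by `x 2`, which is `x (m+4)`.
        norm_num [add_assoc] at e1 e2 e3 e4 ⊢
        have r1 : thompsonSeq A B (m + 4) =
            (thompsonSeq A B 2)⁻¹ * (thompsonSeq A B (m + 3) * thompsonSeq A B 2) := by
          rw [e1, inv_mul_cancel_left]
        have r2 : thompsonSeq A B (m + 5) =
            (thompsonSeq A B 3)⁻¹ * (thompsonSeq A B (m + 4) * thompsonSeq A B 3) := by
          rw [e2, inv_mul_cancel_left]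
        have r3 : thompsonSeq A B 3 =
            (thompsonSeq A B 1)⁻¹ * (thompsonSeq A B 2 * thompsonSeq A B 1) := by
          rw [e4, inv_mul_cancel_left]
        have r4 : thompsonSeq A B (m + 4) =
            (thompsonSeq A B 1)⁻¹ * (thompsonSeq A B (m + 3) * thompsonSeq A B 1) := by
          rw [e3, inv_mul_cancel_left]
        rw [r2, r3]
        nth_rewrite 2 [r4]
        rw [r1]
        group
  intro i j hij
  rcases Nat.eq_zero_or_pos i with rfl | hi
  · rw [thompsonSeq_conj A B j (by omega)]
    simp [thompsonSeq, mul_assoc]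
  · have := thompsonSeq_rel_add A B (i := 1) (j := j - i + 1) le_rfl (by omega) (i - 1)
      (key _ (by omega))
    rwa [show j - i + 1 + (i - 1) = j by omega, show 1 + (i - 1) = i by omega] at this

/-- Sorted positive words `xₙ^{aₙ} xₙ₊₁^{aₙ₊₁} ⋯`. -/
inductive IsSortedWord (x : ℕ → Γ) : ℕ → Γ → Prop
  | one (n : ℕ) : IsSortedWord x n 1
  | step (n a : ℕ) (p : Γ) : IsSortedWord x (n + 1) p → IsSortedWord x n (x n ^ a * p)

namespace IsSortedWord

variable {x : ℕ → Γ}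

theorem of_succ {n : ℕ} {p : Γ} (h : IsSortedWord x (n + 1) p) : IsSortedWord x n p := by
  simpa using h.step n 0

/-- A smaller generator moves to the left past a sorted word at the price of raising all indices by
one; this is what restores sortedness in `mul_gen`. -/
theorem exists_mul_eq (hx : IsThompsonSeq x) {m : ℕ} {p : Γ} (h : IsSortedWord x m p) :
    ∀ {n : ℕ}, n < m → ∃ p', IsSortedWord x (m + 1) p' ∧ p * x n = x n * p' := by
  induction h with
  | one m => exact fun _ => ⟨1, one _, by simp⟩
  | step m a p _ ih =>
    intro n hn
    obtain ⟨p', hp', e⟩ := ih (n := n) (by omega)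
    refine ⟨_, hp'.step (m + 1) a, ?_⟩
    have hs : SemiconjBy (x n) (x (m + 1)) (x m) := (hx n m hn).symm
    rw [mul_assoc, e, ← mul_assoc, ← mul_assoc, (hs.pow_right a).eq]

theorem gen {n j : ℕ} (h : n ≤ j) : IsSortedWord x n (x j) := by
  induction h using Nat.decreasingInduction with
  | self => simpa using (one (x := x) (j + 1)).step j 1
  | of_succ k hk ih => exact ih.of_succ

theorem mul_gen (hx : IsThompsonSeq x) {n : ℕ} {p : Γ} (h : IsSortedWord x n p) :
    ∀ {j : ℕ}, n ≤ j → IsSortedWord x n (p * x j) := by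
  induction h with
  | one n => intro j hj; simpa using gen hj
  | step n a p hp ih =>
    intro j hj
    rcases hj.eq_or_lt with rfl | hj
    · obtain ⟨p', hp', e⟩ := hp.exists_mul_eq hx (Nat.lt_succ_self n)
      rw [mul_assoc, e, ← mul_assoc, ← pow_succ]
      exact hp'.of_succ.step n (a + 1)
    · rw [mul_assoc]
      exact (ih hj).step n a

theorem of_mem_closure (hx : IsThompsonSeq x) {p : Γ}
    (hp : p ∈ Submonoid.closure (Set.range x)) : IsSortedWord x 0 p := by
  induction hp using Submonoid.closure_induction_right with
  | one => exact one 0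
  | mul_right p _ y hy ih =>
    obtain ⟨j, rfl⟩ := hy
    exact ih.mul_gen hx (Nat.zero_le j)

end IsSortedWord

theorem IsThompsonSeq.inv_gen_mul_gen {x : ℕ → Γ} (hx : IsThompsonSeq x) (i j : ℕ) :
    ∃ y z : Γ, (y = 1 ∨ y ∈ Set.range x) ∧ z ∈ Submonoid.closure (Set.range x) ∧
      (x i)⁻¹ * x j = y * z⁻¹ := by
  rcases lt_trichotomy i j with h | rfl | h
  · refine ⟨x (j + 1), x i, Or.inr ⟨_, rfl⟩, Submonoid.subset_closure ⟨_, rfl⟩, ?_⟩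
    rw [eq_mul_inv_iff_mul_eq, mul_assoc, hx i j h, inv_mul_cancel_left]
  · exact ⟨1, 1, Or.inl rfl, one_mem _, by simp⟩
  · refine ⟨x j, x (i + 1), Or.inr ⟨_, rfl⟩, Submonoid.subset_closure ⟨_, rfl⟩, ?_⟩
    rw [eq_mul_inv_iff_mul_eq, mul_assoc, ← hx j i h, inv_mul_cancel_left]

/-- The positive part keeps length at most one while letters of `q` are absorbed, because the
relations exchange one inverse letter with one letter. This is what makes the induction close. -/
theorem IsThompsonSeq.inv_mul_gen {x : ℕ → Γ} (hx : IsThompsonSeq x) {q : Γ}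
    (hq : q ∈ Submonoid.closure (Set.range x)) (j : ℕ) :
    ∃ y z : Γ, (y = 1 ∨ y ∈ Set.range x) ∧ z ∈ Submonoid.closure (Set.range x) ∧
      q⁻¹ * x j = y * z⁻¹ := by
  induction hq using Submonoid.closure_induction_right with
  | one => exact ⟨x j, 1, Or.inr ⟨j, rfl⟩, one_mem _, by simp⟩
  | mul_right q _ w hw ih =>
    obtain ⟨i, rfl⟩ := hw
    obtain ⟨y, z, hy, hz, e⟩ := ih
    have e' : (q * x i)⁻¹ * x j = (x i)⁻¹ * y * z⁻¹ := by
      rw [mul_inv_rev, mul_assoc, e, mul_assoc]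
    rcases hy with rfl | ⟨l, rfl⟩
    · exact ⟨1, z * x i, Or.inl rfl, mul_mem hz (Submonoid.subset_closure ⟨i, rfl⟩),
        by rw [e']; group⟩
    · obtain ⟨y', z', hy', hz', e''⟩ := hx.inv_gen_mul_gen i l
      exact ⟨y', z * z', hy', mul_mem hz hz', by rw [e', e'']; group⟩

/-- The Ore condition: all inverses can be moved to the right, after which numerator and denominator
are sorted separately. -/
theorem IsThompsonSeq.exists_eq_mul_inv {x : ℕ → Γ} (hx : IsThompsonSeq x) {w : Γ}
    (hw : w ∈ Subgroup.closure (Set.range x)) :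
    ∃ p q, IsSortedWord x 0 p ∧ IsSortedWord x 0 q ∧ w = p * q⁻¹ := by
  suffices h : ∃ p ∈ Submonoid.closure (Set.range x), ∃ q ∈ Submonoid.closure (Set.range x),
      w = p * q⁻¹ by
    obtain ⟨p, hp, q, hq, e⟩ := h
    exact ⟨p, q, .of_mem_closure hx hp, .of_mem_closure hx hq, e⟩
  induction hw using Subgroup.closure_induction_right with
  | one => exact ⟨1, one_mem _, 1, one_mem _, by simp⟩
  | mul_right w _ y hy ih =>
    obtain ⟨p, hp, q, hq, rfl⟩ := ih
    obtain ⟨j, rfl⟩ := hy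
    obtain ⟨y, z, hy, hz, e⟩ := hx.inv_mul_gen hq j
    refine ⟨p * y, mul_mem hp ?_, z, hz, by rw [mul_assoc, e, mul_assoc]⟩
    rcases hy with rfl | hy
    exacts [one_mem _, Submonoid.subset_closure hy]
  | mul_inv_cancel w _ y hy ih =>
    obtain ⟨p, hp, q, hq, rfl⟩ := ih
    exact ⟨p, hp, y * q, mul_mem (Submonoid.subset_closure hy) hq, by group⟩

end ThompsonNormalForm

/-! ### Faithful actions of Thompson's group on linear orders -/

section ThompsonDynamics

theorem orderIso_pow_lt {X : Type*} [LinearOrder X] {h : X ≃o X} {y : X} (hy : h y < y) {a : ℕ}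
    (ha : a ≠ 0) : (h ^ a) y < y := by
  induction a with
  | zero => exact absurd rfl ha
  | succ n ih =>
    rcases Nat.eq_zero_or_pos n with rfl | hn
    · simpa using hy
    · rw [pow_succ, RelIso.mul_apply]
      exact ((h ^ n).strictMono hy).trans (ih hn.ne')

theorem orderIso_pow_apply_inj {X : Type*} [LinearOrder X] {h : X ≃o X} {y : X} (hy : h y < y)
    {a b : ℕ} (hab : (h ^ a) y = (h ^ b) y) : a = b := by
  wlog hle : a ≤ b generalizing a b
  · exact (this hab.symm (by omega)).symm
  by_contra hne
  obtain ⟨c, rfl⟩ := Nat.exists_eq_add_of_le hle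
  rw [pow_add, RelIso.mul_apply] at hab
  exact (orderIso_pow_lt hy (a := c) (by omega)).ne ((h ^ a).injective hab).symm

variable {Γ X : Type*} [Group Γ] [LinearOrder X] {x : ℕ → Γ} {φ : Γ →* (X ≃o X)} {y : ℕ → X}

theorem IsSortedWord.apply_eq (hfix : ∀ n m, n < m → φ (x m) (y n) = y n) {m : ℕ} {p : Γ}
    (hp : IsSortedWord x m p) : ∀ {n}, n < m → φ p (y n) = y n := by
  induction hp with
  | one m => intro n _; simp
  | step m a p _ ih =>
    intro n hn
    rw [map_mul, map_pow, RelIso.mul_apply, ih (by omega)]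
    induction a with
    | zero => simp
    | succ a iha => rw [pow_succ, RelIso.mul_apply, hfix n m hn, iha]

theorem IsSortedWord.eq_one (hfix : ∀ n m, n < m → φ (x m) (y n) = y n)
    (hlt : ∀ n, φ (x n) (y n) < y n) {n : ℕ} {p : Γ} (hp : IsSortedWord x n p) :
    φ p = 1 → p = 1 := by
  induction hp with
  | one n => exact fun _ => rfl
  | step n a p hp ih =>
    intro h
    have h1 : (φ (x n) ^ a) (y n) = (φ (x n) ^ 0) (y n) := by
      have := DFunLike.congr_fun h (y n)
      rw [map_mul, map_pow, RelIso.mul_apply, hp.apply_eq hfix (Nat.lt_succ_self n)] at this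
      simpa using this
    obtain rfl := orderIso_pow_apply_inj (hlt n) h1
    simp only [pow_zero, one_mul] at h ⊢
    exact ih h

/-- The point `y n` reads off the exponent of `x n`: later letters fix it, and the powers of `φ (x
n)` move it to distinct points. Cancelling that letter leaves words starting one index later. -/
theorem IsSortedWord.eq_of_map_eq (hfix : ∀ n m, n < m → φ (x m) (y n) = y n)
    (hlt : ∀ n, φ (x n) (y n) < y n) {n : ℕ} {p : Γ} (hp : IsSortedWord x n p) :
    ∀ {q}, IsSortedWord x n q → φ p = φ q → p = q := by
  induction hp with
  | one n =>
    intro q hq h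
    exact (hq.eq_one hfix hlt (by rw [← h, map_one])).symm
  | step n a p hp ih =>
    intro q hq h
    cases hq with
    | one => exact (hp.step n a).eq_one hfix hlt (by rw [h, map_one])
    | step _ b q hq =>
      have h1 : (φ (x n) ^ a) (y n) = (φ (x n) ^ b) (y n) := by
        have := DFunLike.congr_fun h (y n)
        rwa [map_mul, map_pow, RelIso.mul_apply, hp.apply_eq hfix (Nat.lt_succ_self n),
          map_mul, map_pow, RelIso.mul_apply, hq.apply_eq hfix (Nat.lt_succ_self n)] at this
      obtain rfl := orderIso_pow_apply_inj (hlt n) h1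
      rw [map_mul, map_mul, mul_right_inj] at h
      rw [ih hq h]

theorem IsThompsonSeq.injective (hx : IsThompsonSeq x)
    (hgen : Subgroup.closure (Set.range x) = ⊤)
    (hfix : ∀ n m, n < m → φ (x m) (y n) = y n) (hlt : ∀ n, φ (x n) (y n) < y n) :
    Function.Injective φ := by
  rw [injective_iff_map_eq_one]
  intro w hw
  obtain ⟨p, q, hp, hq, rfl⟩ := hx.exists_eq_mul_inv (w := w) (by rw [hgen]; trivial)
  rw [map_mul, map_inv, mul_inv_eq_one] at hw
  rw [hp.eq_of_map_eq hfix hlt hq hw, mul_inv_cancel]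

/-- Two decreasing order automorphisms in fast two-chain position generate a copy of `F`. -/
theorem nonempty_mulEquiv_thompsonF {X : Type*} [LinearOrder X] {A B : X ≃o X} {y₀ α b : X}
    (hA : ∀ z, b ≤ z → A z = z) (hB : ∀ z, z ≤ α → B z = z)
    (hA' : ∀ z, A z ≤ z) (hB' : ∀ z, B z ≤ z) (hfast : A (B b) = α) (hBb : B b < b)
    (hy₀ : y₀ ≤ α) (hAy₀ : A y₀ < y₀) :
    Nonempty (Subgroup.closure ({A, B} : Set (X ≃o X)) ≃* ThompsonF) := by
  have hle : ∀ n z, ((A * B) ^ n) z ≤ z := by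
    intro n
    induction n with
    | zero => intro z; simp
    | succ n ih =>
      intro z
      rw [pow_succ, RelIso.mul_apply, RelIso.mul_apply]
      exact (ih _).trans ((hA' _).trans (hB' _))
  have hb : ∀ n, ((A * B) ^ (n + 1)) b ≤ α := by
    intro n
    rw [pow_succ, RelIso.mul_apply, RelIso.mul_apply, hfast]
    exact hle n α
  -- A positive power of `A * B` carries everything up to `b` below `α`, where `B` is trivial. So
  -- the later generators live above `b`, off the support of `A`, and commute with it.
  have hfix : ∀ n z, z ≤ b → thompsonSeq A B (n + 2) z = z := by
    intro n z hz
    have : B (((A * B) ^ (n + 1)) z) = ((A * B) ^ (n + 1)) z :=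
      hB _ (((OrderIso.monotone _ hz)).trans (hb n))
    simp only [thompsonSeq, RelIso.mul_apply]
    rw [this, RelIso.inv_apply_self]
  have hcomm : ∀ n, Commute A (thompsonSeq A B (n + 2)) := by
    intro n
    ext z
    simp only [RelIso.mul_apply]
    rcases le_total z b with hz | hz
    · rw [hfix n z hz, hfix n _ ((hA' z).trans hz)]
    · rw [hA z hz, hA]
      have := (thompsonSeq A B (n + 2)).monotone hz
      rwa [hfix n b le_rfl] at this
  have hrel : ∀ r ∈ thompsonRelators, (FreeGroup.lift ![A, B]) r = 1 := by
    rintro r ⟨k, hk, rfl⟩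
    have e : ∀ n, thompsonSeq A B (n + 1) = ((A * B) ^ n)⁻¹ * B * (A * B) ^ n := fun n => rfl
    have : Commute A (thompsonSeq A B (k + 1)) := by
      rcases hk with rfl | rfl
      exacts [hcomm 0, hcomm 1]
    rw [e] at this
    simpa [commutatorElement_eq_one_iff_commute] using this
  let φ : ThompsonF →* (X ≃o X) := PresentedGroup.toGroup hrel
  let P : Fin 2 → ThompsonF := PresentedGroup.of
  have hφ0 : φ (P 0) = A := PresentedGroup.toGroup.of hrel
  have hφ1 : φ (P 1) = B := PresentedGroup.toGroup.of hrel
  have hφ : ∀ n, φ (thompsonSeq (P 0) (P 1) n) = thompsonSeq A B n := by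
    intro n
    cases n <;> simp [thompsonSeq, hφ0, hφ1]
  have hP : ∀ k ∈ ({1, 2} : Set ℕ), Commute (P 0) (thompsonSeq (P 0) (P 1) (k + 1)) := by
    intro k hk
    have h1 : (PresentedGroup.mk thompsonRelators) ⁅FreeGroup.of (0 : Fin 2),
      ((FreeGroup.of 0 * FreeGroup.of 1) ^ k)⁻¹ * FreeGroup.of 1 *
        (FreeGroup.of 0 * FreeGroup.of 1) ^ k⁆ = 1 :=
      PresentedGroup.one_of_mem ⟨k, hk, rfl⟩
    rw [map_commutatorElement, commutatorElement_eq_one_iff_commute] at h1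
    simpa [thompsonSeq, P, PresentedGroup.of] using h1
  have hgen : Subgroup.closure (Set.range (thompsonSeq (P 0) (P 1))) = ⊤ := by
    rw [eq_top_iff, ← PresentedGroup.closure_range_of thompsonRelators, Subgroup.closure_le]
    have h1 : P 1 ∈ Subgroup.closure (Set.range (thompsonSeq (P 0) (P 1))) :=
      Subgroup.subset_closure ⟨1, by simp [thompsonSeq]⟩
    have h0 : P 0 * P 1 ∈ Subgroup.closure (Set.range (thompsonSeq (P 0) (P 1))) :=
      Subgroup.subset_closure ⟨0, rfl⟩
    rintro _ ⟨i, rfl⟩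
    fin_cases i
    · simpa using mul_mem h0 (inv_mem h1)
    · exact h1
  have hinj : Function.Injective φ := by
    -- Test points: `y₀` lies where `B` and its conjugates by powers of `A * B` are trivial but `A`
    -- is not; the others are the translates of `b`, a point that `B` moves.
    refine (isThompsonSeq_thompsonSeq (hP 1 (by simp)) (hP 2 (by simp))).injective
      (y := fun n => match n with
        | 0 => y₀
        | n + 1 => ((A * B) ^ n)⁻¹ b) hgen ?_ ?_
    · intro n m hnm
      rw [hφ]
      obtain ⟨m, rfl⟩ : ∃ m', m = m' + 1 := ⟨m - 1, by omega⟩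
      cases n with
      | zero =>
        have : B (((A * B) ^ m) y₀) = ((A * B) ^ m) y₀ := hB _ ((hle m _).trans hy₀)
        simp only [thompsonSeq, RelIso.mul_apply]
        rw [this, RelIso.inv_apply_self]
      | succ n =>
        obtain ⟨k, rfl⟩ : ∃ k, m = n + (k + 1) := ⟨m - n - 1, by omega⟩
        have : B (((A * B) ^ (k + 1)) b) = ((A * B) ^ (k + 1)) b := hB _ (hb k)
        simp only [thompsonSeq, RelIso.mul_apply]
        nth_rewrite 2 [add_comm n (k + 1)]
        rw [pow_add _ (k + 1) n, RelIso.mul_apply, RelIso.apply_inv_self, this,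
          ← RelIso.mul_apply]
        congr 1
        group
    · intro n
      rw [hφ]
      cases n with
      | zero =>
        simp only [thompsonSeq, RelIso.mul_apply]
        rwa [hB _ hy₀]
      | succ n =>
        simp only [thompsonSeq, RelIso.mul_apply]
        rw [RelIso.apply_inv_self]
        exact OrderIso.strictMono _ hBb
  have hrange : φ.range = Subgroup.closure ({A, B} : Set (X ≃o X)) := by
    rw [MonoidHom.range_eq_map, ← PresentedGroup.closure_range_of thompsonRelators,
      MonoidHom.map_closure]
    congr 1
    ext z
    rw [← Set.range_comp, Set.mem_range, Fin.exists_fin_two]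
    change φ (P 0) = z ∨ φ (P 1) = z ↔ _
    rw [hφ0, hφ1]
    simp [eq_comm]
  exact ⟨((MonoidHom.ofInjective hinj).trans (MulEquiv.subgroupCongr hrange)).symm⟩

end ThompsonDynamics

/-! ### Finitely additive invariant probabilities -/

/-- A finitely additive probability defined on all subsets of `X`. -/
structure FinAddProb (X : Type*) where
  /-- the mass of a set -/
  mass : Set X → ℝ
  mass_nonneg : ∀ E, 0 ≤ mass E
  mass_univ : mass Set.univ = 1
  mass_union : ∀ E F, Disjoint E F → mass (E ∪ F) = mass E + mass F

namespace FinAddProb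

variable {X : Type*} (d : FinAddProb X)

theorem mass_mono {E F : Set X} (h : E ⊆ F) : d.mass E ≤ d.mass F := by
  have := d.mass_union E (F \ E) Set.disjoint_sdiff_right
  rw [Set.union_sdiff_cancel h] at this
  linarith [d.mass_nonneg (F \ E)]

theorem mass_le_one (E : Set X) : d.mass E ≤ 1 := by
  rw [← d.mass_univ]
  exact d.mass_mono (Set.subset_univ E)

theorem mass_empty : d.mass ∅ = 0 := by
  have := d.mass_union ∅ ∅ (by simp)
  simp only [Set.union_empty] at this
  linarith

theorem mass_union_le (E F : Set X) : d.mass (E ∪ F) ≤ d.mass E + d.mass F := by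
  rw [← Set.union_sdiff_self, d.mass_union _ _ Set.disjoint_sdiff_right]
  linarith [d.mass_mono (E := F \ E) (F := F) Set.sdiff_subset]

/-- The Dirac mass. -/
noncomputable def dirac (p : X) : FinAddProb X where
  mass E := E.indicator 1 p
  mass_nonneg E := Set.indicator_nonneg (by simp) p
  mass_univ := by simp
  mass_union E F h := by rw [Set.indicator_union_of_disjoint h]

/-- Cesàro averages along an ultrafilter. -/
theorem exists_average (s : X → X) : ∃ d' : FinAddProb X,
    (∀ E, d'.mass (s ⁻¹' E) = d'.mass E) ∧
    ∀ b : X → X, (∀ n E, d.mass (s^[n] ⁻¹' (b ⁻¹' E)) = d.mass (s^[n] ⁻¹' E)) →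
      ∀ E, d'.mass (b ⁻¹' E) = d'.mass E := by
  let u : Set X → ℕ → ℝ := fun E n =>
    (∑ i ∈ Finset.range (n + 1), d.mass (s^[i] ⁻¹' E)) / (n + 1)
  let 𝓕 : Filter ℕ := (Filter.hyperfilter ℕ : Filter ℕ)
  have hpos : ∀ n : ℕ, (0 : ℝ) < n + 1 := fun n => by positivity
  have hu : ∀ E n, u E n ∈ Set.Icc (0 : ℝ) 1 := by
    intro E n
    refine ⟨div_nonneg (Finset.sum_nonneg fun i _ => d.mass_nonneg _) (hpos n).le, ?_⟩
    rw [div_le_one (hpos n)]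
    calc _ ≤ ∑ i ∈ Finset.range (n + 1), (1 : ℝ) := Finset.sum_le_sum fun i _ => d.mass_le_one _
      _ = _ := by simp
  have hL : ∀ E, ∃ L : ℝ, 0 ≤ L ∧ Filter.Tendsto (u E) 𝓕 (𝓝 L) := by
    intro E
    obtain ⟨L, hL, h⟩ := isCompact_Icc.ultrafilter_le_nhds
      ((Filter.hyperfilter ℕ).map (u E)) (s := Set.Icc (0 : ℝ) 1)
      (by
        rw [Filter.le_principal_iff]
        exact Filter.mem_map.2 (Filter.univ_mem' fun n => hu E n))
    exact ⟨L, hL.1, h⟩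
  choose m hm0 hm using hL
  refine ⟨⟨m, hm0, ?_, ?_⟩, ?_, ?_⟩
  · refine tendsto_nhds_unique (hm _) (Filter.Tendsto.congr (fun n => ?_) tendsto_const_nhds)
    simp [u, d.mass_univ, (hpos n).ne']
  · intro E F hEF
    refine tendsto_nhds_unique (hm _) (((hm E).add (hm F)).congr fun n => ?_)
    simp only [u]
    rw [← add_div, ← Finset.sum_add_distrib]
    congr 1
    refine Finset.sum_congr rfl fun i _ => ?_
    rw [Set.preimage_union, d.mass_union _ _ (hEF.preimage _)]
  · intro E
    have h0 : Filter.Tendsto (fun n : ℕ => 1 / ((n : ℝ) + 1)) 𝓕 (𝓝 0) :=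
      tendsto_one_div_add_atTop_nhds_zero_nat.mono_left Nat.hyperfilter_le_atTop
    have h1 : Filter.Tendsto (fun n => u (s ⁻¹' E) n - u E n) 𝓕 (𝓝 0) := by
      refine squeeze_zero_norm (fun n => ?_) h0
      -- The averages telescope, leaving two boundary terms divided by `n + 1`.
      have e : u (s ⁻¹' E) n - u E n = (d.mass (s^[n + 1] ⁻¹' E) - d.mass E) / (n + 1) := by
        simp only [u]
        rw [← sub_div]
        congr 1
        have e1 : ∀ i, s^[i] ⁻¹' (s ⁻¹' E) = s^[i + 1] ⁻¹' E := by
          intro i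
          rw [← Set.preimage_comp, ← Function.iterate_succ']
        simp only [e1]
        rw [Finset.sum_range_succ, Finset.sum_range_succ' (fun i => d.mass (s^[i] ⁻¹' E))]
        simp
      rw [e, Real.norm_eq_abs, abs_div, abs_of_pos (hpos n)]
      gcongr
      rw [abs_le]
      constructor <;>
      linarith [d.mass_nonneg E, d.mass_le_one E, d.mass_nonneg (s^[n + 1] ⁻¹' E),
        d.mass_le_one (s^[n + 1] ⁻¹' E)]
    have := tendsto_nhds_unique ((hm (s ⁻¹' E)).sub (hm E)) h1
    change m _ = m _
    linarith
  · intro b hb E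
    refine tendsto_nhds_unique (hm _) ((hm E).congr fun n => ?_)
    simp only [u]
    congr 1
    exact Finset.sum_congr rfl fun i _ => (hb i E).symm

/-- Invariance of a finitely additive probability under a homeomorphism. -/
def Invariant [TopologicalSpace X] (b : X ≃ₜ X) : Prop := ∀ E, d.mass (b ⁻¹' E) = d.mass E

variable {d} [TopologicalSpace X]

theorem Invariant.one : d.Invariant 1 := fun _ => rfl

theorem Invariant.mul {b c : X ≃ₜ X} (hb : d.Invariant b) (hc : d.Invariant c) :
    d.Invariant (b * c) := fun E => (hc (b ⁻¹' E)).trans (hb E)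

theorem Invariant.inv {b : X ≃ₜ X} (hb : d.Invariant b) : d.Invariant b⁻¹ := fun E => by
  rw [← hb, ← Set.preimage_comp]
  congr 1
  ext x
  simp

theorem Invariant.pow {b : X ≃ₜ X} (hb : d.Invariant b) (n : ℕ) : d.Invariant (b ^ n) := by
  induction n with
  | zero => exact .one
  | succ n ih => rw [pow_succ]; exact ih.mul hb

theorem Invariant.mass_image {b : X ≃ₜ X} (hb : d.Invariant b) (E : Set X) :
    d.mass (b '' E) = d.mass E := by
  rw [← hb, b.preimage_image]

/-- Amenability of the solvable group `⟨a, t⟩`, done by hand: a Dirac mass is averaged along `a`,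
then along `t⁻¹`. The second average keeps `a`-invariance because `a` passes through `t⁻¹ ^ n` as `a
^ 2 ^ n`. -/
theorem exists_invariant [Nonempty X] {a t : X ≃ₜ X} (h : t * a * t⁻¹ = a ^ 2) :
    ∃ d : FinAddProb X, d.Invariant a ∧ d.Invariant t := by
  obtain ⟨p⟩ := ‹Nonempty X›
  obtain ⟨d₁, h₁, -⟩ := (dirac p).exists_average a
  have h₁ : d₁.Invariant a := h₁
  obtain ⟨d₂, h₂, h₃⟩ := d₁.exists_average (t⁻¹ : X ≃ₜ X)
  have h₂ : d₂.Invariant t⁻¹ := h₂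
  refine ⟨d₂, h₃ a fun n E => ?_, by simpa using h₂.inv⟩
  have hit : ∀ n : ℕ, (⇑(t⁻¹))^[n] = ⇑((t⁻¹) ^ n) := by
    intro n
    induction n with
    | zero => rfl
    | succ n ih => rw [Function.iterate_succ, ih, pow_succ]; rfl
  have hconj : ∀ n : ℕ, a * (t⁻¹) ^ n = (t⁻¹) ^ n * a ^ (2 ^ n) := by
    intro n
    induction n with
    | zero => simp
    | succ n ih =>
      have h' : a * t⁻¹ = t⁻¹ * a ^ 2 := by rw [← h]; group
      have h'' : SemiconjBy t⁻¹ (a ^ 2) a := h'.symm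
      rw [pow_succ, ← mul_assoc, ih, mul_assoc, mul_assoc, ← (h''.pow_right (2 ^ n)).eq,
        ← pow_mul, pow_succ', mul_comm 2]
  rw [hit]
  have := h₁.pow (2 ^ n) (⇑((t⁻¹) ^ n) ⁻¹' E)
  rw [← this]
  have e := hconj n
  congr 1
  ext x
  have := DFunLike.congr_fun e x
  simp only [Homeomorph.mul_apply] at this
  simp only [Set.mem_preimage, this]

theorem Invariant.nsmul_mass_le {a : X ≃ₜ X} (ha : d.Invariant a) {W : Set X} {n : ℕ}
    (hW : ∀ i j, i < j → j < n → Disjoint (⇑(a ^ i) ⁻¹' W) (⇑(a ^ j) ⁻¹' W)) :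
    n * d.mass W ≤ 1 := by
  have key : ∀ m ≤ n, d.mass (⋃ i ∈ Finset.range m, ⇑(a ^ i) ⁻¹' W) = m * d.mass W := by
    intro m
    induction m with
    | zero => intro _; simp [d.mass_empty]
    | succ m ih =>
      intro hm
      rw [Finset.range_add_one, Finset.set_biUnion_insert, d.mass_union, ih (by omega),
        ha.pow m W]
      · push_cast; ring
      · rw [Set.disjoint_iUnion₂_right]
        intro i hi
        exact (hW i m (Finset.mem_range.1 hi) (by omega)).symm
  rw [← key n le_rfl]
  exact d.mass_le_one _

/-- The orbit of `x` is infinite, so for each `n` a small enough neighbourhood of `x` has `n`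
disjoint translates, and its mass is at most `1 / n`. -/
theorem Invariant.exists_mass_lt [T2Space X] {a : X ≃ₜ X} (ha : d.Invariant a)
    (hper : ∀ m : ℕ, m ≠ 0 → ∀ p, (a ^ m) p ≠ p) (x : X) {ε : ℝ} (hε : 0 < ε) :
    ∃ W, IsOpen W ∧ x ∈ W ∧ d.mass W < ε := by
  obtain ⟨n, hn⟩ := exists_nat_gt (1 / ε)
  have hinj : ∀ i j, i < j → (a ^ i) x ≠ (a ^ j) x := by
    intro i j hij h
    obtain ⟨k, rfl⟩ := Nat.exists_eq_add_of_lt hij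
    rw [add_assoc, pow_add, Homeomorph.mul_apply] at h
    exact hper (k + 1) (by omega) x ((a ^ i).injective h).symm
  obtain ⟨U, hU, hdisj⟩ := ((Finset.range n).finite_toSet.image
    (fun i : ℕ => (a ^ i) x)).t2_separation
  refine ⟨⋂ i ∈ Finset.range n, ⇑(a ^ i) ⁻¹' U ((a ^ i) x), ?_, ?_, ?_⟩
  · exact isOpen_biInter_finset fun i _ => (hU _).2.preimage (a ^ i).continuous
  · simp only [Set.mem_iInter, Set.mem_preimage]
    exact fun i _ => (hU _).1
  · set W := ⋂ i ∈ Finset.range n, ⇑(a ^ i) ⁻¹' U ((a ^ i) x) with hWdef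
    have hsub : ∀ i < n, ∀ w ∈ W, (a ^ i) w ∈ U ((a ^ i) x) := by
      intro i hi w hw
      simp only [hWdef, Set.mem_iInter] at hw
      exact hw i (Finset.mem_range.2 hi)
    have h1 : (n : ℝ) * d.mass W ≤ 1 := by
      have := ha.inv.nsmul_mass_le (W := W) (n := n) ?_
      · exact this
      · intro i j hij hj
        rw [Set.disjoint_left]
        intro y hy1 hy2
        have e1 := hsub i (by omega) _ hy1
        have e2 := hsub j hj _ hy2
        have e3 : ∀ k : ℕ, (a ^ k) (((a⁻¹) ^ k) y) = y := fun k => by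
          rw [← Homeomorph.mul_apply, inv_pow, mul_inv_cancel, Homeomorph.one_apply]
        rw [e3] at e1 e2
        refine Set.disjoint_left.1 (hdisj ⟨i, by simpa using hij.trans hj, rfl⟩
          ⟨j, by simpa using hj, rfl⟩ (hinj i j hij)) e1 e2
    have hn0 : (0 : ℝ) < n := lt_trans (by positivity) hn
    rw [div_lt_iff₀ hε] at hn
    nlinarith

/-- Poincaré recurrence; finite additivity is enough. -/
theorem Invariant.exists_return {a : X ≃ₜ X} (ha : d.Invariant a) {W : Set X}
    (hW : 0 < d.mass W) : ∃ k : ℕ, k ≠ 0 ∧ ∃ z ∈ W, (a ^ k) z ∈ W := by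
  by_contra! hcon
  obtain ⟨n, hn⟩ := exists_nat_gt (1 / d.mass W)
  rw [div_lt_iff₀ hW] at hn
  refine absurd (ha.nsmul_mass_le (W := W) (n := n) ?_) (not_le.2 hn)
  intro i j hij _
  rw [Set.disjoint_left]
  intro y hy1 hy2
  obtain ⟨k, rfl⟩ := Nat.exists_eq_add_of_lt hij
  refine hcon (k + 1) (by omega) _ hy1 ?_
  rwa [← Homeomorph.mul_apply, ← pow_add, add_comm, ← add_assoc]

/-- Otherwise finitely many null neighbourhoods would cover the space. -/
theorem exists_forall_mem_nhds_mass_pos [CompactSpace X] (d : FinAddProb X) :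
    ∃ x, ∀ W ∈ 𝓝 x, 0 < d.mass W := by
  by_contra! hcon
  choose W hW hd using hcon
  obtain ⟨s, hs⟩ := CompactSpace.elim_nhds_subcover W hW
  have : ∀ s : Finset X, d.mass (⋃ x ∈ s, W x) ≤ 0 := by
    classical
    intro s
    induction s using Finset.induction_on with
    | empty => simp [d.mass_empty]
    | insert x s _ ih =>
      rw [Finset.set_biUnion_insert]
      linarith [d.mass_union_le (W x) (⋃ x ∈ s, W x), hd x]
  have h := this s
  rw [hs, Set.top_eq_univ, d.mass_univ] at h
  linarith

end FinAddProb

/-! ### Arcs in a one-dimensional chart -/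

section Arcs

set_option linter.unusedSectionVars false

variable {X L : Type*} [TopologicalSpace X] [ConditionallyCompleteLinearOrder L]
  [TopologicalSpace L] [OrderTopology L] [DenselyOrdered L]
  {d : FinAddProb X} {e : OpenPartialHomeomorph L X}

/-- The mass of the arc `e [u, v)`. -/
def arcMass (d : FinAddProb X) (e : OpenPartialHomeomorph L X) (u v : L) : ℝ :=
  d.mass (e '' Set.Ico u v)

theorem arcMass_nonneg (u v : L) : 0 ≤ arcMass d e u v := d.mass_nonneg _

theorem arcMass_add (he : e.source.OrdConnected) {u v w : L} (hu : u ∈ e.source)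
    (hw : w ∈ e.source) (huv : u ≤ v) (hvw : v ≤ w) :
    arcMass d e u w = arcMass d e u v + arcMass d e v w := by
  unfold arcMass
  rw [← Set.Ico_union_Ico_eq_Ico huv hvw, Set.image_union, d.mass_union]
  have hsub : Set.Icc u w ⊆ e.source := he.out hu hw
  refine Set.disjoint_image_image ?_
  intro x hx y hy hxy
  have := e.injOn (hsub ⟨hx.1, hx.2.le.trans hvw⟩) (hsub ⟨huv.trans hy.1, hy.2.le⟩) hxy
  exact absurd (this ▸ hx.2) (not_lt.2 hy.1)

/-- The expression of the homeomorphism `b` in the chart. -/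
def chartExpr (e : OpenPartialHomeomorph L X) (b : X ≃ₜ X) (w : L) : L := e.symm (b (e w))

theorem continuousOn_chartExpr {b : X ≃ₜ X} {s : Set L} (hs : s ⊆ e.source)
    (hb : ∀ w ∈ s, b (e w) ∈ e.target) : ContinuousOn (chartExpr e b) s :=
  e.symm.continuousOn.comp (b.continuous.comp_continuousOn (e.continuousOn.mono hs)) hb

theorem injOn_chartExpr {b : X ≃ₜ X} {s : Set L} (hs : s ⊆ e.source)
    (hb : ∀ w ∈ s, b (e w) ∈ e.target) : Set.InjOn (chartExpr e b) s := by
  intro x hx y hy hxy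
  exact e.injOn (hs hx) (hs hy) (b.injective (e.symm.injOn (hb x hx) (hb y hy) hxy))

/-- A continuous injection of an interval is monotone and the order of the endpoint images decides
the direction, so a half-open arc goes to a half-open arc. -/
theorem arcMass_chartExpr {b : X ≃ₜ X} (hb : d.Invariant b) {u v : L} (huv : u ≤ v)
    (hs : Set.Icc u v ⊆ e.source) (hmap : ∀ w ∈ Set.Icc u v, b (e w) ∈ e.target)
    (hle : chartExpr e b u ≤ chartExpr e b v) :
    StrictMonoOn (chartExpr e b) (Set.Icc u v) ∧
      arcMass d e (chartExpr e b u) (chartExpr e b v) = arcMass d e u v := by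
  have hc := continuousOn_chartExpr hs hmap
  have hmono := hc.strictMonoOn_of_injOn_Icc huv hle (injOn_chartExpr hs hmap)
  refine ⟨hmono, ?_⟩
  have himg : chartExpr e b '' Set.Ico u v = Set.Ico (chartExpr e b u) (chartExpr e b v) := by
    refine Set.Subset.antisymm ?_ ?_
    · rintro _ ⟨w, hw, rfl⟩
      exact ⟨hmono.monotoneOn ⟨le_rfl, huv⟩ ⟨hw.1, hw.2.le⟩ hw.1,
        hmono ⟨hw.1, hw.2.le⟩ ⟨huv, le_rfl⟩ hw.2⟩
    · intro y hy
      obtain ⟨w, hw, rfl⟩ := intermediate_value_Icc huv hc ⟨hy.1, hy.2.le⟩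
      refine ⟨w, ⟨hw.1, lt_of_le_of_ne hw.2 ?_⟩, rfl⟩
      rintro rfl
      exact lt_irrefl _ hy.2
  unfold arcMass
  rw [← himg, ← hb.mass_image (e '' Set.Ico u v), ← Set.image_comp, ← Set.image_comp]
  congr 1
  refine Set.image_congr fun w hw => ?_
  exact e.right_inv (hmap w ⟨hw.1, hw.2.le⟩)

variable [T2Space X]

/-- An invariant homeomorphism without fixed points on an arc, which moves one point `z` of the arc
to the right, moves all later points to the right by the same mass, as long as there is room. -/
theorem chartExpr_of_room (he : e.source.OrdConnected) {g : X ≃ₜ X} (hg : d.Invariant g)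
    (hfix : ∀ w, g w ≠ w) {z z' v r : L} (hz : z ∈ e.source) (hr : r ∈ e.source)
    (hzz' : z < z') (hgz : g (e z) = e z') (hz'v : z' ≤ v) (hvr : v ≤ r)
    (hroom : arcMass d e z z' < arcMass d e v r) :
    ∀ w ∈ Set.Icc z v, g (e w) ∈ e.target ∧ w < chartExpr e g w ∧ chartExpr e g w ≤ r ∧
      arcMass d e w (chartExpr e g w) = arcMass d e z z' := by
  have hsub : Set.Icc z r ⊆ e.source := he.out hz hr
  have hzv : z ≤ v := hzz'.le.trans hz'v
  have hz'r : z' ≤ r := hz'v.trans hvr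
  have hz's : z' ∈ e.source := hsub ⟨hzz'.le, hz'r⟩
  have hΓz : chartExpr e g z = z' := by rw [chartExpr, hgz, e.left_inv hz's]
  have hKt : e '' Set.Icc z r ⊆ e.target := by
    rintro _ ⟨w, hw, rfl⟩
    exact e.map_source (hsub hw)
  have hKclosed : IsClosed (e '' Set.Icc z r) :=
    (isCompact_Icc.image_of_continuousOn (e.continuousOn.mono hsub)).isClosed
  have hKΓ : ∀ w, g (e w) ∈ e '' Set.Icc z r → chartExpr e g w ∈ Set.Icc z r := by
    rintro w ⟨y, hy, hyw⟩
    rwa [chartExpr, ← hyw, e.left_inv (hsub hy)]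
  -- By the intermediate value theorem, a change of direction would produce a fixed point of `g`.
  have hlt : ∀ u, u ≤ v → z ≤ u → (∀ w ∈ Set.Icc z u, g (e w) ∈ e '' Set.Icc z r) →
      u < chartExpr e g u := by
    intro u huv hzu hu
    by_contra! hcon
    have hs : Set.Icc z u ⊆ e.source := fun w hw => hsub ⟨hw.1, hw.2.trans (huv.trans hvr)⟩
    obtain ⟨w, hw, hw'⟩ := isPreconnected_Icc.intermediate_value₂ (s := Set.Icc z u)
      (a := z) (b := u) ⟨le_rfl, hzu⟩ ⟨hzu, le_rfl⟩ (f := id) (g := chartExpr e g)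
      continuousOn_id (continuousOn_chartExpr hs fun w hw => hKt (hu w hw))
      (by rw [hΓz]; exact hzz'.le) hcon
    refine hfix (e w) ?_
    have := e.right_inv (hKt (hu w hw))
    rw [← this]
    exact congrArg e hw'.symm
  -- Let `u` be the infimum of the points that escape. By continuity `g` must send `u` to the end
  -- `r`. Then `[z, u)` and `[z', r)` have equal mass, so the mass of `[u, r)` is that of `[z, z')`,
  -- against `hroom`.
  have hK : ∀ w ∈ Set.Icc z v, g (e w) ∈ e '' Set.Icc z r := by
    by_contra! hcon
    obtain ⟨w₀, hw₀, hw₀'⟩ := hcon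
    set Bd : Set L := {w | w ∈ Set.Icc z v ∧ g (e w) ∉ e '' Set.Icc z r} with hBd
    have hne : Bd.Nonempty := ⟨w₀, hw₀, hw₀'⟩
    have hbdd : BddBelow Bd := ⟨z, fun w hw => hw.1.1⟩
    set u := sInf Bd with hu
    have hzu : z ≤ u := le_csInf hne fun w hw => hw.1.1
    have huv : u ≤ v := (csInf_le hbdd hne.some_mem).trans hne.some_mem.1.2
    have hus : u ∈ e.source := hsub ⟨hzu, huv.trans hvr⟩
    have hbelow : ∀ w, z ≤ w → w < u → g (e w) ∈ e '' Set.Icc z r := by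
      intro w hzw hwu
      by_contra hw
      exact absurd (csInf_le hbdd (show w ∈ Bd from ⟨⟨hzw, hwu.le.trans huv⟩, hw⟩)) (not_le.2 hwu)
    have hcont : ContinuousAt (fun w => g (e w)) u :=
      g.continuous.continuousAt.comp (e.continuousAt hus)
    have hgu : g (e u) ∈ e '' Set.Icc z r := by
      rcases hzu.eq_or_lt with h | h
      · rw [← h, hgz]
        exact ⟨z', ⟨hzz'.le, hz'r⟩, rfl⟩
      · have : (𝓝[<] u).NeBot := nhdsLT_neBot_of_exists_lt ⟨z, h⟩
        refine hKclosed.mem_of_tendsto (hcont.tendsto.mono_left nhdsWithin_le_nhds :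
          Filter.Tendsto _ (𝓝[<] u) _) ?_
        filter_upwards [Ioo_mem_nhdsLT h] with w hw
        exact hbelow w hw.1.le hw.2
    have hall : ∀ w ∈ Set.Icc z u, g (e w) ∈ e '' Set.Icc z r := by
      intro w hw
      rcases hw.2.eq_or_lt with rfl | h
      exacts [hgu, hbelow w hw.1 h]
    have hlt' := hlt u huv hzu hall
    have hΓu := hKΓ u hgu
    have hΓr : chartExpr e g u = r := by
      refine le_antisymm hΓu.2 (not_lt.1 fun hlt'' => ?_)
      have hopen : IsOpen (e '' Set.Ioo z r) :=
        e.isOpen_image_of_subset_source isOpen_Ioo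
          (Set.Ioo_subset_Icc_self.trans hsub)
      have hmem : g (e u) ∈ e '' Set.Ioo z r :=
        ⟨chartExpr e g u, ⟨hzu.trans_lt hlt', hlt''⟩, e.right_inv (hKt hgu)⟩
      have hev := hcont.eventually (hopen.mem_nhds hmem)
      have hclos : u ∈ closure Bd := csInf_mem_closure hne hbdd
      obtain ⟨w, hw1, hw2⟩ := (mem_closure_iff_frequently.1 hclos).and_eventually hev |>.exists
      exact hw1.2 (Set.image_mono Set.Ioo_subset_Icc_self hw2)
    have hs : Set.Icc z u ⊆ e.source := fun w hw => hsub ⟨hw.1, hw.2.trans (huv.trans hvr)⟩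
    have htr := (arcMass_chartExpr hg hzu hs (fun w hw => hKt (hall w hw))
      (by rw [hΓz, hΓr]; exact hz'r)).2
    rw [hΓz, hΓr] at htr
    have h1 := arcMass_add (d := d) he hz hr hzu (huv.trans hvr)
    have h2 := arcMass_add (d := d) he hz hr hzz'.le hz'r
    have h3 := arcMass_add (d := d) he hus hr huv hvr
    linarith [arcMass_nonneg (d := d) (e := e) u v]
  have hs : Set.Icc z v ⊆ e.source := fun w hw => hsub ⟨hw.1, hw.2.trans hvr⟩
  have hΓlt : ∀ w ∈ Set.Icc z v, w < chartExpr e g w := fun w hw =>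
    hlt w hw.2 hw.1 fun w' hw' => hK w' ⟨hw'.1, hw'.2.trans hw.2⟩
  have hmono := (arcMass_chartExpr hg hzv hs (fun w hw => hKt (hK w hw))
      (by rw [hΓz]; exact hz'v.trans (hΓlt v ⟨hzv, le_rfl⟩).le)).1
  intro w hw
  refine ⟨hKt (hK w hw), hΓlt w hw, (hKΓ w (hK w hw)).2, ?_⟩
  have hz'w : z' ≤ chartExpr e g w := by
    rw [← hΓz]
    exact hmono.monotoneOn ⟨le_rfl, hzv⟩ hw hw.1
  have htr := (arcMass_chartExpr hg hw.1 (fun y hy => hs ⟨hy.1, hy.2.trans hw.2⟩)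
    (fun y hy => hKt (hK y ⟨hy.1, hy.2.trans hw.2⟩)) (by rwa [hΓz])).2
  rw [hΓz] at htr
  have hΓs : chartExpr e g w ∈ e.source := hsub (hKΓ w (hK w hw))
  have h1 := arcMass_add (d := d) he hz hΓs hw.1 (hΓlt w hw).le
  have h2 := arcMass_add (d := d) he hz hΓs hzz'.le hz'w
  linarith

/-- One step of the push to the right, from any starting point at or after `z`. -/
theorem exists_chart_step (he : e.source.OrdConnected) {g : X ≃ₜ X} (hg : d.Invariant g)
    (hfix : ∀ w, g w ≠ w) {z z' r : L} (hz : z ∈ e.source) (hr : r ∈ e.source)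
    (hzz' : z < z') (hgz : g (e z) = e z') (hz'r : z' ≤ r)
    (hroom : arcMass d e z z' < arcMass d e z' r) {v E : L} (hE : E ∈ e.source)
    (hzv : z ≤ v) (hvE : v ≤ E) (hroom' : arcMass d e z z' < arcMass d e v E) :
    ∃ v' ∈ e.source, v < v' ∧ g (e v) = e v' ∧ arcMass d e v v' = arcMass d e z z' := by
  -- Before `z'` the room is supplied by `r`, beyond `z'` by `E`.
  have key : g (e v) ∈ e.target ∧ v < chartExpr e g v ∧
      arcMass d e v (chartExpr e g v) = arcMass d e z z' := by
    rcases le_total z' v with h | h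
    · obtain ⟨h1, h2, -, h3⟩ :=
        chartExpr_of_room he hg hfix hz hE hzz' hgz h hvE hroom' v ⟨hzv, le_rfl⟩
      exact ⟨h1, h2, h3⟩
    · obtain ⟨h1, h2, -, h3⟩ :=
        chartExpr_of_room he hg hfix hz hr hzz' hgz le_rfl hz'r hroom v ⟨hzv, h⟩
      exact ⟨h1, h2, h3⟩
  exact ⟨_, e.map_target key.1, key.2.1, (e.right_inv key.1).symm, key.2.2⟩

/-- Measured by mass, `g` is a translation to the right by the mass of `[z, z')`, so `n` steps fit
as soon as the room exceeds `n` times that mass. -/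
theorem exists_chart_iterate (he : e.source.OrdConnected) {g : X ≃ₜ X} (hg : d.Invariant g)
    (hfix : ∀ w, g w ≠ w) {z z' r : L} (hz : z ∈ e.source) (hr : r ∈ e.source)
    (hzz' : z < z') (hgz : g (e z) = e z') (hz'r : z' ≤ r)
    (hroom : arcMass d e z z' < arcMass d e z' r) {y E : L} (hy : y ∈ e.source)
    (hE : E ∈ e.source) (hzy : z ≤ y) (hyE : y ≤ E) (n : ℕ)
    (hroom' : n * arcMass d e z z' < arcMass d e y E) :
    ∃ y' ∈ e.source, y ≤ y' ∧ y' < E ∧ (g ^ n) (e y) = e y' ∧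
      arcMass d e y y' = n * arcMass d e z z' := by
  have hlt : ∀ y' ∈ e.source, y ≤ y' → arcMass d e y y' < arcMass d e y E → y' < E := by
    intro y' hy' hyy' h
    by_contra! hcon
    have := arcMass_add (d := d) he hy hy' hyE hcon
    linarith [arcMass_nonneg (d := d) (e := e) E y']
  induction n with
  | zero =>
    have h0 : arcMass d e y y = 0 := by simp [arcMass, d.mass_empty]
    exact ⟨y, hy, le_rfl, hlt y hy le_rfl (by simpa [h0] using hroom'), by simp, by simp [h0]⟩
  | succ n ih =>
    push_cast at hroom'
    have hθ := arcMass_nonneg (d := d) (e := e) z z'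
    obtain ⟨y₁, hy₁, hyy₁, hy₁E, hgy₁, hm⟩ := ih (by linarith)
    have hadd := arcMass_add (d := d) he hy hE hyy₁ hy₁E.le
    obtain ⟨y₂, hy₂, hlt₂, hgy₂, hm₂⟩ := exists_chart_step he hg hfix hz hr hzz' hgz hz'r hroom
      hE (hzy.trans hyy₁) hy₁E.le (by linarith)
    have hadd₂ := arcMass_add (d := d) he hy hy₂ hyy₁ hlt₂.le
    have e1 : arcMass d e y y₂ = (n + 1) * arcMass d e z z' := by linarith
    refine ⟨y₂, hy₂, hyy₁.trans hlt₂.le, hlt y₂ hy₂ (hyy₁.trans hlt₂.le) (by linarith), ?_,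
      by push_cast; exact e1⟩
    rw [pow_succ', Homeomorph.mul_apply, hgy₁, hgy₂]

/-- A homeomorphism without fixed points cannot move an arc with room by mass zero. -/
theorem arcMass_ne_zero_of_room (he : e.source.OrdConnected) {g : X ≃ₜ X} (hg : d.Invariant g)
    (hfix : ∀ w, g w ≠ w) {z z' r p : L} (hz : z ∈ e.source) (hr : r ∈ e.source)
    (hzz' : z < z') (hgz : g (e z) = e z') (hz'r : z' ≤ r)
    (hroom : arcMass d e z z' < arcMass d e z' r) (hzp : z ≤ p) (hpr : p ≤ r)
    (hroomp : 0 < arcMass d e p r) : arcMass d e z z' ≠ 0 := by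
  intro hθ
  have hsub : Set.Icc z r ⊆ e.source := he.out hz hr
  have hp : p ∈ e.source := hsub ⟨hzp, hpr⟩
  -- If the step has mass zero, the room is never used up: the whole orbit of `p` is monotone and
  -- stays below `r`, and its limit is a fixed point of `g`.
  have hit := fun n : ℕ => exists_chart_iterate he hg hfix hz hr hzz' hgz hz'r hroom hp hr hzp hpr n
    (by rw [hθ, mul_zero]; exact hroomp)
  choose y hy hpy hyr hgy hmy using hit
  have hmono : Monotone y := by
    refine monotone_nat_of_le_succ fun n => ?_
    have hadd := arcMass_add (d := d) he hp hr (hpy n) (hyr n).le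
    rw [hmy n, hθ] at hadd
    obtain ⟨y', hy', hlt, hg', -⟩ := exists_chart_step he hg hfix hz hr hzz' hgz hz'r hroom
      hr (hzp.trans (hpy n)) (hyr n).le (by linarith)
    have : e (y (n + 1)) = e y' := by
      rw [← hgy, pow_succ', Homeomorph.mul_apply, hgy, hg']
    rw [e.injOn (hy _) hy' this]
    exact hlt.le
  have hbdd : BddAbove (Set.range y) := ⟨r, by rintro _ ⟨n, rfl⟩; exact (hyr n).le⟩
  have htend := tendsto_atTop_ciSup hmono hbdd
  set q := ⨆ n, y n
  have hq : q ∈ e.source := hsub ⟨(hzp.trans (hpy 0)).trans (le_ciSup hbdd 0),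
    ciSup_le fun n => (hyr n).le⟩
  have h1 : Filter.Tendsto (fun n => e (y n)) Filter.atTop (𝓝 (e q)) :=
    (e.continuousAt hq).tendsto.comp htend
  have h2 : Filter.Tendsto (fun n => e (y (n + 1))) Filter.atTop (𝓝 (g (e q))) := by
    refine ((g.continuous.tendsto _).comp h1).congr fun n => ?_
    simp only [Function.comp]
    rw [← hgy, ← hgy, pow_succ', Homeomorph.mul_apply]
  exact hfix _ (tendsto_nhds_unique h2 (h1.comp (Filter.tendsto_add_atTop_nat 1)))

/-- The local incompatibility between `h g = g ^ R h` and an invariant mass. -/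
theorem false_of_semiconj_of_room (he : e.source.OrdConnected) {g h : X ≃ₜ X} {R : ℕ}
    (hR : 2 ≤ R) (hgh : h * g = g ^ R * h) (hg : d.Invariant g) (hh : d.Invariant h)
    (hfix : ∀ w, g w ≠ w) {z z' r p y E : L} (hz : z ∈ e.source) (hr : r ∈ e.source)
    (hzz' : z < z') (hgz : g (e z) = e z') (hz'r : z' ≤ r)
    (hroom : arcMass d e z z' < arcMass d e z' r) (hzp : z ≤ p) (hpr : p ≤ r)
    (hroomp : arcMass d e z z' < arcMass d e p r)
    (hmap : ∀ w ∈ Set.Icc p r, h (e w) ∈ e.target) (hy : y ∈ e.source) (hhp : h (e p) = e y)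
    (hzy : z ≤ y) (hE : E ∈ e.source) (hyE : y ≤ E)
    (hroomy : R * arcMass d e z z' < arcMass d e y E) : False := by
  have hsub : Set.Icc z r ⊆ e.source := he.out hz hr
  have hp : p ∈ e.source := hsub ⟨hzp, hpr⟩
  obtain ⟨p', hp', hpp', hp'r, hgp, hmp⟩ := exists_chart_iterate he hg hfix hz hr hzz' hgz hz'r hroom
    hp hr hzp hpr 1 (by simpa using hroomp)
  obtain ⟨y', hy', hyy', -, hgy, hmy⟩ := exists_chart_iterate he hg hfix hz hr hzz' hgz hz'r hroom
    hy hE hzy hyE R hroomy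
  simp only [pow_one, Nat.cast_one, one_mul] at hgp hmp
  -- One step of `g` from `p` corresponds under `h` to `R` steps from `y`. As `h` preserves mass,
  -- the step length equals `R` times itself.
  have hhp' : h (e p') = e y' := by
    have := DFunLike.congr_fun hgh (e p)
    simp only [Homeomorph.mul_apply] at this
    rw [← hgp, this, hhp, hgy]
  have e1 : chartExpr e h p = y := by rw [chartExpr, hhp, e.left_inv hy]
  have e2 : chartExpr e h p' = y' := by rw [chartExpr, hhp', e.left_inv hy']
  have htr := (arcMass_chartExpr hh hpp' (fun w hw => hsub ⟨hzp.trans hw.1, hw.2.trans hp'r.le⟩)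
    (fun w hw => hmap w ⟨hw.1, hw.2.trans hp'r.le⟩) (by rwa [e1, e2])).2
  rw [e1, e2, hmp, hmy] at htr
  have hR' : (2 : ℝ) ≤ R := by exact_mod_cast hR
  have hθ := arcMass_nonneg (d := d) (e := e) z z'
  refine arcMass_ne_zero_of_room he hg hfix hz hr hzz' hgz hz'r hroom hzp hpr
    (hθ.trans_lt hroomp) ?_
  nlinarith

end Arcs

/-! ### Existence of periodic points -/

section Periodic

variable {X L : Type*} [TopologicalSpace X] [T2Space X] [ConditionallyCompleteLinearOrder L]
  [TopologicalSpace L] [OrderTopology L] [DenselyOrdered L]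
  {d : FinAddProb X} {e : OpenPartialHomeomorph L X} {a : X ≃ₜ X}

theorem FinAddProb.Invariant.mass_singleton (ha : d.Invariant a)
    (hper : ∀ m : ℕ, m ≠ 0 → ∀ p, (a ^ m) p ≠ p) (x : X) : d.mass {x} = 0 := by
  refine le_antisymm (le_of_forall_pos_le_add fun ε hε => ?_) (d.mass_nonneg _)
  obtain ⟨W, -, hx, hW⟩ := ha.exists_mass_lt hper x hε
  linarith [d.mass_mono (Set.singleton_subset_iff.2 hx)]

set_option linter.unusedSectionVars false

theorem FinAddProb.mass_insert_of_null {x : X} (hx : d.mass {x} = 0) (E : Set X) :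
    d.mass (insert x E) = d.mass E := by
  refine le_antisymm ?_ (d.mass_mono (Set.subset_insert x E))
  have := d.mass_union_le {x} E
  rwa [hx, zero_add, Set.singleton_union] at this

theorem mass_image_Ioc (hnull : ∀ x, d.mass {x} = 0) (u v : L) :
    d.mass (e '' Set.Ioc u v) = arcMass d e u v := by
  rcases lt_or_ge u v with h | h
  · unfold arcMass
    rw [← Set.Ioo_insert_left h, ← Set.Ioo_insert_right h, Set.image_insert_eq,
      Set.image_insert_eq, d.mass_insert_of_null (hnull _), d.mass_insert_of_null (hnull _)]
  · simp [arcMass, Set.Ioc_eq_empty (not_lt.2 h), Set.Ico_eq_empty (not_lt.2 h)]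

/-- The orientation-reversing case: the closed end of the arc changes sides, which is harmless
because points are null. -/
theorem arcMass_chartExpr_of_ge (hnull : ∀ x, d.mass {x} = 0) {b : X ≃ₜ X} (hb : d.Invariant b)
    {u v : L} (huv : u ≤ v)
    (hs : Set.Icc u v ⊆ e.source) (hmap : ∀ w ∈ Set.Icc u v, b (e w) ∈ e.target)
    (hle : chartExpr e b v ≤ chartExpr e b u) :
    arcMass d e (chartExpr e b v) (chartExpr e b u) = arcMass d e u v := by
  have hc := continuousOn_chartExpr hs hmap
  have hanti := hc.strictAntiOn_of_injOn_Icc huv hle (injOn_chartExpr hs hmap)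
  have himg : chartExpr e b '' Set.Ioc u v = Set.Ico (chartExpr e b v) (chartExpr e b u) := by
    refine Set.Subset.antisymm ?_ ?_
    · rintro _ ⟨w, hw, rfl⟩
      exact ⟨hanti.antitoneOn ⟨hw.1.le, hw.2⟩ ⟨huv, le_rfl⟩ hw.2,
        hanti ⟨le_rfl, huv⟩ ⟨hw.1.le, hw.2⟩ hw.1⟩
    · intro y hy
      obtain ⟨w, hw, rfl⟩ := intermediate_value_Icc' huv hc ⟨hy.1, hy.2.le⟩
      refine ⟨w, ⟨lt_of_le_of_ne hw.1 ?_, hw.2⟩, rfl⟩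
      rintro rfl
      exact lt_irrefl _ hy.2
  rw [← mass_image_Ioc hnull u v]
  unfold arcMass
  rw [← himg, ← hb.mass_image (e '' Set.Ioc u v), ← Set.image_comp, ← Set.image_comp]
  congr 1
  refine Set.image_congr fun w hw => ?_
  exact e.right_inv (hmap w ⟨hw.1.le, hw.2⟩)

/-- The chart with the reversed order. -/
def dualChart (e : OpenPartialHomeomorph L X) : OpenPartialHomeomorph Lᵒᵈ X :=
  (⟨OrderDual.ofDual, continuous_ofDual, continuous_toDual⟩ : Lᵒᵈ ≃ₜ L).transOpenPartialHomeomorph e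

theorem arcMass_dualChart (hnull : ∀ x, d.mass {x} = 0) (u v : L) :
    arcMass d (dualChart e) (OrderDual.toDual u) (OrderDual.toDual v) = arcMass d e v u := by
  rw [← mass_image_Ioc hnull v u]
  unfold arcMass
  congr 1
  ext x
  constructor
  · rintro ⟨w, hw, rfl⟩
    exact ⟨OrderDual.ofDual w, ⟨hw.2, hw.1⟩, rfl⟩
  · rintro ⟨w, hw, rfl⟩
    exact ⟨OrderDual.toDual w, ⟨hw.2, hw.1⟩, rfl⟩

/-- For a finitely additive mass, null points would not suffice; continuity comes from
neighbourhoods of arbitrarily small mass. -/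
theorem continuousOn_arcMass (he : e.source.OrdConnected) (ha : d.Invariant a)
    (hper : ∀ m : ℕ, m ≠ 0 → ∀ p, (a ^ m) p ≠ p) {l r : L} (hl : l ∈ e.source)
    (hr : r ∈ e.source) : ContinuousOn (arcMass d e l) (Set.Icc l r) := by
  have hsub : Set.Icc l r ⊆ e.source := he.out hl hr
  intro u hu
  rw [ContinuousWithinAt, Metric.tendsto_nhds]
  intro ε hε
  obtain ⟨W, hWo, huW, hW⟩ := ha.exists_mass_lt hper (e u) hε
  have hpre : e ⁻¹' W ∈ 𝓝 u := (e.continuousAt (hsub hu)).preimage_mem_nhds (hWo.mem_nhds huW)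
  obtain ⟨b, c, hubc, hbc, hsubW⟩ := exists_Icc_mem_subset_of_mem_nhds hpre
  have key : ∀ x y, x ∈ Set.Icc b c → y ∈ Set.Icc b c → x ∈ Set.Icc l r → y ∈ Set.Icc l r →
      x ≤ y → |arcMass d e l y - arcMass d e l x| < ε := by
    intro x y hx hy hxl hyl hxy
    have hadd := arcMass_add (d := d) he hl (hsub hyl) hxl.1 hxy
    have : arcMass d e x y ≤ d.mass W := by
      refine d.mass_mono ?_
      rintro _ ⟨w, hw, rfl⟩
      exact hsubW ⟨hx.1.trans hw.1, hw.2.le.trans hy.2⟩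
    rw [hadd, add_sub_cancel_left, abs_of_nonneg (arcMass_nonneg _ _)]
    exact this.trans_lt hW
  filter_upwards [self_mem_nhdsWithin, mem_nhdsWithin_of_mem_nhds hbc] with v hv hvbc
  rw [Real.dist_eq]
  rcases le_total u v with h | h
  · exact key u v hubc hvbc hu hv h
  · rw [abs_sub_comm]
    exact key v u hvbc hubc hv hu h

theorem semiconj_pow_of_conj_eq_sq {Γ : Type*} [Group Γ] {a t : Γ} (h : t * a * t⁻¹ = a ^ 2)
    (n : ℕ) : t ^ n * a = a ^ 2 ^ n * t ^ n := by
  induction n with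
  | zero => simp
  | succ n ih =>
    have h' : SemiconjBy t a (a ^ 2) := by
      rw [← h]; simp [SemiconjBy]
    rw [pow_succ', mul_assoc, ih, ← mul_assoc, (h'.pow_right (2 ^ n)).eq, ← pow_mul, mul_assoc,
      ← pow_succ']

/-- The interior replaces `Ioo` because an interval starting at the endpoint `0` of `ℝ≥0` contains
that endpoint in its interior. -/
theorem interior_Icc_ordConnected (l r : L) : (interior (Set.Icc l r)).OrdConnected := by
  refine ⟨fun u hu w hw v hv => ?_⟩
  rcases hv.1.eq_or_lt with rfl | h1
  · exact hu
  rcases hv.2.eq_or_lt with rfl | h2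
  · exact hw
  exact mem_interior.2 ⟨Set.Ioo u w, fun y hy => ⟨(interior_subset hu).1.trans hy.1.le,
    hy.2.le.trans (interior_subset hw).2⟩, isOpen_Ioo, h1, h2⟩

/-- Recurrence of `a` on a tiny arc in the middle of `[l, r]` supplies the translation `g` needed in
`false_of_semiconj_of_room`; there is ample room around that arc and around its image under `h`. -/
theorem false_of_semiconj_in_chart (he : e.source.OrdConnected) (ha : d.Invariant a)
    (hper : ∀ m : ℕ, m ≠ 0 → ∀ p, (a ^ m) p ≠ p) {h : X ≃ₜ X} (hh : d.Invariant h) {R : ℕ}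
    (hR : 2 ≤ R) (hha : h * a = a ^ R * h) {l r : L} (hl : l ∈ e.source) (hr : r ∈ e.source)
    (hlr : l ≤ r) (hpos : 0 < arcMass d e l r)
    (hmap : ∀ w ∈ Set.Icc l r, h (e w) ∈ e.target) : False := by
  have hsub : Set.Icc l r ⊆ e.source := he.out hl hr
  have hnull := ha.mass_singleton hper
  have hR' : (2 : ℝ) ≤ R := by exact_mod_cast hR
  have hcont := continuousOn_arcMass he ha hper hl hr
  have h0 : arcMass d e l l = 0 := by simp [arcMass, d.mass_empty]
  set w := arcMass d e l r with hw
  -- Chosen so that `(R + 1) * ε = w / 4`: `R` steps of mass at most `ε` fit into the room `w / 2 -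
  -- ε` on either side.
  set ε := w / (4 * (R + 1)) with hε
  have hεpos : 0 < ε := by positivity
  have hεw : ε * (4 * (R + 1)) = w := div_mul_cancel₀ _ (by positivity)
  have hε1 : R * ε < w / 2 - ε := by nlinarith
  have hε2 : ε < w / 2 - ε := by nlinarith
  obtain ⟨σ₁, hσ₁, hm₁⟩ := intermediate_value_Icc hlr hcont
    (show w / 2 ∈ Set.Icc (arcMass d e l l) (arcMass d e l r) by
      rw [h0]; constructor <;> linarith)
  obtain ⟨σ₂, hσ₂, hm₂⟩ := intermediate_value_Icc hlr hcont
    (show w / 2 + ε ∈ Set.Icc (arcMass d e l l) (arcMass d e l r) by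
      rw [h0]; constructor <;> linarith)
  have hσ : σ₁ ≤ σ₂ := by
    by_contra! hcon
    have := arcMass_add (d := d) he hl (hsub hσ₁) hσ₂.1 hcon.le
    linarith [arcMass_nonneg (d := d) (e := e) σ₂ σ₁]
  have hm₁₂ : arcMass d e σ₁ σ₂ = ε := by
    have := arcMass_add (d := d) he hl (hsub hσ₂) hσ₁.1 hσ
    linarith
  have hm₂r : arcMass d e σ₂ r = w / 2 - ε := by
    have := arcMass_add (d := d) he hl hr hσ₂.1 hσ₂.2
    linarith
  -- a return of the arc `[σ₁, σ₂)` to itself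
  obtain ⟨g, z, z', hz, hz', hzz', hgz, hg, hfix, hgh⟩ : ∃ (g : X ≃ₜ X) (z z' : L),
      z ∈ Set.Ico σ₁ σ₂ ∧ z' ∈ Set.Ico σ₁ σ₂ ∧ z < z' ∧ g (e z) = e z' ∧ d.Invariant g ∧
        (∀ w, g w ≠ w) ∧ h * g = g ^ R * h := by
    obtain ⟨k, hk, _, ⟨z, hz, rfl⟩, z', hz', hzk⟩ :=
      ha.exists_return (W := e '' Set.Ico σ₁ σ₂) (by rw [← hm₁₂] at hεpos; exact hεpos)
    have hsc : SemiconjBy h a (a ^ R) := hha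
    have hsc' : h * a ^ k = (a ^ k) ^ R * h := by
      rw [(hsc.pow_right k).eq, ← pow_mul, ← pow_mul, mul_comm]
    rcases lt_trichotomy z z' with hlt | rfl | hlt
    · exact ⟨a ^ k, z, z', hz, hz', hlt, hzk.symm, ha.pow k, hper k hk, hsc'⟩
    · exact absurd hzk.symm (hper k hk _)
    -- A return that moves to the left is replaced by its inverse, which satisfies the same relation
    -- with `h`.
    · refine ⟨(a ^ k)⁻¹, z', z, hz', hz, hlt, ?_, (ha.pow k).inv, fun w hw => ?_, ?_⟩
      · rw [hzk]; exact (a ^ k).symm_apply_apply _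
      · refine hper k hk w ?_
        nth_rewrite 1 [← hw]
        exact (a ^ k).apply_symm_apply _
      · have : SemiconjBy h (a ^ k) ((a ^ k) ^ R) := hsc'
        rw [this.inv_right.eq, inv_pow]
  have hmz : ∀ {x}, x ∈ Set.Ico σ₁ σ₂ → w / 2 ≤ arcMass d e l x ∧ w / 2 - ε ≤ arcMass d e x r := by
    intro x hx
    have hxl : l ≤ x := hσ₁.1.trans hx.1
    have hxr : x ≤ r := hx.2.le.trans hσ₂.2
    have a1 := arcMass_add (d := d) he hl (hsub ⟨hxl, hxr⟩) hσ₁.1 hx.1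
    have a2 := arcMass_add (d := d) he (hsub ⟨hxl, hxr⟩) hr hx.2.le hσ₂.2
    constructor
    · linarith [arcMass_nonneg (d := d) (e := e) σ₁ x]
    · linarith [arcMass_nonneg (d := d) (e := e) x σ₂]
  have hzl : z ∈ Set.Icc l r := ⟨hσ₁.1.trans hz.1, hz.2.le.trans hσ₂.2⟩
  have hz'l : z' ∈ Set.Icc l r := ⟨hσ₁.1.trans hz'.1, hz'.2.le.trans hσ₂.2⟩
  have hθ : arcMass d e z z' ≤ ε := by
    rw [← hm₁₂]
    exact d.mass_mono (Set.image_mono (Set.Ico_subset_Ico hz.1 hz'.2.le))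
  have hRθ : R * arcMass d e z z' ≤ R * ε := by gcongr
  set y := chartExpr e h z with hy
  have hys : y ∈ e.source := e.map_target (hmap z hzl)
  have hhz : h (e z) = e y := (e.right_inv (hmap z hzl)).symm
  have hΓs : ∀ w ∈ Set.Icc l r, chartExpr e h w ∈ e.source := fun w hw => e.map_target (hmap w hw)
  have hl' : l ∈ Set.Icc l r := ⟨le_rfl, hlr⟩
  have hr' : r ∈ Set.Icc l r := ⟨hlr, le_rfl⟩
  -- there is room on both sides of `y`
  obtain ⟨⟨E, hE, hyE, hmE⟩, E', hE', hyE', hmE'⟩ :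
      (∃ E ∈ e.source, y ≤ E ∧ w / 2 - ε ≤ arcMass d e y E) ∧
      (∃ E ∈ e.source, E ≤ y ∧ w / 2 - ε ≤ arcMass d e E y) := by
    have s1 : Set.Icc l z ⊆ Set.Icc l r := Set.Icc_subset_Icc le_rfl hzl.2
    have s2 : Set.Icc z r ⊆ Set.Icc l r := Set.Icc_subset_Icc hzl.1 le_rfl
    rcases (continuousOn_chartExpr hsub hmap).strictMonoOn_of_injOn_Icc' hlr
      (injOn_chartExpr hsub hmap) with hm | hm
    · have c1 := hm.monotoneOn hl' hzl hzl.1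
      have c2 := hm.monotoneOn hzl hr' hzl.2
      refine ⟨⟨chartExpr e h r, hΓs r hr', c2, ?_⟩, chartExpr e h l, hΓs l hl', c1, ?_⟩
      · rw [hy, (arcMass_chartExpr hh hzl.2 (s2.trans hsub) (fun w hw => hmap w (s2 hw)) c2).2]
        exact (hmz hz).2
      · rw [hy, (arcMass_chartExpr hh hzl.1 (s1.trans hsub) (fun w hw => hmap w (s1 hw)) c1).2]
        linarith [(hmz hz).1]
    · have c1 := hm.antitoneOn hl' hzl hzl.1
      have c2 := hm.antitoneOn hzl hr' hzl.2
      refine ⟨⟨chartExpr e h l, hΓs l hl', c1, ?_⟩, chartExpr e h r, hΓs r hr', c2, ?_⟩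
      · rw [hy, arcMass_chartExpr_of_ge hnull hh hzl.1 (s1.trans hsub)
          (fun w hw => hmap w (s1 hw)) c1]
        linarith [(hmz hz).1]
      · rw [hy, arcMass_chartExpr_of_ge hnull hh hzl.2 (s2.trans hsub)
          (fun w hw => hmap w (s2 hw)) c2]
        exact (hmz hz).2
  -- The translation is controlled only on the side of `z` towards which it moves. If `y` lies on
  -- the other side, the order of the chart is reversed and `g` replaced by `g⁻¹`.
  rcases le_total z y with hzy | hzy
  · exact false_of_semiconj_of_room he hR hgh hg hh hfix (hsub hzl) hr hzz' hgz hz'l.2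
      (by linarith [(hmz hz').2]) le_rfl hzl.2 (by linarith [(hmz hz).2])
      (fun w hw => hmap w ⟨hzl.1.trans hw.1, hw.2⟩) hys hhz hzy hE hyE (by linarith)
  · have hed : (dualChart e).source.OrdConnected := by
      refine ⟨fun x hx y hy z hz => ?_⟩
      exact he.out (x := OrderDual.ofDual y) (by exact hy) (y := OrderDual.ofDual x) (by exact hx)
        ⟨hz.2, hz.1⟩
    have hgh' : h * g⁻¹ = g⁻¹ ^ R * h := by
      have : SemiconjBy h g (g ^ R) := hgh
      rw [this.inv_right.eq, inv_pow]
    refine false_of_semiconj_of_room (e := dualChart e) hed hR hgh' hg.inv hh (fun w hw => ?_)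
      (z := OrderDual.toDual z') (z' := OrderDual.toDual z) (r := OrderDual.toDual l)
      (p := OrderDual.toDual z) (y := OrderDual.toDual y) (E := OrderDual.toDual E')
      (by exact hsub hz'l) (by exact hl) (by exact hzz') ?_ (by exact hzl.1) ?_ (by exact hzz'.le)
      (by exact hzl.1) ?_ (fun w hw => ?_) (by exact hys) (by exact hhz) ?_ (by exact hE')
      (by exact hyE') ?_
    · refine hfix w ?_
      nth_rewrite 1 [← hw]
      exact g.apply_symm_apply _
    · change g⁻¹ (e z') = e z
      rw [← hgz]
      exact g.symm_apply_apply _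
    · rw [arcMass_dualChart hnull, arcMass_dualChart hnull]
      linarith [(hmz hz).1]
    · rw [arcMass_dualChart hnull, arcMass_dualChart hnull]
      linarith [(hmz hz).1]
    · exact hmap (OrderDual.ofDual w) ⟨hw.2, (show OrderDual.ofDual w ≤ z from hw.1).trans hzl.2⟩
    · exact hzy.trans hzz'.le
    · rw [arcMass_dualChart hnull, arcMass_dualChart hnull]
      linarith

/-- On a compact one-manifold, a homeomorphism conjugate to its square has a periodic point. -/
theorem exists_periodic_point {X : Type*} [TopologicalSpace X] [T2Space X] [CompactSpace X]
    [ChartedSpace ℝ≥0 X] [Nonempty X] {a t : X ≃ₜ X} (hat : t * a * t⁻¹ = a ^ 2) :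
    ∃ m : ℕ, m ≠ 0 ∧ ∃ p, (a ^ m) p = p := by
  by_contra! hper
  obtain ⟨d, ha, ht⟩ := FinAddProb.exists_invariant hat
  obtain ⟨x, hx⟩ := d.exists_forall_mem_nhds_mass_pos
  -- The `t`-orbit of `x` visits a single chart near `q` at two different times, so a positive power
  -- of `t` maps a small arc around `(t ^ i) x` into that chart. The arc has positive mass by
  -- invariance under `t ^ i`.
  obtain ⟨q, hq⟩ : ∃ q, MapClusterPt q Filter.atTop (fun n : ℕ => (t ^ n) x) :=
    (exists_clusterPt_of_compactSpace _)
  set c := chartAt ℝ≥0 q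
  have hqc : q ∈ c.source := mem_chart_source ℝ≥0 q
  obtain ⟨l₀, r₀, -, hlr₀, hsub₀⟩ := exists_Icc_mem_subset_of_mem_nhds
    (c.open_target.mem_nhds (c.map_source hqc))
  set e := c.symm.restrOpen (interior (Set.Icc l₀ r₀)) isOpen_interior with hedef
  have hes : e.source = interior (Set.Icc l₀ r₀) := by
    rw [hedef, OpenPartialHomeomorph.restrOpen_source]
    exact Set.inter_eq_right.2 (interior_subset.trans hsub₀)
  have he : e.source.OrdConnected := hes ▸ interior_Icc_ordConnected l₀ r₀
  have hqe : e.target ∈ 𝓝 q := by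
    refine e.open_target.mem_nhds ?_
    have h1 : c q ∈ e.source := by rw [hes]; exact mem_interior_iff_mem_nhds.2 hlr₀
    have h2 := e.map_source h1
    rwa [show e (c q) = q from c.left_inv hqc] at h2
  have hfreq := hq.frequently hqe
  obtain ⟨i, hi⟩ := hfreq.exists
  obtain ⟨j, hj, hij⟩ := (hfreq.and_eventually (Filter.eventually_gt_atTop i)).exists
  obtain ⟨n, rfl⟩ := Nat.exists_eq_add_of_lt hij
  have htx : (t ^ (n + 1)) ((t ^ i) x) ∈ e.target := by
    rwa [← Homeomorph.mul_apply, ← pow_add, add_comm, ← add_assoc]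
  set ξ := e.symm ((t ^ i) x)
  have hξ : ξ ∈ e.source := e.map_target hi
  have heξ : e ξ = (t ^ i) x := e.right_inv hi
  have hnhds : e.source ∩ (fun w => (t ^ (n + 1)) (e w)) ⁻¹' e.target ∈ 𝓝 ξ := by
    refine Filter.inter_mem (e.open_source.mem_nhds hξ) ?_
    refine ((t ^ (n + 1)).continuous.continuousAt.comp (e.continuousAt hξ)).preimage_mem_nhds ?_
    exact e.open_target.mem_nhds (by simpa [heξ] using htx)
  obtain ⟨l, r, hξlr, hlr, hsub⟩ := exists_Icc_mem_subset_of_mem_nhds hnhds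
  have hle : l ≤ r := hξlr.1.trans hξlr.2
  have hnull := ha.mass_singleton hper
  refine false_of_semiconj_in_chart he ha hper (ht.pow (n + 1)) (R := 2 ^ (n + 1)) ?_
    (semiconj_pow_of_conj_eq_sq hat (n + 1)) (hsub ⟨le_rfl, hle⟩).1 (hsub ⟨hle, le_rfl⟩).1 hle ?_
    fun w hw => (hsub hw).2
  · rw [pow_succ]
    have := Nat.one_le_two_pow (n := n)
    omega
  · have h1 : e '' Set.Icc l r ∈ 𝓝 ((t ^ i) x) := by
      rw [← heξ, ← e.map_nhds_eq hξ]
      exact Filter.image_mem_map hlr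
    have h2 : 0 < d.mass (e '' Set.Icc l r) := by
      rw [← ht.pow i]
      exact hx _ ((t ^ i).continuous.continuousAt.preimage_mem_nhds h1)
    unfold arcMass
    rwa [← Set.Ico_insert_right hle, Set.image_insert_eq,
      d.mass_insert_of_null (hnull _)] at h2

end Periodic

/-! ### One-sided slopes of piecewise linear homeomorphisms -/

section Slopes

variable {M : Type*} [TopologicalSpace M]

/-- The ray at `p` in the direction `ε` in the chart `c`. -/
noncomputable def chartRay (c : OpenPartialHomeomorph M ℝ≥0) (p : M) (ε δ : ℝ) : M :=
  c.symm (Real.toNNReal (c p + ε * δ))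

/-- `ε` is the direction of a ray at `p`: `1`, or `-1` if `p` is not a boundary point. -/
def IsRayDir (c : OpenPartialHomeomorph M ℝ≥0) (p : M) (ε : ℝ) : Prop :=
  ε = 1 ∨ ε = -1 ∧ 0 < c p

theorem IsRayDir.eventually_nonneg {c : OpenPartialHomeomorph M ℝ≥0} {p : M} {ε : ℝ}
    (h : IsRayDir c p ε) : ∀ᶠ δ in 𝓝[>] (0 : ℝ), 0 ≤ (c p : ℝ) + ε * δ := by
  rcases h with rfl | ⟨rfl, h⟩
  · filter_upwards [self_mem_nhdsWithin] with δ hδ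
    have : (0 : ℝ) < δ := hδ
    have := (c p).coe_nonneg
    linarith
  · have h' : (0 : ℝ) < c p := h
    filter_upwards [Ioo_mem_nhdsGT h'] with δ hδ
    linarith [hδ.2]

theorem tendsto_chartRay {c : OpenPartialHomeomorph M ℝ≥0} {p : M} (hp : p ∈ c.source) (ε : ℝ) :
    Filter.Tendsto (chartRay c p ε) (𝓝[>] 0) (𝓝 p) := by
  have h1 : Filter.Tendsto (fun δ : ℝ => Real.toNNReal (c p + ε * δ)) (𝓝 0) (𝓝 (c p)) := by
    have : Continuous (fun δ : ℝ => Real.toNNReal (c p + ε * δ)) := by fun_prop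
    simpa using this.tendsto 0
  have h2 := (c.continuousAt_symm (c.map_source hp)).tendsto
  rw [c.left_inv hp] at h2
  exact (h2.comp h1).mono_left nhdsWithin_le_nhds

theorem eventually_coe_chartRay {c : OpenPartialHomeomorph M ℝ≥0} {p : M} (hp : p ∈ c.source)
    {ε : ℝ} (hε : IsRayDir c p ε) :
    ∀ᶠ δ in 𝓝[>] (0 : ℝ), (c (chartRay c p ε δ) : ℝ) = c p + ε * δ := by
  have h1 : Filter.Tendsto (fun δ : ℝ => Real.toNNReal (c p + ε * δ)) (𝓝[>] 0) (𝓝 (c p)) := by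
    have : Continuous (fun δ : ℝ => Real.toNNReal (c p + ε * δ)) := by fun_prop
    simpa using (this.tendsto 0).mono_left (nhdsWithin_le_nhds (s := Set.Ioi (0 : ℝ)))
  filter_upwards [h1.eventually (c.open_target.mem_nhds (c.map_source hp)), hε.eventually_nonneg]
    with δ h2 h3
  rw [chartRay, c.right_inv h2, Real.coe_toNNReal _ h3]

theorem tendsto_const_mul_nhdsGT {κ : ℝ} (hκ : 0 < κ) :
    Filter.Tendsto (fun δ : ℝ => κ * δ) (𝓝[>] 0) (𝓝[>] 0) := by
  refine tendsto_nhdsWithin_iff.2 ⟨?_, ?_⟩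
  · have : Continuous fun δ : ℝ => κ * δ := by fun_prop
    simpa using (this.tendsto 0).mono_left (nhdsWithin_le_nhds (s := Set.Ioi (0 : ℝ)))
  · filter_upwards [self_mem_nhdsWithin] with δ hδ
    exact mul_pos hκ hδ

/-- The one or two rays at `p` together with `p` fill a neighbourhood. -/
theorem eventually_nhds_of_chartRay {c : OpenPartialHomeomorph M ℝ≥0} {p : M} (hp : p ∈ c.source)
    {P : M → Prop} (h0 : P p)
    (h : ∀ ε, IsRayDir c p ε → ∀ᶠ δ in 𝓝[>] (0 : ℝ), P (chartRay c p ε δ)) :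
    ∀ᶠ q in 𝓝 p, P q := by
  have key : ∀ᶠ y in 𝓝 (c p), P (c.symm y) := by
    obtain ⟨η₁, hη₁, h₁⟩ := mem_nhdsGT_iff_exists_Ioo_subset.1 (h 1 (Or.inl rfl))
    have hright : ∀ᶠ y in 𝓝 (c p), c p < y → P (c.symm y) := by
      have hlt : ∀ᶠ y : ℝ≥0 in 𝓝 (c p), (y : ℝ) < c p + η₁ :=
        (NNReal.continuous_coe.tendsto (c p)).eventually
          (gt_mem_nhds (by linarith [show (0 : ℝ) < η₁ from hη₁]))
      filter_upwards [hlt] with y hy hlt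
      have hlt' : (c p : ℝ) < y := hlt
      have := h₁ (show (y : ℝ) - c p ∈ Set.Ioo 0 η₁ from ⟨by linarith, by linarith⟩)
      simpa [chartRay] using this
    have hleft : ∀ᶠ y in 𝓝 (c p), y < c p → P (c.symm y) := by
      rcases eq_or_lt_of_le (zero_le : 0 ≤ c p) with h0 | h0
      · refine Filter.Eventually.of_forall fun y hy => ?_
        rw [← h0] at hy
        exact absurd hy (not_lt.2 zero_le)
      · obtain ⟨η₂, hη₂, h₂⟩ := mem_nhdsGT_iff_exists_Ioo_subset.1 (h (-1) (Or.inr ⟨rfl, h0⟩))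
        have hlt : ∀ᶠ y : ℝ≥0 in 𝓝 (c p), (c p : ℝ) - η₂ < y :=
          (NNReal.continuous_coe.tendsto (c p)).eventually
            (lt_mem_nhds (by linarith [show (0 : ℝ) < η₂ from hη₂]))
        filter_upwards [hlt] with y hy hlt
        have hlt' : (y : ℝ) < c p := hlt
        have := h₂ (show (c p : ℝ) - y ∈ Set.Ioo 0 η₂ from ⟨by linarith, by linarith⟩)
        simpa [chartRay] using this
    filter_upwards [hright, hleft] with y h1 h2
    rcases lt_trichotomy y (c p) with h | rfl | h
    · exact h2 h
    · rwa [c.left_inv hp]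
    · exact h1 h
  filter_upwards [(c.continuousAt hp).eventually key, c.open_source.mem_nhds hp] with q hq hqs
  rwa [c.left_inv hqs] at hq

variable [ChartedSpace ℝ≥0 M]

theorem IsPLHomeo.isPLAt {h : M ≃ₜ M} (hh : IsPLHomeo h) {c c' : OpenPartialHomeomorph M ℝ≥0}
    (hc : c ∈ atlas ℝ≥0 M) (hc' : c' ∈ atlas ℝ≥0 M) {p : M} (hp : p ∈ c.source)
    (hp' : h p ∈ c'.source) : IsPLAt (fun y => c' (h (c.symm y))) (c p) := by
  have := (mem_groupoid_of_pregroupoid.1 (hh c c' hc hc')).1 (c p)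
    (by simp [c.map_source hp, c.left_inv hp, hp'])
  exact this

/-- A piecewise linear homeomorphism maps rays to rays. -/
theorem IsPLHomeo.chartRay_image {h : M ≃ₜ M} (hh : IsPLHomeo h)
    {c c' : OpenPartialHomeomorph M ℝ≥0} (hc : c ∈ atlas ℝ≥0 M) (hc' : c' ∈ atlas ℝ≥0 M) {p : M}
    (hp : p ∈ c.source) (hp' : h p ∈ c'.source) {ε : ℝ} (hε : IsRayDir c p ε) :
    ∃ ε' κ, 0 < κ ∧ IsRayDir c' (h p) ε' ∧
      ∀ᶠ δ in 𝓝[>] (0 : ℝ), h (chartRay c p ε δ) = chartRay c' (h p) ε' (κ * δ) := by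
  have hPL := hh.isPLAt hc hc' hp hp'
  have hy : Filter.Tendsto (fun δ : ℝ => Real.toNNReal (c p + ε * δ)) (𝓝[>] 0) (𝓝 (c p)) := by
    have : Continuous (fun δ : ℝ => Real.toNNReal (c p + ε * δ)) := by fun_prop
    simpa using (this.tendsto 0).mono_left (nhdsWithin_le_nhds (s := Set.Ioi (0 : ℝ)))
  have hray := tendsto_chartRay hp ε
  have hsrc : ∀ᶠ δ in 𝓝[>] (0 : ℝ), h (chartRay c p ε δ) ∈ c'.source :=
    ((h.continuous.tendsto p).comp hray).eventually (c'.open_source.mem_nhds hp')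
  obtain ⟨η, hη⟩ : ∃ η : ℝ, ∀ᶠ δ in 𝓝[>] (0 : ℝ),
      (c' (h (chartRay c p ε δ)) : ℝ) = c' (h p) + η * δ := by
    have hnn := hε.eventually_nonneg
    have hpos : ∀ᶠ δ in 𝓝[>] (0 : ℝ), 0 < δ := self_mem_nhdsWithin
    rcases hε with rfl | ⟨rfl, -⟩
    · obtain ⟨s, hs⟩ := hPL.2
      refine ⟨s, ?_⟩
      have hw : Filter.Tendsto (fun δ : ℝ => Real.toNNReal (c p + 1 * δ)) (𝓝[>] 0)
          (𝓝[≥] (c p)) := by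
        refine tendsto_nhdsWithin_iff.2 ⟨hy, ?_⟩
        filter_upwards [hnn, hpos] with δ h1 h2
        rw [Set.mem_Ici, ← NNReal.coe_le_coe, Real.coe_toNNReal _ h1]
        linarith
      filter_upwards [hw.eventually hs, hnn] with δ h1 h2
      rw [Real.coe_toNNReal _ h2, c.left_inv hp] at h1
      rw [chartRay, h1]; ring
    · obtain ⟨s, hs⟩ := hPL.1
      refine ⟨-s, ?_⟩
      have hw : Filter.Tendsto (fun δ : ℝ => Real.toNNReal (c p + -1 * δ)) (𝓝[>] 0)
          (𝓝[≤] (c p)) := by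
        refine tendsto_nhdsWithin_iff.2 ⟨hy, ?_⟩
        filter_upwards [hnn, hpos] with δ h1 h2
        rw [Set.mem_Iic, ← NNReal.coe_le_coe, Real.coe_toNNReal _ h1]
        linarith
      filter_upwards [hw.eventually hs, hnn] with δ h1 h2
      rw [Real.coe_toNNReal _ h2, c.left_inv hp] at h1
      rw [chartRay, h1]; ring
  have hcoord := eventually_coe_chartRay hp hε
  -- A zero slope would collapse the ray, against injectivity of `h`; the sign of `η` then gives the
  -- direction of the image ray.
  have hη0 : η ≠ 0 := by
    rintro rfl
    obtain ⟨δ, ⟨⟨h1, h2⟩, h3⟩, h4⟩ := ((hη.and hsrc).and hcoord |>.and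
      (self_mem_nhdsWithin : Set.Ioi (0 : ℝ) ∈ 𝓝[>] 0)).exists
    have h5 : c' (h (chartRay c p ε δ)) = c' (h p) := by
      rw [← NNReal.coe_inj, h1]; ring
    have h6 := h.injective (c'.injOn h2 hp' h5)
    rw [h6] at h3
    have h7 : ε * δ = 0 := by linarith
    have h8 : ε ≠ 0 := by rcases hε with rfl | ⟨rfl, -⟩ <;> norm_num
    exact (mul_ne_zero h8 (ne_of_gt h4)) h7
  have hback : ∀ᶠ δ in 𝓝[>] (0 : ℝ), h (chartRay c p ε δ) =
      c'.symm (Real.toNNReal (c' (h p) + η * δ)) := by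
    filter_upwards [hη, hsrc] with δ h1 h2
    rw [← h1, Real.toNNReal_coe, c'.left_inv h2]
  rcases lt_or_gt_of_ne hη0 with hneg | hpos
  · refine ⟨-1, -η, by linarith, Or.inr ⟨rfl, ?_⟩, ?_⟩
    · obtain ⟨δ, h1, h2⟩ := (hη.and (self_mem_nhdsWithin : Set.Ioi (0 : ℝ) ∈ 𝓝[>] 0)).exists
      have h3 := (c' (h (chartRay c p ε δ))).coe_nonneg
      have h4 : η * δ < 0 := mul_neg_of_neg_of_pos hneg h2
      have : (0 : ℝ) < c' (h p) := by linarith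
      exact_mod_cast this
    · filter_upwards [hback] with δ h1
      rw [h1, chartRay]
      congr 3
      ring
  · refine ⟨1, η, hpos, Or.inl rfl, ?_⟩
    filter_upwards [hback] with δ h1
    rw [h1, chartRay, one_mul]

/-- `b`, which fixes `p`, acts on some ray at `p` by the homothety of ratio `s`. -/
def HasSlope (b : M ≃ₜ M) (p : M) (s : ℝ) : Prop :=
  ∃ c ∈ atlas ℝ≥0 M, p ∈ c.source ∧ ∃ ε, IsRayDir c p ε ∧
    ∀ᶠ δ in 𝓝[>] (0 : ℝ), b (chartRay c p ε δ) = chartRay c p ε (s * δ)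

/-- The set of all ratios at all fixed points. -/
def slopeSet (b : M ≃ₜ M) : Set ℝ := {s | 0 < s ∧ ∃ p, b p = p ∧ HasSlope b p s}

/-- The stretching factor of `t` along the ray cancels, and the chart at `t p` is arbitrary. With `t
= 1` this says that slopes do not depend on the chart. -/
theorem HasSlope.conj {b t : M ≃ₜ M} (ht : IsPLHomeo t) {p : M} {s : ℝ} (hs : 0 < s)
    (h : HasSlope b p s) {c' : OpenPartialHomeomorph M ℝ≥0} (hc' : c' ∈ atlas ℝ≥0 M)
    (hp' : t p ∈ c'.source) : ∃ ε, IsRayDir c' (t p) ε ∧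
      ∀ᶠ δ in 𝓝[>] (0 : ℝ), (t * b * t⁻¹) (chartRay c' (t p) ε δ) =
        chartRay c' (t p) ε (s * δ) := by
  obtain ⟨c, hc, hp, ε, hε, hev⟩ := h
  obtain ⟨ε', κ, hκ, hε', himg⟩ := ht.chartRay_image hc hc' hp hp' hε
  refine ⟨ε', hε', ?_⟩
  have t1 := tendsto_const_mul_nhdsGT (inv_pos.2 hκ)
  have t2 := (tendsto_const_mul_nhdsGT hs).comp t1
  filter_upwards [t1.eventually himg, t1.eventually hev, t2.eventually himg] with δ h1 h2 h3
  simp only [Function.comp] at h3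
  rw [mul_inv_cancel_left₀ hκ.ne'] at h1
  have h4 : t⁻¹ (chartRay c' (t p) ε' δ) = chartRay c p ε (κ⁻¹ * δ) := by
    rw [← h1]; exact t.symm_apply_apply _
  rw [Homeomorph.mul_apply, Homeomorph.mul_apply, h4, h2, h3]
  congr 1
  field_simp

theorem slopeSet_conj {b t : M ≃ₜ M} (ht : IsPLHomeo t) {s : ℝ} (hs : s ∈ slopeSet b) :
    s ∈ slopeSet (t * b * t⁻¹) := by
  obtain ⟨hs, p, hp, h⟩ := hs
  refine ⟨hs, t p, ?_, ?_⟩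
  · rw [Homeomorph.mul_apply, Homeomorph.mul_apply, Homeomorph.inv_apply, t.symm_apply_apply, hp]
  · exact ⟨chartAt ℝ≥0 (t p), chart_mem_atlas _ _, mem_chart_source _ _,
      h.conj ht hs (chart_mem_atlas _ _) (mem_chart_source _ _)⟩

theorem slopeSet_sq {b : M ≃ₜ M} {s : ℝ} (hs : s ∈ slopeSet b) : s ^ 2 ∈ slopeSet (b ^ 2) := by
  obtain ⟨hs, p, hp, c, hc, hpc, ε, hε, hev⟩ := hs
  refine ⟨by positivity, p, ?_, c, hc, hpc, ε, hε, ?_⟩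
  · rw [pow_two, Homeomorph.mul_apply, hp, hp]
  · filter_upwards [hev, (tendsto_const_mul_nhdsGT hs).eventually hev] with δ h1 h2
    rw [pow_two, Homeomorph.mul_apply, h1, h2]
    congr 1
    ring

/-- Near a fixed point `q` the map is affine on each side of `q`, so fixed points close to `q` only
see the two slopes at `q`. -/
theorem exists_nhds_finite_slopes [T2Space M] {b : M ≃ₜ M} (hb : IsPLHomeo b)
    (h1 : IsPLHomeo (1 : M ≃ₜ M)) (q : M) :
    ∃ V ∈ 𝓝 q, ∃ Φ : Set ℝ, Φ.Finite ∧ ∀ p ∈ V, ∀ s, 0 < s → b p = p → HasSlope b p s → s ∈ Φ := by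
  by_cases hq : b q = q
  swap
  · refine ⟨{p | b p ≠ p}, ?_, ∅, Set.finite_empty, fun p hp s _ hp' _ => absurd hp' hp⟩
    exact (isOpen_ne_fun b.continuous continuous_id).mem_nhds hq
  set c := chartAt ℝ≥0 q
  have hqc : q ∈ c.source := mem_chart_source _ _
  have hc : c ∈ atlas ℝ≥0 M := chart_mem_atlas _ _
  have hPL := hb.isPLAt hc hc hqc (hq.symm ▸ hqc)
  obtain ⟨⟨sL, hL⟩, ⟨sR, hR⟩⟩ := hPL
  rw [eventually_nhdsWithin_iff] at hL hR
  refine ⟨c.source ∩ c ⁻¹' {y | ∀ᶠ y' in 𝓝 y, _}, Filter.inter_mem (c.open_source.mem_nhds hqc)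
    ((c.continuousAt hqc).eventually (eventually_eventually_nhds.2 (hL.and hR))), {sL, sR},
    by simp, ?_⟩
  rintro p ⟨hpc, hp⟩ s hs hbp hslope
  have hconj := hslope.conj h1 hs hc (by exact hpc)
  simp only [one_mul, inv_one, mul_one, Homeomorph.one_apply] at hconj
  obtain ⟨ε, hε, hev⟩ := hconj
  have hε0 : ε ≠ 0 := by rcases hε with rfl | ⟨rfl, -⟩ <;> norm_num
  have hray := tendsto_chartRay hpc ε
  have hev1 := eventually_coe_chartRay hpc hε
  have hev2 := (tendsto_const_mul_nhdsGT hs).eventually hev1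
  have hcr : Filter.Tendsto (fun δ => c (chartRay c p ε δ)) (𝓝[>] 0) (𝓝 (c p)) :=
    (c.continuousAt hpc).tendsto.comp hray
  have hev3 := hcr.eventually hp
  have hev4 := hray.eventually (c.open_source.mem_nhds hpc)
  -- The point `p` and its ray lie on one side of `q`, hence on one affine piece; subtracting the
  -- two affine formulas isolates the slope.
  have hside : ∀ᶠ δ in 𝓝[>] (0 : ℝ), (c q ≤ c p ∧ c q ≤ c (chartRay c p ε δ)) ∨
      (c p ≤ c q ∧ c (chartRay c p ε δ) ≤ c q) := by
    rcases lt_trichotomy (c q) (c p) with h | h | h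
    · filter_upwards [hcr.eventually (lt_mem_nhds h)] with δ hδ
      exact Or.inl ⟨h.le, hδ.le⟩
    · filter_upwards with δ
      rcases le_total (c q) (c (chartRay c p ε δ)) with h' | h'
      exacts [Or.inl ⟨h.le, h'⟩, Or.inr ⟨h.ge, h'⟩]
    · filter_upwards [hcr.eventually (gt_mem_nhds h)] with δ hδ
      exact Or.inr ⟨h.le, hδ.le⟩
  obtain ⟨δ, ⟨⟨⟨⟨⟨e0, e1⟩, e2⟩, e3⟩, e4⟩, e5⟩, hδ⟩ := (hev.and hev1 |>.and hev2 |>.and hev3 |>.and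
    hev4 |>.and hside |>.and (self_mem_nhdsWithin : Set.Ioi (0 : ℝ) ∈ 𝓝[>] 0)).exists
  have hδ0 : ε * δ ≠ 0 := mul_ne_zero hε0 (ne_of_gt hδ)
  have hp0 := hp.self_of_nhds
  beta_reduce at hp0 e3
  rw [c.left_inv hpc, hbp, c.left_inv hqc, hq] at hp0
  rw [c.left_inv e4, e0, c.left_inv hqc, hq, e2] at e3
  rcases e5 with ⟨h5, h6⟩ | ⟨h5, h6⟩
  · have r1 := hp0.2 h5
    have r2 := e3.2 h6
    rw [e1] at r2
    right
    have : s * (ε * δ) = sR * (ε * δ) := by linarith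
    exact mul_right_cancel₀ hδ0 this
  · have r1 := hp0.1 h5
    have r2 := e3.1 h6
    rw [e1] at r2
    left
    have : s * (ε * δ) = sL * (ε * δ) := by linarith
    exact mul_right_cancel₀ hδ0 this

theorem finite_slopeSet [T2Space M] [CompactSpace M] {b : M ≃ₜ M} (hb : IsPLHomeo b)
    (h1 : IsPLHomeo (1 : M ≃ₜ M)) : (slopeSet b).Finite := by
  choose V hV Φ hΦ h using exists_nhds_finite_slopes hb h1
  obtain ⟨S, hS⟩ := CompactSpace.elim_nhds_subcover V hV
  refine (S.finite_toSet.biUnion fun q _ => hΦ q).subset ?_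
  rintro s ⟨hs, p, hp, hslope⟩
  have : p ∈ ⋃ x ∈ S, V x := hS ▸ Set.mem_univ p
  simp only [Set.mem_iUnion] at this ⊢
  obtain ⟨q, hq, hpq⟩ := this
  exact ⟨q, hq, h q p hpq s hs hp hslope⟩

/-- Squares of slopes of `b` are slopes of `b ^ 2`, hence of its conjugate `b`. The successive
squares of a positive number other than 1 are all distinct, against finiteness. -/
theorem slopeSet_subset_one [T2Space M] [CompactSpace M] {b t : M ≃ₜ M} (hb : IsPLHomeo b)
    (ht : IsPLHomeo t⁻¹) (h1 : IsPLHomeo (1 : M ≃ₜ M)) (hbt : t * b * t⁻¹ = b ^ 2) {s : ℝ}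
    (hs : s ∈ slopeSet b) : s = 1 := by
  have hsq : ∀ s ∈ slopeSet b, s ^ 2 ∈ slopeSet b := by
    intro s hs
    have := slopeSet_conj ht (slopeSet_sq hs)
    rwa [← hbt, show t⁻¹ * (t * b * t⁻¹) * t⁻¹⁻¹ = b by group] at this
  have hpow : ∀ n : ℕ, s ^ 2 ^ n ∈ slopeSet b := by
    intro n
    induction n with
    | zero => simpa using hs
    | succ n ih => rw [pow_succ, pow_mul]; exact hsq _ ih
  by_contra hne
  refine (Set.infinite_of_injective_forall_mem (f := fun n : ℕ => s ^ 2 ^ n) ?_ hpow)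
    (finite_slopeSet hb h1)
  exact (pow_right_injective₀ hs.1 hne).comp (Nat.pow_right_injective le_rfl)

/-- Near a fixed point, a piecewise linear homeomorphism with trivial slopes is the identity or a
reflection. -/
theorem germ_dichotomy {b : M ≃ₜ M} (hb : IsPLHomeo b) (hs : ∀ s ∈ slopeSet b, s = 1)
    (hs2 : ∀ s ∈ slopeSet (b ^ 2), s = 1) {p : M} (hp : b p = p) :
    (∀ᶠ q in 𝓝 p, b q = q) ∨
      ((∀ᶠ q in 𝓝 p, (b ^ 2) q = q) ∧ ∀ᶠ q in 𝓝 p, q ≠ p → b q ≠ q) := by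
  set c := chartAt ℝ≥0 p
  have hpc : p ∈ c.source := mem_chart_source _ _
  have hc : c ∈ atlas ℝ≥0 M := chart_mem_atlas _ _
  have hp2 : (b ^ 2) p = p := by rw [pow_two, Homeomorph.mul_apply, hp, hp]
  have himg : ∀ ε, IsRayDir c p ε → ∃ ε' κ, 0 < κ ∧ IsRayDir c p ε' ∧
      ∀ᶠ δ in 𝓝[>] (0 : ℝ), b (chartRay c p ε δ) = chartRay c p ε' (κ * δ) := by
    intro ε hε
    have := hb.chartRay_image hc hc hpc (hp.symm ▸ hpc) hε
    rwa [hp] at this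
  have hsame : ∀ ε κ, IsRayDir c p ε → 0 < κ →
      (∀ᶠ δ in 𝓝[>] (0 : ℝ), b (chartRay c p ε δ) = chartRay c p ε (κ * δ)) →
      ∀ᶠ δ in 𝓝[>] (0 : ℝ), b (chartRay c p ε δ) = chartRay c p ε δ := by
    intro ε κ hε hκ hev
    obtain rfl := hs κ ⟨hκ, p, hp, c, hc, hpc, ε, hε, hev⟩
    simpa using hev
  have hd1 : IsRayDir c p 1 := Or.inl rfl
  -- Two different rays cannot share their image. So `b` either preserves each ray or exchanges the
  -- two; a boundary point has only one ray.
  have hinj : ∀ ε' κ₁ κ₂, IsRayDir c p (-1) → 0 < κ₁ → 0 < κ₂ →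
      (∀ᶠ δ in 𝓝[>] (0 : ℝ), b (chartRay c p 1 δ) = chartRay c p ε' (κ₁ * δ)) →
      (∀ᶠ δ in 𝓝[>] (0 : ℝ), b (chartRay c p (-1) δ) = chartRay c p ε' (κ₂ * δ)) → False := by
    intro ε' κ₁ κ₂ hd2 hκ₁ hκ₂ h1 h2
    have t1 := tendsto_const_mul_nhdsGT (inv_pos.2 hκ₁)
    have t2 := tendsto_const_mul_nhdsGT (inv_pos.2 hκ₂)
    obtain ⟨δ, ⟨⟨⟨e1, e2⟩, e3⟩, e4⟩, hδ⟩ := ((t1.eventually h1).and (t2.eventually h2) |>.and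
      (t1.eventually (eventually_coe_chartRay hpc hd1)) |>.and
      (t2.eventually (eventually_coe_chartRay hpc hd2)) |>.and
      (self_mem_nhdsWithin : Set.Ioi (0 : ℝ) ∈ 𝓝[>] 0)).exists
    rw [mul_inv_cancel_left₀ hκ₁.ne'] at e1
    rw [mul_inv_cancel_left₀ hκ₂.ne', ← e1] at e2
    rw [b.injective e2, e3] at e4
    have p1 : 0 < κ₁⁻¹ * δ := mul_pos (inv_pos.2 hκ₁) hδ
    have p2 : 0 < κ₂⁻¹ * δ := mul_pos (inv_pos.2 hκ₂) hδ
    linarith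
  obtain ⟨ε₁, κ₁, hκ₁, hε₁, h₁⟩ := himg 1 hd1
  rcases hε₁ with rfl | ⟨rfl, hpos⟩
  · left
    refine eventually_nhds_of_chartRay hpc hp ?_
    rintro ε hε
    rcases hε with rfl | ⟨rfl, hpos⟩
    · exact hsame 1 κ₁ hd1 hκ₁ h₁
    · have hd2 : IsRayDir c p (-1) := Or.inr ⟨rfl, hpos⟩
      obtain ⟨ε₂, κ₂, hκ₂, hε₂, h₂⟩ := himg (-1) hd2
      rcases hε₂ with rfl | ⟨rfl, -⟩
      · exact (hinj 1 κ₁ κ₂ hd2 hκ₁ hκ₂ h₁ h₂).elim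
      · exact hsame (-1) κ₂ hd2 hκ₂ h₂
  · right
    have hd2 : IsRayDir c p (-1) := Or.inr ⟨rfl, hpos⟩
    obtain ⟨ε₂, κ₂, hκ₂, hε₂, h₂⟩ := himg (-1) hd2
    rcases hε₂ with rfl | ⟨rfl, -⟩
    swap
    · exact (hinj (-1) κ₁ κ₂ hd2 hκ₁ hκ₂ h₁ h₂).elim
    -- When the rays are exchanged, only `b ^ 2` has slopes, namely the products `κ' * κ`, and these
    -- are 1 by `hs2`.
    have hsq : ∀ ε ε' κ κ', IsRayDir c p ε → 0 < κ → 0 < κ' →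
        (∀ᶠ δ in 𝓝[>] (0 : ℝ), b (chartRay c p ε δ) = chartRay c p ε' (κ * δ)) →
        (∀ᶠ δ in 𝓝[>] (0 : ℝ), b (chartRay c p ε' δ) = chartRay c p ε (κ' * δ)) →
        ∀ᶠ δ in 𝓝[>] (0 : ℝ), (b ^ 2) (chartRay c p ε δ) = chartRay c p ε δ := by
      intro ε ε' κ κ' hε hκ hκ' h h'
      have hev : ∀ᶠ δ in 𝓝[>] (0 : ℝ), (b ^ 2) (chartRay c p ε δ) =
          chartRay c p ε (κ' * κ * δ) := by
        filter_upwards [h, (tendsto_const_mul_nhdsGT hκ).eventually h'] with δ e1 e2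
        rw [pow_two, Homeomorph.mul_apply, e1, e2, mul_assoc]
      have hone := hs2 (κ' * κ) ⟨mul_pos hκ' hκ, p, hp2, c, hc, hpc, ε, hε, hev⟩
      simpa [hone] using hev
    have hmove : ∀ ε κ, IsRayDir c p ε → IsRayDir c p (-ε) → 0 < κ →
        (∀ᶠ δ in 𝓝[>] (0 : ℝ), b (chartRay c p ε δ) = chartRay c p (-ε) (κ * δ)) →
        ∀ᶠ δ in 𝓝[>] (0 : ℝ), chartRay c p ε δ ≠ p → b (chartRay c p ε δ) ≠ chartRay c p ε δ := by
      intro ε κ hε hε' hκ h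
      filter_upwards [h, eventually_coe_chartRay hpc hε, (tendsto_const_mul_nhdsGT hκ).eventually
        (eventually_coe_chartRay hpc hε'), self_mem_nhdsWithin] with δ e1 e2 e3 e4 _ e5
      have e4 : 0 < δ := e4
      rw [← e1, e5, e2] at e3
      have hε0 : ε ≠ 0 := by rcases hε with rfl | ⟨rfl, -⟩ <;> norm_num
      have : ε * (δ + κ * δ) = 0 := by linarith
      exact mul_ne_zero hε0 (by positivity) this
    refine ⟨eventually_nhds_of_chartRay hpc hp2 ?_,
      eventually_nhds_of_chartRay hpc (fun h => absurd rfl h) ?_⟩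
    · rintro ε (rfl | ⟨rfl, -⟩)
      exacts [hsq _ _ κ₁ κ₂ hd1 hκ₁ hκ₂ h₁ h₂, hsq _ _ κ₂ κ₁ hd2 hκ₂ hκ₁ h₂ h₁]
    · rintro ε (rfl | ⟨rfl, -⟩)
      · exact hmove 1 κ₁ hd1 hd2 hκ₁ h₁
      · exact hmove (-1) κ₂ hd2 (by simpa using hd1) hκ₂ (by simpa using h₂)

end Slopes

/-! ### The relation `t a t⁻¹ = a²` in groups of piecewise linear homeomorphisms -/

section NoAction

theorem locallyConnectedSpace_nnreal : LocallyConnectedSpace ℝ≥0 := by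
  rw [locallyConnectedSpace_iff_connected_subsets]
  intro x U hU
  obtain ⟨b, c, -, h, hsub⟩ := exists_Icc_mem_subset_of_mem_nhds hU
  exact ⟨_, h, isPreconnected_Icc, hsub⟩

theorem conj_pow_eq_sq {Γ : Type*} [Group Γ] {a t : Γ} (hat : t * a * t⁻¹ = a ^ 2) (m : ℕ) :
    t * a ^ m * t⁻¹ = (a ^ m) ^ 2 := by
  rw [← conj_pow, hat, pow_right_comm]

variable {M : Type*} [TopologicalSpace M]

/-- The fixed point set of a homeomorphism. -/
def fixedSet (b : M ≃ₜ M) : Set M := {p | b p = p}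

theorem pow_apply_eq_of_apply_eq {b : M ≃ₜ M} {p : M} (h : b p = p) (n : ℕ) : (b ^ n) p = p := by
  induction n with
  | zero => rfl
  | succ n ih => rw [pow_succ, Homeomorph.mul_apply, h, ih]

variable [T2Space M] [CompactSpace M] [ChartedSpace ℝ≥0 M]

/-- A limit of interior fixed points is a non-isolated fixed point unless it is itself interior, so
`germ_dichotomy` rules out a reflection there. At reflections, squaring gives the identity nearby.
-/
theorem isClopen_interior_fixedSet {b t : M ≃ₜ M} (hb : IsPLHomeo b) (hb2 : IsPLHomeo (b ^ 2))
    (ht : IsPLHomeo t⁻¹) (h1 : IsPLHomeo (1 : M ≃ₜ M)) (hbt : t * b * t⁻¹ = b ^ 2) :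
    IsClopen (interior (fixedSet b)) ∧ fixedSet b ⊆ interior (fixedSet (b ^ 2)) := by
  have hdich := fun p (hp : b p = p) => germ_dichotomy hb
    (fun s hs => slopeSet_subset_one hb ht h1 hbt hs)
    (fun s hs => slopeSet_subset_one hb2 ht h1 (conj_pow_eq_sq hbt 2) hs) hp
  have hclosed : IsClosed (fixedSet b) := isClosed_eq b.continuous continuous_id
  refine ⟨⟨?_, isOpen_interior⟩, ?_⟩
  · refine isClosed_of_closure_subset fun z hz => ?_
    have hz' : b z = z := closure_minimal interior_subset hclosed hz
    rcases hdich z hz' with h | ⟨-, h⟩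
    · exact mem_interior_iff_mem_nhds.2 h
    · by_contra hcon
      obtain ⟨q, hq, hq'⟩ := (mem_closure_iff_frequently.1 hz).and_eventually h |>.exists
      refine hq' ?_ (interior_subset (s := fixedSet b) hq)
      rintro rfl
      exact hcon hq
  · intro p hp
    rcases hdich p hp with h | ⟨h, -⟩
    · refine mem_interior_iff_mem_nhds.2 ?_
      filter_upwards [h] with q hq
      exact pow_apply_eq_of_apply_eq hq 2
    · exact mem_interior_iff_mem_nhds.2 h

/-- In a group of piecewise linear homeomorphisms of a compact one-manifold, an element conjugate
to its square has finite order. -/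
theorem exists_pow_eq_one_of_conj_eq_sq {S : Subgroup (M ≃ₜ M)} (hS : ∀ h ∈ S, IsPLHomeo h)
    {a t : M ≃ₜ M} (ha : a ∈ S) (ht : t ∈ S) (hat : t * a * t⁻¹ = a ^ 2) :
    ∃ m : ℕ, m ≠ 0 ∧ a ^ m = 1 := by
  have hclopen := fun m : ℕ => isClopen_interior_fixedSet (hS _ (pow_mem ha m))
    (hS _ (pow_mem (pow_mem ha m) 2)) (hS _ (inv_mem ht)) (hS _ (one_mem S)) (conj_pow_eq_sq hat m)
  set P : Set M := {p | ∃ m : ℕ, m ≠ 0 ∧ (a ^ m) p = p} with hP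
  have hPQ : ∀ p ∈ P, ∃ m : ℕ, m ≠ 0 ∧ p ∈ interior (fixedSet (a ^ m)) := by
    rintro p ⟨m, hm, hp⟩
    refine ⟨m * 2, by omega, ?_⟩
    rw [pow_mul]
    exact (hclopen m).2 hp
  have hQP : ∀ m : ℕ, m ≠ 0 → interior (fixedSet (a ^ m)) ⊆ P :=
    fun m hm p hp => ⟨m, hm, interior_subset (s := fixedSet (a ^ m)) hp⟩
  have hopen : IsOpen P := by
    rw [isOpen_iff_mem_nhds]
    intro p hp
    obtain ⟨m, hm, hpm⟩ := hPQ p hp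
    exact Filter.mem_of_superset (isOpen_interior.mem_nhds hpm) (hQP m hm)
  -- Each `interior (fixedSet (a ^ m))` is clopen, so a component that meets `P` lies in `P`;
  -- components are open in a manifold.
  have hopen' : IsOpen Pᶜ := by
    have := locallyConnectedSpace_nnreal
    have := ChartedSpace.locallyConnectedSpace ℝ≥0 M
    rw [isOpen_iff_mem_nhds]
    intro z hz
    refine Filter.mem_of_superset (isOpen_connectedComponent.mem_nhds mem_connectedComponent) ?_
    intro w hw hwP
    obtain ⟨m, hm, hwm⟩ := hPQ w hwP
    have := (hclopen m).1.connectedComponent_subset hwm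
    rw [← connectedComponent_eq hw] at this
    exact hz (hQP m hm (this mem_connectedComponent))
  -- A nonempty complement would be a compact one-manifold preserved by `a` and `t` on which `a` has
  -- no periodic point.
  have hPuniv : ∀ p, p ∈ P := by
    by_contra! hne
    obtain ⟨p₀, hp₀⟩ := hne
    let Y : TopologicalSpace.Opens M := ⟨Pᶜ, hopen'⟩
    have : Nonempty Y := ⟨⟨p₀, hp₀⟩⟩
    have : CompactSpace Y := isCompact_iff_compactSpace.1 hopen.isClosed_compl.isCompact
    have hcomm : ∀ m : ℕ, a * a ^ m = a ^ m * a := fun m => (Commute.self_pow a m).eq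
    have hainv : ∀ p, p ∈ Y ↔ a p ∈ Y := by
      intro p
      refine not_congr (exists_congr fun m => and_congr_right fun _ => ?_)
      have := DFunLike.congr_fun (hcomm m) p
      simp only [Homeomorph.mul_apply] at this
      rw [← this, a.injective.eq_iff]
    have htinv : ∀ p, p ∈ Y ↔ t p ∈ Y := by
      intro p
      have key : ∀ m : ℕ, ((a ^ m) ^ 2) (t p) = t ((a ^ m) p) := by
        intro m
        rw [← conj_pow_eq_sq hat m, Homeomorph.mul_apply, Homeomorph.mul_apply,
          Homeomorph.inv_apply, t.symm_apply_apply]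
      refine not_congr ⟨?_, ?_⟩
      · rintro ⟨m, hm, hp⟩
        refine ⟨m * 2, by omega, ?_⟩
        rw [pow_mul, key m, hp]
      · rintro ⟨m, hm, hp⟩
        refine ⟨m, hm, t.injective ?_⟩
        rw [← key m, pow_apply_eq_of_apply_eq hp 2]
    let a' : Y ≃ₜ Y := a.subtype hainv
    let t' : Y ≃ₜ Y := t.subtype htinv
    have hpow : ∀ (m : ℕ) (y : Y), ((a' ^ m) y : M) = (a ^ m) y := by
      intro m
      induction m with
      | zero => intro y; rfl
      | succ m ih => intro y; rw [pow_succ, pow_succ, Homeomorph.mul_apply, ih]; rfl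
    have hat' : t' * a' * t'⁻¹ = a' ^ 2 := by
      rw [mul_inv_eq_iff_eq_mul] at hat ⊢
      ext y
      have h1 := DFunLike.congr_fun hat (y : M)
      have h2 := hpow 2 (t' y)
      rw [Homeomorph.mul_apply (a' ^ 2), h2]
      exact h1
    obtain ⟨m, hm, y, hy⟩ := exists_periodic_point hat'
    refine y.2 ⟨m, hm, ?_⟩
    rw [← hpow, hy]
  choose! m hm hmQ using hPQ
  obtain ⟨s, hs⟩ := CompactSpace.elim_nhds_subcover (fun p => interior (fixedSet (a ^ m p)))
    fun p => isOpen_interior.mem_nhds (hmQ p (hPuniv p))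
  refine ⟨∏ p ∈ s, m p, Finset.prod_ne_zero_iff.2 fun p _ => hm p (hPuniv p), ?_⟩
  ext q
  have hq : q ∈ ⋃ p ∈ s, interior (fixedSet (a ^ m p)) := hs ▸ Set.mem_univ q
  simp only [Set.mem_iUnion] at hq
  obtain ⟨p, hp, hpq⟩ := hq
  obtain ⟨k, hk⟩ := Finset.dvd_prod_of_mem m hp
  rw [hk, pow_mul]
  exact pow_apply_eq_of_apply_eq (interior_subset (s := fixedSet (a ^ m p)) hpq) k

end NoAction

/-! ### Order automorphisms supported in intervals -/

section OrderAut

variable {X Y : Type*} [LinearOrder X] [LinearOrder Y] {p q : X}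

open Classical in
/-- Transport of an automorphism of `Y` to the interval `(p, q)`, extended by the identity. -/
noncomputable def extendFun (θ : Y ≃o Set.Ioo p q) (h : Y ≃o Y) (x : X) : X :=
  if hx : x ∈ Set.Ioo p q then θ (h (θ.symm ⟨x, hx⟩)) else x

theorem extendFun_coe (θ : Y ≃o Set.Ioo p q) (h : Y ≃o Y) (s : Y) :
    extendFun θ h (θ s) = θ (h s) := by
  simp [extendFun, (θ s).2]

theorem extendFun_of_notMem (θ : Y ≃o Set.Ioo p q) (h : Y ≃o Y) {x : X} (hx : x ∉ Set.Ioo p q) :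
    extendFun θ h x = x := by
  simp [extendFun, hx]

theorem extendFun_mul (θ : Y ≃o Set.Ioo p q) (h k : Y ≃o Y) (x : X) :
    extendFun θ h (extendFun θ k x) = extendFun θ (h * k) x := by
  by_cases hx : x ∈ Set.Ioo p q
  · obtain ⟨s, hs⟩ := θ.surjective ⟨x, hx⟩
    obtain rfl : (θ s : X) = x := by rw [hs]
    simp only [extendFun_coe, RelIso.mul_apply]
  · simp only [extendFun_of_notMem θ _ hx]

theorem extendFun_one (θ : Y ≃o Set.Ioo p q) (x : X) : extendFun θ 1 x = x := by
  by_cases hx : x ∈ Set.Ioo p q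
  · simp [extendFun]
  · exact extendFun_of_notMem θ _ hx

theorem extendFun_strictMono (θ : Y ≃o Set.Ioo p q) (h : Y ≃o Y) :
    StrictMono (extendFun θ h) := by
  intro x y hxy
  have hmem : ∀ {x}, x ∈ Set.Ioo p q → extendFun θ h x ∈ Set.Ioo p q := by
    intro x hx
    obtain ⟨s, hs⟩ := θ.surjective ⟨x, hx⟩
    obtain rfl : (θ s : X) = x := by rw [hs]
    rw [extendFun_coe]
    exact (θ (h s)).2
  by_cases hx : x ∈ Set.Ioo p q <;> by_cases hy : y ∈ Set.Ioo p q
  · simp only [extendFun, hx, hy, dif_pos]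
    exact θ.strictMono (h.strictMono (θ.symm.strictMono hxy))
  · rw [extendFun_of_notMem θ h hy]
    refine (hmem hx).2.trans_le (not_lt.1 fun hyq => hy ⟨hx.1.trans hxy, hyq⟩)
  · rw [extendFun_of_notMem θ h hx]
    exact (not_lt.1 fun hpx => hx ⟨hpx, hxy.trans hy.2⟩ : x ≤ p).trans_lt (hmem hy).1
  · rwa [extendFun_of_notMem θ h hx, extendFun_of_notMem θ h hy]

/-- The extension by the identity, as a homomorphism. -/
noncomputable def extendHom (θ : Y ≃o Set.Ioo p q) : (Y ≃o Y) →* (X ≃o X) where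
  toFun h :=
    { toFun := extendFun θ h
      invFun := extendFun θ h⁻¹
      left_inv := fun x => by rw [extendFun_mul, inv_mul_cancel, extendFun_one]
      right_inv := fun x => by rw [extendFun_mul, mul_inv_cancel, extendFun_one]
      map_rel_iff' := (extendFun_strictMono θ h).le_iff_le }
  map_one' := by ext x; exact extendFun_one θ x
  map_mul' h k := by ext x; exact (extendFun_mul θ h k x).symm

theorem extendHom_coe (θ : Y ≃o Set.Ioo p q) (h : Y ≃o Y) (s : Y) :
    extendHom θ h (θ s) = θ (h s) := extendFun_coe θ h s

theorem extendHom_of_le (θ : Y ≃o Set.Ioo p q) (h : Y ≃o Y) {x : X} (hx : x ≤ p) :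
    extendHom θ h x = x := extendFun_of_notMem θ h fun hx' => absurd hx'.1 (not_lt.2 hx)

theorem extendHom_of_ge (θ : Y ≃o Set.Ioo p q) (h : Y ≃o Y) {x : X} (hx : q ≤ x) :
    extendHom θ h x = x := extendFun_of_notMem θ h fun hx' => absurd hx'.2 (not_lt.2 hx)

theorem exists_coe_eq (θ : Y ≃o Set.Ioo p q) {x : X} (h₁ : p < x) (h₂ : x < q) :
    ∃ s, (θ s : X) = x := by
  obtain ⟨s, hs⟩ := θ.surjective ⟨x, h₁, h₂⟩
  exact ⟨s, by rw [hs]⟩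

theorem coe_lt_coe_iff (θ : Y ≃o Set.Ioo p q) {s s' : Y} : (θ s : X) < θ s' ↔ s < s' := by
  rw [Subtype.coe_lt_coe, θ.lt_iff_lt]

theorem inv_apply_eq_of_apply_eq {h : X ≃o X} {x : X} (hx : h x = x) : h⁻¹ x = x := by
  nth_rewrite 1 [← hx]
  exact h.symm_apply_apply x

/-- The automorphism of `Y` induced by an automorphism of `X` fixing `p` and `q`. -/
noncomputable def restrictAut (θ : Y ≃o Set.Ioo p q) (h : X ≃o X) (hp : h p = p) (hq : h q = q) :
    Y ≃o Y :=
  StrictMono.orderIsoOfSurjective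
    (fun s => θ.symm ⟨h (θ s), by have := h.strictMono (θ s).2.1; rwa [hp] at this, by
      have := h.strictMono (θ s).2.2; rwa [hq] at this⟩)
    (fun s s' hs => θ.symm.strictMono (h.strictMono ((coe_lt_coe_iff θ).2 hs)))
    (fun s => by
      have h1 : p < h⁻¹ (θ s) := by
        have := h⁻¹.strictMono (θ s).2.1
        rwa [inv_apply_eq_of_apply_eq hp] at this
      have h2 : h⁻¹ (θ s) < q := by
        have := h⁻¹.strictMono (θ s).2.2
        rwa [inv_apply_eq_of_apply_eq hq] at this
      obtain ⟨s', hs'⟩ := exists_coe_eq θ h1 h2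
      refine ⟨s', ?_⟩
      have : h (θ s') = θ s := by rw [hs']; exact h.apply_symm_apply _
      simp [this])

theorem coe_restrictAut (θ : Y ≃o Set.Ioo p q) {h : X ≃o X} (hp : h p = p) (hq : h q = q) (s : Y) :
    (θ (restrictAut θ h hp hq s) : X) = h (θ s) := by
  change (θ (θ.symm _) : X) = _
  rw [θ.apply_symm_apply]

/-- Two automorphisms commute if one is supported in an interval fixed pointwise by the other. -/
theorem commute_of_fixed_on_Icc {h k : X ≃o X} (hh : ∀ x ∈ Set.Icc p q, h x = x)
    (hk : ∀ x, x ≤ p ∨ q ≤ x → k x = x) : Commute h k := by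
  ext x
  simp only [RelIso.mul_apply]
  rcases le_total x p with hxp | hxp
  · rcases le_total p q with hpq | hpq
    · rw [hk x (Or.inl hxp), hk]
      left
      have := h.monotone hxp
      rwa [hh p ⟨le_rfl, hpq⟩] at this
    · rw [hk x (Or.inl hxp), hk]
      exact (le_total (h x) p).imp id fun h' => hpq.trans h'
  · rcases le_total q x with hxq | hxq
    · rcases le_total p q with hpq | hpq
      · rw [hk x (Or.inr hxq), hk]
        right
        have := h.monotone hxq
        rwa [hh q ⟨hpq, le_rfl⟩] at this
      · rw [hk x (Or.inr hxq), hk]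
        exact (le_total (h x) p).imp id fun h' => hpq.trans h'
    · have h1 := k.monotone hxp
      have h2 := k.monotone hxq
      rw [hk p (Or.inl le_rfl)] at h1
      rw [hk q (Or.inr le_rfl)] at h2
      rw [hh x ⟨hxp, hxq⟩, hh _ ⟨h1, h2⟩]

/-- `h` has support `(p, q)` and moves its points to the right. -/
structure IsBump (h : X ≃o X) (p q : X) : Prop where
  lt_apply : ∀ x, p < x → x < q → x < h x
  apply_of_le : ∀ x, x ≤ p → h x = x
  apply_of_ge : ∀ x, q ≤ x → h x = x

theorem IsBump.conj {h : X ≃o X} (hh : IsBump h p q) (m : X ≃o X) :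
    IsBump (m * h * m⁻¹) (m p) (m q) := by
  have hmm : ∀ x, m (m⁻¹ x) = x := fun x => m.apply_symm_apply x
  have hmm' : ∀ x, m⁻¹ (m x) = x := fun x => m.symm_apply_apply x
  refine ⟨fun x h1 h2 => ?_, fun x hx => ?_, fun x hx => ?_⟩
  · have h1' := m⁻¹.strictMono h1
    have h2' := m⁻¹.strictMono h2
    rw [hmm'] at h1' h2'
    have := m.strictMono (hh.lt_apply _ h1' h2')
    rwa [hmm] at this
  · have hx' := m⁻¹.monotone hx
    rw [hmm'] at hx'
    rw [RelIso.mul_apply, RelIso.mul_apply, hh.apply_of_le _ hx', hmm]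
  · have hx' := m⁻¹.monotone hx
    rw [hmm'] at hx'
    rw [RelIso.mul_apply, RelIso.mul_apply, hh.apply_of_ge _ hx', hmm]

/-- `h` has support `(p, c) ∪ (c, q)` and moves its points away from `c`. -/
structure IsRepelling (h : X ≃o X) (p c q : X) : Prop where
  lt_left : p < c
  lt_right : c < q
  apply_lt : ∀ x, p < x → x < c → h x < x
  apply_mid : h c = c
  lt_apply : ∀ x, c < x → x < q → x < h x
  apply_of_le : ∀ x, x ≤ p → h x = x
  apply_of_ge : ∀ x, q ≤ x → h x = x

theorem IsRepelling.conj {h : X ≃o X} {c : X} (hh : IsRepelling h p c q) (m : X ≃o X) :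
    IsRepelling (m * h * m⁻¹) (m p) (m c) (m q) := by
  have hmm : ∀ x, m (m⁻¹ x) = x := fun x => m.apply_symm_apply x
  have hmm' : ∀ x, m⁻¹ (m x) = x := fun x => m.symm_apply_apply x
  refine ⟨m.strictMono hh.lt_left, m.strictMono hh.lt_right, fun x h1 h2 => ?_, ?_,
    fun x h1 h2 => ?_, fun x hx => ?_, fun x hx => ?_⟩
  · have h1' := m⁻¹.strictMono h1
    have h2' := m⁻¹.strictMono h2
    rw [hmm'] at h1' h2'
    have := m.strictMono (hh.apply_lt _ h1' h2')
    rwa [hmm] at this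
  · rw [RelIso.mul_apply, RelIso.mul_apply, hmm', hh.apply_mid]
  · have h1' := m⁻¹.strictMono h1
    have h2' := m⁻¹.strictMono h2
    rw [hmm'] at h1' h2'
    have := m.strictMono (hh.lt_apply _ h1' h2')
    rwa [hmm] at this
  · have hx' := m⁻¹.monotone hx
    rw [hmm'] at hx'
    rw [RelIso.mul_apply, RelIso.mul_apply, hh.apply_of_le _ hx', hmm]
  · have hx' := m⁻¹.monotone hx
    rw [hmm'] at hx'
    rw [RelIso.mul_apply, RelIso.mul_apply, hh.apply_of_ge _ hx', hmm]

theorem isRepelling_inv_mul {v w : X ≃o X} {c : X} (hpc : p < c) (hcq : c < q)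
    (hv : IsBump v p c) (hw : IsBump w c q) : IsRepelling (v⁻¹ * w) p c q := by
  refine ⟨hpc, hcq, fun x h1 h2 => ?_, ?_, fun x h1 h2 => ?_, fun x hx => ?_, fun x hx => ?_⟩
  · rw [RelIso.mul_apply, hw.apply_of_le x h2.le]
    have := v⁻¹.strictMono (hv.lt_apply x h1 h2)
    rwa [show v⁻¹ (v x) = x from v.symm_apply_apply x] at this
  · rw [RelIso.mul_apply, hw.apply_of_le c le_rfl,
      inv_apply_eq_of_apply_eq (hv.apply_of_ge c le_rfl)]
  · have h3 := hw.lt_apply x h1 h2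
    rwa [RelIso.mul_apply, inv_apply_eq_of_apply_eq (hv.apply_of_ge _ (h1.trans h3).le)]
  · rw [RelIso.mul_apply, hw.apply_of_le x (hx.trans hpc.le),
      inv_apply_eq_of_apply_eq (hv.apply_of_le x hx)]
  · rw [RelIso.mul_apply, hw.apply_of_ge x hx,
      inv_apply_eq_of_apply_eq (hv.apply_of_ge x (hcq.le.trans hx))]

end OrderAut

/-! ### Linearization -/

section Linearization

/-- The orbit of `0` is unbounded in both directions, since its supremum or infimum would be fixed.
So `[0, k 0)` is a fundamental domain; it is parametrized linearly and the parametrization is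
carried along by `k`. -/
theorem exists_conj_translation {k : ℝ ≃o ℝ} (hk : ∀ s, s < k s) :
    ∃ ψ : ℝ ≃o ℝ, ∀ s, k (ψ s) = ψ (s + 1) := by
  have hmono : StrictMono fun n : ℤ => (k ^ n) 0 := by
    refine strictMono_int_of_lt_succ fun n => ?_
    rw [zpow_add_one, RelIso.mul_apply]
    exact (k ^ n).strictMono (hk 0)
  have hsucc : ∀ n : ℤ, (k ^ (n + 1)) 0 = k ((k ^ n) 0) := fun n => by
    rw [add_comm, zpow_add, zpow_one, RelIso.mul_apply]
  have hunb : ∀ y, ∃ n : ℤ, y < (k ^ n) 0 := by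
    intro y
    by_contra! hcon
    have hbdd : BddAbove (Set.range fun n : ℤ => (k ^ n) 0) := ⟨y, by rintro _ ⟨n, rfl⟩; exact hcon n⟩
    have h1 : k⁻¹ (⨆ n : ℤ, (k ^ n) 0) < ⨆ n : ℤ, (k ^ n) 0 := by
      have := hk (k⁻¹ (⨆ n : ℤ, (k ^ n) 0))
      rwa [show k (k⁻¹ (⨆ n : ℤ, (k ^ n) 0)) = _ from k.apply_symm_apply _] at this
    obtain ⟨n, hn⟩ := exists_lt_of_lt_ciSup h1
    have h2 := k.strictMono hn
    rw [show k (k⁻¹ (⨆ n : ℤ, (k ^ n) 0)) = _ from k.apply_symm_apply _, ← hsucc] at h2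
    exact absurd (le_ciSup hbdd (n + 1)) (not_le.2 h2)
  have hunb' : ∀ y, ∃ n : ℤ, (k ^ n) 0 ≤ y := by
    intro y
    by_contra! hcon
    have hbdd : BddBelow (Set.range fun n : ℤ => (k ^ n) 0) :=
      ⟨y, by rintro _ ⟨n, rfl⟩; exact (hcon n).le⟩
    obtain ⟨n, hn⟩ := exists_lt_of_ciInf_lt (hk (⨅ n : ℤ, (k ^ n) 0))
    have h3 := hsucc (n - 1)
    rw [sub_add_cancel] at h3
    rw [h3] at hn
    exact absurd (ciInf_le hbdd (n - 1)) (not_le.2 (k.lt_iff_lt.1 hn))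
  have hpos : 0 < k 0 := hk 0
  let f : ℝ → ℝ := fun s => (k ^ ⌊s⌋) (Int.fract s * k 0)
  have hf0 : ∀ s, (k ^ ⌊s⌋) 0 ≤ f s := fun s =>
    (k ^ ⌊s⌋).monotone (mul_nonneg (Int.fract_nonneg s) hpos.le)
  have hf1 : ∀ s, f s < (k ^ (⌊s⌋ + 1)) 0 := by
    intro s
    rw [zpow_add_one, RelIso.mul_apply]
    exact (k ^ ⌊s⌋).strictMono (mul_lt_of_lt_one_left hpos (Int.fract_lt_one s))
  have hfmono : StrictMono f := by
    intro s s' hs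
    rcases (Int.floor_le_floor hs.le).eq_or_lt with h | h
    · have hfr : Int.fract s < Int.fract s' := by
        rw [Int.fract, Int.fract, h]; linarith
      simp only [f]
      rw [h]
      exact (k ^ ⌊s'⌋).strictMono (mul_lt_mul_of_pos_right hfr hpos)
    · exact (hf1 s).trans_le ((hmono.monotone (Int.add_one_le_iff.2 h)).trans (hf0 s'))
  have hfsurj : Function.Surjective f := by
    intro y
    obtain ⟨N, hN⟩ := hunb y
    obtain ⟨n, hn, hmax⟩ := Int.exists_greatest_of_bdd (P := fun n => (k ^ n) 0 ≤ y)
      ⟨N, fun z hz => (hmono.lt_iff_lt.1 (hz.trans_lt hN)).le⟩ (hunb' y)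
    have hn1 : y < (k ^ (n + 1)) 0 := by
      by_contra! hcon
      have := hmax _ hcon
      omega
    set r := (k ^ n)⁻¹ y with hr
    have hkr : (k ^ n) r = y := (k ^ n).apply_symm_apply y
    have hr0 : 0 ≤ r := (k ^ n).le_iff_le.1 (by rwa [hkr])
    have hr1 : r < k 0 := (k ^ n).lt_iff_lt.1 (by
      rwa [hkr, ← RelIso.mul_apply, ← zpow_add_one])
    have hd0 : 0 ≤ r / k 0 := div_nonneg hr0 hpos.le
    have hd1 : r / k 0 < 1 := (div_lt_one hpos).2 hr1
    refine ⟨n + r / k 0, ?_⟩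
    have h1 : ⌊(n : ℝ) + r / k 0⌋ = n := by
      rw [Int.floor_intCast_add, Int.floor_eq_zero_iff.2 ⟨hd0, hd1⟩, add_zero]
    have h2 : Int.fract ((n : ℝ) + r / k 0) = r / k 0 := by
      rw [Int.fract_intCast_add, Int.fract_eq_self.2 ⟨hd0, hd1⟩]
    simp only [f, h1, h2]
    rw [div_mul_cancel₀ _ hpos.ne', hkr]
  refine ⟨StrictMono.orderIsoOfSurjective f hfmono hfsurj, fun s => ?_⟩
  simp only [StrictMono.coe_orderIsoOfSurjective, f]
  rw [Int.floor_add_one, Int.fract_add_one, add_comm, zpow_add, zpow_one, RelIso.mul_apply]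

/-- The automorphism of `ℝ` commuting with the integer translations that agrees with `χ` on
`[0, 1]`. -/
theorem exists_periodization (χ : ℝ ≃o ℝ) (h0 : χ 0 = 0) (h1 : χ 1 = 1) :
    ∃ ψ : ℝ ≃o ℝ, (∀ s, ψ (s + 1) = ψ s + 1) ∧ ∀ s ∈ Set.Icc (0 : ℝ) 1, ψ s = χ s := by
  let f : ℝ → ℝ := fun s => ⌊s⌋ + χ (Int.fract s)
  have hr : ∀ r : ℝ, 0 ≤ r → r < 1 → 0 ≤ χ r ∧ χ r < 1 := by
    intro r hr0 hr1
    constructor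
    · rw [← h0]; exact χ.monotone hr0
    · have := χ.strictMono hr1
      rwa [h1] at this
  have hmono : StrictMono f := by
    intro s s' hs
    have e1 := hr _ (Int.fract_nonneg s) (Int.fract_lt_one s)
    have e2 := hr _ (Int.fract_nonneg s') (Int.fract_lt_one s')
    rcases (Int.floor_le_floor hs.le).eq_or_lt with h | h
    · have hfr : Int.fract s < Int.fract s' := by
        rw [Int.fract, Int.fract, h]; linarith
      simp only [f]
      rw [h]
      linarith [χ.strictMono hfr]
    · have : (⌊s⌋ : ℝ) + 1 ≤ ⌊s'⌋ := by exact_mod_cast Int.add_one_le_iff.2 h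
      simp only [f]
      linarith
  have hsurj : Function.Surjective f := by
    intro y
    set r := χ⁻¹ (Int.fract y)
    have hχr : χ r = Int.fract y := χ.apply_symm_apply _
    have hr0 : 0 ≤ r := χ.le_iff_le.1 (by rw [h0, hχr]; exact Int.fract_nonneg y)
    have hr1 : r < 1 := χ.lt_iff_lt.1 (by rw [h1, hχr]; exact Int.fract_lt_one y)
    refine ⟨⌊y⌋ + r, ?_⟩
    have e1 : ⌊(⌊y⌋ : ℝ) + r⌋ = ⌊y⌋ := by
      rw [Int.floor_intCast_add, Int.floor_eq_zero_iff.2 ⟨hr0, hr1⟩, add_zero]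
    have e2 : Int.fract ((⌊y⌋ : ℝ) + r) = r := by
      rw [Int.fract_intCast_add, Int.fract_eq_self.2 ⟨hr0, hr1⟩]
    simp only [f, e1, e2, hχr]
    exact Int.floor_add_fract y
  refine ⟨StrictMono.orderIsoOfSurjective f hmono hsurj, fun s => ?_, fun s hs => ?_⟩
  · simp only [StrictMono.coe_orderIsoOfSurjective, f]
    rw [Int.floor_add_one, Int.fract_add_one]
    push_cast
    ring
  · simp only [StrictMono.coe_orderIsoOfSurjective, f]
    rcases hs.2.eq_or_lt with rfl | hlt
    · simp [h0, h1]
    · rw [Int.floor_eq_zero_iff.2 ⟨hs.1, hlt⟩, Int.fract_eq_self.2 ⟨hs.1, hlt⟩]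
      simp

theorem exists_orderIso_through {s₁ s₂ s₃ : ℝ} (h₁ : s₁ < s₂) (h₂ : s₂ < s₃) :
    ∃ ψ : ℝ ≃o ℝ, ψ (-1) = s₁ ∧ ψ 0 = s₂ ∧ ψ 1 = s₃ := by
  let f : ℝ → ℝ := fun x => s₂ + if x ≤ 0 then (s₂ - s₁) * x else (s₃ - s₂) * x
  have hmono : StrictMono f := by
    intro x y hxy
    simp only [f]
    split_ifs with hx hy hy
    · nlinarith
    · nlinarith
    · linarith
    · nlinarith
  have hsurj : Function.Surjective f := by
    intro y
    rcases le_or_gt y s₂ with hy | hy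
    · refine ⟨(y - s₂) / (s₂ - s₁), ?_⟩
      have : (y - s₂) / (s₂ - s₁) ≤ 0 := div_nonpos_of_nonpos_of_nonneg (by linarith) (by linarith)
      simp only [f, this, if_true]
      rw [mul_div_cancel₀ _ (by linarith)]
      ring
    · refine ⟨(y - s₂) / (s₃ - s₂), ?_⟩
      have : ¬ (y - s₂) / (s₃ - s₂) ≤ 0 := not_le.2 (div_pos (by linarith) (by linarith))
      simp only [f, this, if_false]
      rw [mul_div_cancel₀ _ (by linarith)]
      ring
  refine ⟨StrictMono.orderIsoOfSurjective f hmono hsurj, ?_, ?_, ?_⟩ <;> norm_num [f]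

variable {X : Type*} [LinearOrder X]

theorem exists_linearization {h : X ≃o X} {p q : X} (θ₀ : ℝ ≃o Set.Ioo p q) (hp : h p = p)
    (hq : h q = q) (hlt : ∀ x, p < x → x < q → x < h x) :
    ∃ θ : ℝ ≃o Set.Ioo p q, ∀ s, h (θ s) = θ (s + 1) := by
  obtain ⟨ψ, hψ⟩ := exists_conj_translation (k := restrictAut θ₀ h hp hq) (fun s => by
    rw [← coe_lt_coe_iff θ₀, coe_restrictAut]
    exact hlt _ (θ₀ s).2.1 (θ₀ s).2.2)
  refine ⟨ψ.trans θ₀, fun s => ?_⟩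
  simp only [OrderIso.trans_apply]
  rw [← hψ, coe_restrictAut]

/-- On each half both maps, or both inverses, are translations in suitable coordinates; the
conjugator matches these coordinates and is the identity elsewhere. -/
theorem IsRepelling.exists_conj_of_same
    (hX : ∀ p q : X, p < q → Nonempty (ℝ ≃o Set.Ioo p q)) {h₁ h₂ : X ≃o X} {p c q : X} (H₁ : IsRepelling h₁ p c q)
    (H₂ : IsRepelling h₂ p c q) :
    ∃ Z : X ≃o X, (∀ x, x ≤ p ∨ q ≤ x → Z x = x) ∧ Z * h₁ * Z⁻¹ = h₂ := by
  have key : ∀ {h : X ≃o X}, IsRepelling h p c q →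
      (∃ θ : ℝ ≃o Set.Ioo c q, ∀ s, h (θ s) = θ (s + 1)) ∧
      (∃ η : ℝ ≃o Set.Ioo p c, ∀ s, h⁻¹ (η s) = η (s + 1)) := by
    intro h H
    constructor
    · obtain ⟨θ₀⟩ := hX c q H.lt_right
      exact exists_linearization θ₀ H.apply_mid (H.apply_of_ge q le_rfl) H.lt_apply
    · obtain ⟨θ₀⟩ := hX p c H.lt_left
      refine exists_linearization θ₀ (inv_apply_eq_of_apply_eq (H.apply_of_le p le_rfl))
        (inv_apply_eq_of_apply_eq H.apply_mid) fun x h1 h2 => ?_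
      have := h⁻¹.strictMono (H.apply_lt x h1 h2)
      rwa [show h⁻¹ (h x) = x from h.symm_apply_apply x] at this
  obtain ⟨⟨θ₁, hθ₁⟩, η₁, hη₁⟩ := key H₁
  obtain ⟨⟨θ₂, hθ₂⟩, η₂, hη₂⟩ := key H₂
  have hη₁' : ∀ s, h₁ (η₁ s) = η₁ (s - 1) := fun s => by
    have := hη₁ (s - 1)
    rw [sub_add_cancel] at this
    rw [← this]; exact h₁.apply_symm_apply _
  have hη₂' : ∀ s, h₂ (η₂ s) = η₂ (s - 1) := fun s => by
    have := hη₂ (s - 1)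
    rw [sub_add_cancel] at this
    rw [← this]; exact h₂.apply_symm_apply _
  let Z₁ : X ≃o X := extendHom θ₁ (θ₂.trans θ₁.symm : ℝ ≃o ℝ)
  let Z₂ : X ≃o X := extendHom η₁ (η₂.trans η₁.symm : ℝ ≃o ℝ)
  have hZ₁ : ∀ s, Z₁ (θ₁ s) = θ₂ s := fun s => by
    rw [show Z₁ (θ₁ s) = _ from extendHom_coe _ _ _]; simp
  have hZ₂ : ∀ s, Z₂ (η₁ s) = η₂ s := fun s => by
    rw [show Z₂ (η₁ s) = _ from extendHom_coe _ _ _]; simp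
  have hZ₁le : ∀ x ≤ c, Z₁ x = x := fun x hx => extendHom_of_le _ _ hx
  have hZ₁ge : ∀ x, q ≤ x → Z₁ x = x := fun x hx => extendHom_of_ge _ _ hx
  have hZ₂le : ∀ x ≤ p, Z₂ x = x := fun x hx => extendHom_of_le _ _ hx
  have hZ₂ge : ∀ x, c ≤ x → Z₂ x = x := fun x hx => extendHom_of_ge _ _ hx
  have hZθ : ∀ s, (Z₁ * Z₂) (θ₁ s) = θ₂ s := fun s => by
    rw [RelIso.mul_apply, hZ₂ge _ (θ₁ s).2.1.le, hZ₁]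
  have hZη : ∀ s, (Z₁ * Z₂) (η₁ s) = η₂ s := fun s => by
    rw [RelIso.mul_apply, hZ₂, hZ₁le _ (η₂ s).2.2.le]
  have hZout : ∀ x, x ≤ p ∨ q ≤ x → (Z₁ * Z₂) x = x := by
    rintro x (hx | hx)
    · rw [RelIso.mul_apply, hZ₂le x hx, hZ₁le x (hx.trans H₁.lt_left.le)]
    · rw [RelIso.mul_apply, hZ₂ge x (H₁.lt_right.le.trans hx), hZ₁ge x hx]
  have hZc : (Z₁ * Z₂) c = c := by rw [RelIso.mul_apply, hZ₂ge c le_rfl, hZ₁le c le_rfl]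
  refine ⟨Z₁ * Z₂, hZout, ?_⟩
  rw [mul_inv_eq_iff_eq_mul]
  ext x
  rw [RelIso.mul_apply _ h₁, RelIso.mul_apply h₂]
  rcases le_or_gt x p with hxp | hxp
  · rw [H₁.apply_of_le x hxp, hZout x (Or.inl hxp), H₂.apply_of_le x hxp]
  rcases le_or_gt q x with hxq | hxq
  · rw [H₁.apply_of_ge x hxq, hZout x (Or.inr hxq), H₂.apply_of_ge x hxq]
  rcases lt_trichotomy x c with hxc | rfl | hxc
  · obtain ⟨s, rfl⟩ := exists_coe_eq η₁ hxp hxc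
    rw [hη₁', hZη, hZη, hη₂']
  · rw [H₁.apply_mid, hZc, H₂.apply_mid]
  · obtain ⟨s, rfl⟩ := exists_coe_eq θ₁ hxc hxq
    rw [hθ₁, hZθ, hZθ, hθ₂]

/-- A map that is affine in a coordinate of `(p, r)` first aligns the repelling points and right
ends. -/
theorem IsRepelling.exists_conj
    (hX : ∀ p q : X, p < q → Nonempty (ℝ ≃o Set.Ioo p q)) {h₁ h₂ : X ≃o X} {p c₁ q₁ c₂ q₂ r : X}
    (H₁ : IsRepelling h₁ p c₁ q₁) (H₂ : IsRepelling h₂ p c₂ q₂) (hr₁ : q₁ < r) (hr₂ : q₂ < r) :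
    ∃ Z : X ≃o X, (∀ x, x ≤ p ∨ r ≤ x → Z x = x) ∧ Z * h₁ * Z⁻¹ = h₂ := by
  obtain ⟨θ⟩ := hX p r (H₁.lt_left.trans (H₁.lt_right.trans hr₁))
  obtain ⟨s₁, hs₁⟩ := exists_coe_eq θ H₁.lt_left (H₁.lt_right.trans hr₁)
  obtain ⟨u₁, hu₁⟩ := exists_coe_eq θ (H₁.lt_left.trans H₁.lt_right) hr₁
  obtain ⟨s₂, hs₂⟩ := exists_coe_eq θ H₂.lt_left (H₂.lt_right.trans hr₂)
  obtain ⟨u₂, hu₂⟩ := exists_coe_eq θ (H₂.lt_left.trans H₂.lt_right) hr₂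
  have hsu₁ : s₁ < u₁ := by rw [← coe_lt_coe_iff θ, hs₁, hu₁]; exact H₁.lt_right
  have hsu₂ : s₂ < u₂ := by rw [← coe_lt_coe_iff θ, hs₂, hu₂]; exact H₂.lt_right
  let φ : ℝ ≃o ℝ := ((OrderIso.addRight (-s₁)).trans
    (OrderIso.mulRight₀ ((u₂ - s₂) / (u₁ - s₁)) (div_pos (sub_pos.2 hsu₂) (sub_pos.2 hsu₁)))).trans
    (OrderIso.addRight s₂)
  have hφs : φ s₁ = s₂ := by simp [φ]
  have hφu : φ u₁ = u₂ := by
    have : u₁ - s₁ ≠ 0 := (sub_pos.2 hsu₁).ne'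
    simp [φ]
    field_simp
    ring
  let W : X ≃o X := extendHom θ φ
  have hWp : W p = p := extendHom_of_le _ _ le_rfl
  have hWc : W c₁ = c₂ := by
    rw [← hs₁, ← hs₂, ← hφs]; exact extendHom_coe _ _ _
  have hWq : W q₁ = q₂ := by
    rw [← hu₁, ← hu₂, ← hφu]; exact extendHom_coe _ _ _
  have H₁' := H₁.conj W
  rw [hWp, hWc, hWq] at H₁'
  obtain ⟨Z, hZ, hZconj⟩ := H₁'.exists_conj_of_same hX H₂
  refine ⟨Z * W, ?_, by rw [← hZconj]; group⟩
  rintro x (hx | hx)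
  · rw [RelIso.mul_apply, show W x = x from extendHom_of_le _ _ hx, hZ x (Or.inl hx)]
  · rw [RelIso.mul_apply, show W x = x from extendHom_of_ge _ _ hx,
      hZ x (Or.inr (hr₂.le.trans hx))]

end Linearization

/-! ### The construction -/

section Construction

variable {X : Type*} [LinearOrder X]

theorem isBump_extendHom_addRight {p q : X} (θ : ℝ ≃o Set.Ioo p q) {c : ℝ} (hc : 0 < c) :
    IsBump (extendHom θ (OrderIso.addRight c)) p q := by
  refine ⟨fun x h1 h2 => ?_, fun x hx => extendHom_of_le _ _ hx, fun x hx => extendHom_of_ge _ _ hx⟩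
  obtain ⟨s, rfl⟩ := exists_coe_eq θ h1 h2
  rw [extendHom_coe, coe_lt_coe_iff]
  simpa using hc

theorem IsBump.le_apply {h : X ≃o X} {p q : X} (hh : IsBump h p q) (x : X) : x ≤ h x := by
  rcases le_or_gt x p with hp | hp
  · exact (hh.apply_of_le x hp).ge
  rcases le_or_gt q x with hq | hq
  · exact (hh.apply_of_ge x hq).ge
  · exact (hh.lt_apply x hp hq).le

theorem IsBump.inv_apply_le {h : X ≃o X} {p q : X} (hh : IsBump h p q) (x : X) : h⁻¹ x ≤ x := by
  have := hh.le_apply (h⁻¹ x)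
  rwa [show h (h⁻¹ x) = x from h.apply_symm_apply x] at this

theorem IsBump.pow_ne_one {h : X ≃o X} {p q x : X} (hh : IsBump h p q) (hp : p < x) (hq : x < q)
    {m : ℕ} (hm : m ≠ 0) : h ^ m ≠ 1 := by
  intro hone
  have h1 : h⁻¹ x < x := by
    have := h⁻¹.strictMono (hh.lt_apply x hp hq)
    rwa [show h⁻¹ (h x) = x from h.symm_apply_apply x] at this
  have h2 := orderIso_pow_lt h1 hm
  rw [inv_pow, hone, inv_one] at h2
  exact lt_irrefl _ h2

theorem apply_eq_of_sq_apply_eq {h : X ≃o X} {x : X} (hx : (h ^ 2) x = x) : h x = x := by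
  rw [pow_two, RelIso.mul_apply] at hx
  rcases lt_trichotomy (h x) x with hlt | heq | hgt
  · have := h.strictMono hlt
    rw [hx] at this
    exact absurd hlt this.not_gt
  · exact heq
  · have := h.strictMono hgt
    rw [hx] at this
    exact absurd hgt this.not_gt

/-- Up to `A α` the commutator is `B`; between `A α` and `b` it jumps beyond `b` because `B (A α) =
b`; from `b` on it is the bump `B * A * B⁻¹`. So the support is a single interval. -/
theorem IsBump.commutator {A B : X ≃o X} {p α b r : X} (hA : IsBump A p b) (hB : IsBump B α r)
    (hpα : p < α) (hbr : b < r) (hαb : α < b) (hfast : B (A α) = b) :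
    IsBump (B * A * B⁻¹ * A⁻¹) α (B b) := by
  have hAA : ∀ x, A (A⁻¹ x) = x := fun x => A.apply_symm_apply x
  have hBB : ∀ x, B (B⁻¹ x) = x := fun x => B.apply_symm_apply x
  have hAA' : ∀ x, A⁻¹ (A x) = x := fun x => A.symm_apply_apply x
  have hBB' : ∀ x, B⁻¹ (B x) = x := fun x => B.symm_apply_apply x
  have hAα : A α < b := by
    have := A.strictMono hαb
    rwa [hA.apply_of_ge b le_rfl] at this
  have hlow : ∀ x, x ≤ A α → (B * A * B⁻¹ * A⁻¹) x = B x := by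
    intro x hx
    have h1 := A⁻¹.monotone hx
    rw [hAA'] at h1
    simp only [RelIso.mul_apply]
    rw [inv_apply_eq_of_apply_eq (hB.apply_of_le _ h1), hAA]
  refine ⟨fun x h1 h2 => ?_, fun x hx => ?_, fun x hx => ?_⟩
  · rcases le_or_gt x (A α) with hx | hx
    · rw [hlow x hx]
      exact hB.lt_apply x h1 (hx.trans_lt (hAα.trans hbr))
    rcases lt_or_ge x b with hxb | hxb
    · refine hxb.trans ?_
      rw [← hfast]
      simp only [RelIso.mul_apply]
      refine B.strictMono (A.strictMono ?_)
      have h3 := B⁻¹.strictMono (A⁻¹.strictMono hx)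
      rwa [hAA', inv_apply_eq_of_apply_eq (hB.apply_of_le α le_rfl)] at h3
    · simp only [RelIso.mul_apply]
      rw [inv_apply_eq_of_apply_eq (hA.apply_of_ge x hxb)]
      have h3 := B⁻¹.monotone hxb
      have h4 := B⁻¹.strictMono h2
      rw [hBB'] at h4
      rw [← hfast, hBB'] at h3
      have h5 := B.strictMono (hA.lt_apply _ ((hpα.trans_le (hA.le_apply α)).trans_le h3) h4)
      rwa [hBB] at h5
  · rw [hlow x (hx.trans (hA.le_apply α)), hB.apply_of_le x hx]
  · have h1 : b ≤ x := (hB.le_apply b).trans hx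
    have h2 := B⁻¹.monotone hx
    rw [hBB'] at h2
    simp only [RelIso.mul_apply]
    rw [inv_apply_eq_of_apply_eq (hA.apply_of_ge x h1), hA.apply_of_ge _ h2, hBB]

/-- A square root of a translation can be chosen with prescribed conjugation action on an element
supported in half a fundamental domain. -/
theorem exists_sqrt_conj {p b : X} (θ : ℝ ≃o Set.Ioo p b) {k Z : X ≃o X}
    (hk : ∀ x, x ≤ (θ 0 : X) ∨ (θ (1 / 2) : X) ≤ x → k x = x)
    (hZ : ∀ x, x ≤ (θ (1 / 2) : X) ∨ (θ 1 : X) ≤ x → Z x = x) :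
    ∃ f : X ≃o X, f ^ 2 = extendHom θ (OrderIso.addRight 1) ∧
      f * k * f⁻¹ = Z * (extendHom θ (OrderIso.addRight (1 / 2)) * k *
        (extendHom θ (OrderIso.addRight (1 / 2)))⁻¹) * Z⁻¹ := by
  set S := extendHom θ (OrderIso.addRight (1 / 2)) with hS
  have hSS : S ^ 2 = extendHom θ (OrderIso.addRight 1) := by
    rw [hS, ← map_pow]
    congr 1
    ext s
    rw [pow_two, RelIso.mul_apply]
    simp only [OrderIso.addRight_apply]
    ring
  have hle : ∀ {s s' : ℝ}, (θ s : X) ≤ θ s' ↔ s ≤ s' := fun {s s'} => by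
    rw [Subtype.coe_le_coe, θ.le_iff_le]
  have hZ0 : Z (θ 0) = θ 0 := hZ _ (Or.inl (hle.2 (by norm_num)))
  have hZ1 : Z (θ 1) = θ 1 := hZ _ (Or.inr le_rfl)
  have hZp : Z p = p := hZ _ (Or.inl (θ _).2.1.le)
  have hZb : Z b = b := hZ _ (Or.inr (θ _).2.2.le)
  have hres : ∀ s, (θ (restrictAut θ Z hZp hZb s) : X) = Z (θ s) := coe_restrictAut θ hZp hZb
  -- Repeating `Z` on every fundamental domain gives `P` commuting with the translation `S ^ 2`, so
  -- `P * S * P⁻¹` is another root of it. On the half carrying `k`, `P` is trivial; on the next half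
  -- it equals `Z`.
  obtain ⟨ψ, hψ, hψZ⟩ := exists_periodization (restrictAut θ Z hZp hZb)
    (θ.injective (Subtype.ext ((hres 0).trans hZ0)))
    (θ.injective (Subtype.ext ((hres 1).trans hZ1)))
  set P := extendHom θ ψ with hP
  have hPZ : ∀ x, (θ 0 : X) ≤ x → x ≤ (θ 1 : X) → P x = Z x := by
    intro x h0 h1
    obtain ⟨s, rfl⟩ := exists_coe_eq θ ((θ 0).2.1.trans_le h0) (h1.trans_lt (θ 1).2.2)
    rw [hP, extendHom_coe, hψZ s ⟨hle.1 h0, hle.1 h1⟩, hres]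
  have hPA : P * S ^ 2 = S ^ 2 * P := by
    rw [hSS, hP, ← map_mul, ← map_mul]
    congr 1
    ext s
    simp only [RelIso.mul_apply, OrderIso.addRight_apply, hψ]
  have hSinv : ∀ s, S⁻¹ (θ (s + 1 / 2)) = θ s := fun s => by
    rw [show (θ (s + 1 / 2) : X) = S (θ s) from 
      (extendHom_coe θ (OrderIso.addRight (1 / 2)) s).symm]
    exact S.symm_apply_apply _
  have hPk : Commute P k := commute_of_fixed_on_Icc (p := (θ 0 : X)) (q := (θ (1 / 2) : X))
    (fun x hx => by
      rw [hPZ x hx.1 (hx.2.trans (hle.2 (by norm_num))), hZ x (Or.inl hx.2)]) hk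
  have hZPk : Commute (Z⁻¹ * P) (S * k * S⁻¹) :=
    commute_of_fixed_on_Icc (p := (θ (1 / 2) : X)) (q := (θ 1 : X))
      (fun x hx => by
        rw [RelIso.mul_apply, hPZ x ((hle.2 (by norm_num)).trans hx.1) hx.2]
        exact Z.symm_apply_apply x)
      (fun x hx => by
        rw [RelIso.mul_apply, RelIso.mul_apply, hk]
        · exact S.apply_symm_apply x
        · refine hx.imp (fun h => ?_) fun h => ?_
          · have := S⁻¹.monotone h
            rwa [show (1 / 2 : ℝ) = 0 + 1 / 2 by norm_num, hSinv] at this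
          · have := S⁻¹.monotone h
            rwa [show (1 : ℝ) = 1 / 2 + 1 / 2 by norm_num, hSinv] at this)
  refine ⟨P * S * P⁻¹, ?_, ?_⟩
  · rw [← hSS, conj_pow, hPA, mul_inv_cancel_right]
  · have e1 : P⁻¹ * k * P = k := by rw [mul_assoc, ← hPk.eq, inv_mul_cancel_left]
    have e2 : (Z⁻¹ * P) * (S * k * S⁻¹) * (Z⁻¹ * P)⁻¹ = S * k * S⁻¹ := by
      rw [hZPk.eq, mul_inv_cancel_right]
    calc P * S * P⁻¹ * k * (P * S * P⁻¹)⁻¹ = P * (S * (P⁻¹ * k * P) * S⁻¹) * P⁻¹ := by group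
      _ = Z * ((Z⁻¹ * P) * (S * k * S⁻¹) * (Z⁻¹ * P)⁻¹) * Z⁻¹ := by rw [e1]; group
      _ = _ := by rw [e2]

/-- In a coordinate where `h` is `s ↦ s + 1`, doubling `s ↦ 2 * s` conjugates `h` to its square. -/
theorem exists_conj_eq_sq {h : X ≃o X} {p q : X} (θ₀ : ℝ ≃o Set.Ioo p q) (hh : IsBump h p q) :
    ∃ (t : X ≃o X) (c : X), IsRepelling t p c q ∧ t * h * t⁻¹ = h ^ 2 := by
  obtain ⟨θ, hθ⟩ := exists_linearization θ₀ (hh.apply_of_le p le_rfl) (hh.apply_of_ge q le_rfl)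
    hh.lt_apply
  have hT : h = extendHom θ (OrderIso.addRight 1) := by
    ext x
    rcases le_or_gt x p with hp | hp
    · rw [hh.apply_of_le x hp, extendHom_of_le _ _ hp]
    rcases le_or_gt q x with hq | hq
    · rw [hh.apply_of_ge x hq, extendHom_of_ge _ _ hq]
    obtain ⟨s, rfl⟩ := exists_coe_eq θ hp hq
    rw [hθ, extendHom_coe]
    rfl
  let D : ℝ ≃o ℝ := OrderIso.mulLeft₀ 2 two_pos
  have hD : ∀ s, D s = 2 * s := fun s => rfl
  refine ⟨extendHom θ D, θ 0, ⟨(θ 0).2.1, (θ 0).2.2, fun x h1 h2 => ?_, ?_, fun x h1 h2 => ?_,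
    fun x hx => extendHom_of_le _ _ hx, fun x hx => extendHom_of_ge _ _ hx⟩, ?_⟩
  · obtain ⟨s, rfl⟩ := exists_coe_eq θ h1 (h2.trans (θ 0).2.2)
    rw [coe_lt_coe_iff] at h2
    rw [extendHom_coe, coe_lt_coe_iff, hD]
    linarith
  · rw [extendHom_coe, hD, mul_zero]
  · obtain ⟨s, rfl⟩ := exists_coe_eq θ ((θ 0).2.1.trans h1) h2
    rw [coe_lt_coe_iff] at h1
    rw [extendHom_coe, coe_lt_coe_iff, hD]
    linarith
  · rw [hT, mul_inv_eq_iff_eq_mul, ← map_pow, ← map_mul, ← map_mul]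
    congr 1
    ext s
    simp only [RelIso.mul_apply, pow_two, OrderIso.addRight_apply, hD]
    ring

theorem exists_square_roots (hX : ∀ p q : X, p < q → Nonempty (ℝ ≃o Set.Ioo p q)) {p r : X}
    (hpr : p < r) :
    ∃ (f g : X ≃o X) (α b : X), p < α ∧ α < b ∧ b < r ∧ IsBump (f ^ 2) p b ∧ IsBump (g ^ 2) α r ∧
      (g ^ 2) ((f ^ 2) α) = b ∧
      ∃ u ∈ Subgroup.closure {f, g}, ∃ t ∈ Subgroup.closure {f, g},
        t * u * t⁻¹ = u ^ 2 ∧ ∀ m : ℕ, m ≠ 0 → u ^ m ≠ 1 := by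
  obtain ⟨θ₀⟩ := hX p r hpr
  obtain ⟨b, hpb, hbr⟩ : ∃ b, p < b ∧ b < r := ⟨θ₀ 0, (θ₀ 0).2⟩
  obtain ⟨θf⟩ := hX p b hpb
  set α := ((θf 0 : Set.Ioo p b) : X) with hα
  set S := extendHom θf (OrderIso.addRight (1 / 2)) with hS
  set A := extendHom θf (OrderIso.addRight 1) with hA
  have hpα : p < α := (θf 0).2.1
  have hαb : α < b := (θf 0).2.2
  have hSα : S α = θf (1 / 2) := by rw [hS, hα, extendHom_coe]; simp
  have hAα : A α = θf 1 := by rw [hA, hα, extendHom_coe]; simp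
  have hSθ : S (θf (1 / 2)) = θf 1 := by
    rw [hS, extendHom_coe, OrderIso.addRight_apply]; norm_num
  have hA2 : A (A α) < b := by rw [hAα, hA, extendHom_coe]; exact (θf _).2.2
  have hαS : α < θf (1 / 2) := (coe_lt_coe_iff θf).2 (by norm_num)
  have hSA : (θf (1 / 2) : X) < θf 1 := (coe_lt_coe_iff θf).2 (by norm_num)
  have hAb : (θf 1 : X) < b := (θf 1).2.2
  have hbA : IsBump A p b := isBump_extendHom_addRight θf one_pos
  obtain ⟨θ₁⟩ := hX α r (hαb.trans hbr)
  obtain ⟨s₁, hs₁⟩ := exists_coe_eq θ₁ hαS (hSA.trans (hAb.trans hbr))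
  obtain ⟨s₂, hs₂⟩ := exists_coe_eq θ₁ (hαS.trans hSA) (hAb.trans hbr)
  obtain ⟨s₃, hs₃⟩ := exists_coe_eq θ₁ hαb hbr
  -- The coordinate of `B` is arranged so that `B` sends `S α` to `A α` and `A α` to `b`.
  obtain ⟨φ, hφ₁, hφ₂, hφ₃⟩ := exists_orderIso_through
    (s₁ := s₁) (s₂ := s₂) (s₃ := s₃)
    (by rw [← coe_lt_coe_iff θ₁, hs₁, hs₂]; exact hSA)
    (by rw [← coe_lt_coe_iff θ₁, hs₂, hs₃]; exact hAb)
  set θg := φ.trans θ₁ with hθg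
  have hg₁ : (θg (-1) : X) = θf (1 / 2) := by rw [hθg, OrderIso.trans_apply, hφ₁, hs₁]
  have hg₂ : (θg 0 : X) = θf 1 := by rw [hθg, OrderIso.trans_apply, hφ₂, hs₂]
  have hg₃ : (θg 1 : X) = b := by rw [hθg, OrderIso.trans_apply, hφ₃, hs₃]
  set g := extendHom θg (OrderIso.addRight (1 / 2)) with hg
  set B := extendHom θg (OrderIso.addRight 1) with hB
  have hgB : g ^ 2 = B := by
    rw [hg, hB, ← map_pow]
    congr 1
    ext s
    rw [pow_two, RelIso.mul_apply]
    simp only [OrderIso.addRight_apply]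
    ring
  have hbB : IsBump B α r := isBump_extendHom_addRight θg one_pos
  have hB₁ : B (θf (1 / 2)) = θf 1 := by
    rw [hB, ← hg₁, extendHom_coe, OrderIso.addRight_apply, ← hg₂]; norm_num
  have hB₂ : B (θf 1) = b := by
    rw [hB, ← hg₂, extendHom_coe, OrderIso.addRight_apply, ← hg₃]; norm_num
  have hBinv : ∀ {x y}, B x = y → B⁻¹ y = x := by
    rintro x _ rfl; exact B.symm_apply_apply x
  have hBα : B⁻¹ α = α := inv_apply_eq_of_apply_eq (hbB.apply_of_le α le_rfl)
  have hw := hbA.commutator hbB hpα hbr hαb (by rw [hAα, hB₂])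
  set w := B * A * B⁻¹ * A⁻¹ with hw_def
  have hv := (hw.conj B⁻¹).conj B⁻¹
  rw [hBα, hBα, hBinv rfl, hBinv hB₂] at hv
  set v := B⁻¹ * (B⁻¹ * w * B⁻¹⁻¹) * B⁻¹⁻¹ with hv_def
  -- The bump `v` has support `(α, A α)`, so `A * v * A⁻¹` has the adjacent support `(A α, A (A
  -- α))`, and `v⁻¹` times it repels from `A α`. Conjugating by `B⁻¹` twice pushes this into `(α, S
  -- α)`: this is `k`.
  have hv' := hv.conj A
  rw [hAα] at hv'
  have hA1 : (θf 1 : X) < A (θf 1) := hbA.lt_apply _ (θf 1).2.1 hAb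
  have hA2' : A (θf 1) < b := by rwa [← hAα]
  have hk := ((isRepelling_inv_mul (hαS.trans hSA) hA1 hv hv').conj B⁻¹).conj B⁻¹
  rw [hBα, hBα] at hk
  set k := B⁻¹ * (B⁻¹ * (v⁻¹ * (A * v * A⁻¹)) * B⁻¹⁻¹) * B⁻¹⁻¹ with hk_def
  have hkq : B⁻¹ (B⁻¹ (A (θf 1))) < θf (1 / 2) := by
    have := B⁻¹.strictMono (B⁻¹.strictMono hA2')
    rwa [hBinv hB₂, hBinv hB₁] at this
  have hu := hv'.conj B⁻¹
  rw [hBinv hB₁] at hu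
  set u := B⁻¹ * (A * v * A⁻¹) * B⁻¹⁻¹ with hu_def
  have huq : B⁻¹ (A (θf 1)) < θf 1 := by
    have := B⁻¹.strictMono hA2'
    rwa [hBinv hB₂] at this
  have hup : (θf (1 / 2) : X) < B⁻¹ (A (θf 1)) := by
    have := B⁻¹.strictMono hA1
    rwa [hBinv hB₁] at this
  obtain ⟨θu⟩ := hX _ _ hup
  -- Both `t` and `S * k * S⁻¹` are repelling, start at `S α` and end before `A α`. Hence some `Z`
  -- supported between these points conjugates one to the other, and a root `f` of `A` satisfies `f
  -- * k * f⁻¹ = t`.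
  obtain ⟨t, c, ht, htu⟩ := exists_conj_eq_sq θu hu
  have hk' := hk.conj S
  rw [hSα] at hk'
  obtain ⟨Z, hZ, hZk⟩ := hk'.exists_conj hX ht (r := (θf 1 : X))
    (by have := S.strictMono hkq; rwa [hSθ] at this) huq
  obtain ⟨f, hf, hfk⟩ := exists_sqrt_conj θf (k := k) (Z := Z)
    (fun x hx => hx.elim (hk.apply_of_le x) fun h => hk.apply_of_ge x (hkq.le.trans h)) hZ
  rw [hZk] at hfk
  obtain ⟨huG, htG⟩ : u ∈ Subgroup.closure {f, g} ∧ t ∈ Subgroup.closure {f, g} := by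
    have hfG : f ∈ Subgroup.closure {f, g} := Subgroup.subset_closure (by simp)
    have hgG : g ∈ Subgroup.closure {f, g} := Subgroup.subset_closure (by simp)
    set G := Subgroup.closure {f, g}
    have hAG : A ∈ G := by rw [hA, ← hf]; exact pow_mem hfG 2
    have hBG : B ∈ G := by rw [← hgB]; exact pow_mem hgG 2
    have hconj : ∀ {x y}, x ∈ G → y ∈ G → x * y * x⁻¹ ∈ G := fun hx hy =>
      mul_mem (mul_mem hx hy) (inv_mem hx)
    have hBG' := inv_mem hBG
    have hwG : w ∈ G := mul_mem (hconj hBG hAG) (inv_mem hAG)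
    have hvG : v ∈ G := hconj hBG' (hconj hBG' hwG)
    have hkG : k ∈ G := hconj hBG' (hconj hBG' (mul_mem (inv_mem hvG) (hconj hAG hvG)))
    exact ⟨hconj hBG' (hconj hAG hvG), hfk ▸ hconj hfG hkG⟩
  refine ⟨f, g, α, b, hpα, hαb, hbr, ?_, ?_, ?_, u, huG, t, htG, htu, fun m hm => ?_⟩
  · rwa [hf]
  · rwa [hgB]
  · rw [hf, hgB, ← hA, hAα, hB₂]
  · exact hu.pow_ne_one (θu 0).2.1 (θu 0).2.2 hm

/-! ### Realization on the unit interval -/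

theorem unitInterval_nonempty_orderIso_Ioo (p q : I) (hpq : p < q) :
    Nonempty (ℝ ≃o Set.Ioo p q) := by
  let e := orderIsoIooNegOneOne ℝ
  have hd : (0 : ℝ) < q - p := sub_pos.2 hpq
  let f : ℝ → ℝ := fun s => p + (q - p) * ((e s + 1) / 2)
  have hf : ∀ s, (p : ℝ) < f s ∧ f s < q := by
    intro s
    have h1 : (-1 : ℝ) < e s := (e s).2.1
    have h2 : (e s : ℝ) < 1 := (e s).2.2
    simp only [f]
    constructor <;> nlinarith
  have hmono : StrictMono f := by
    intro s s' hs
    have : (e s : ℝ) < e s' := e.strictMono hs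
    simp only [f]
    nlinarith
  have hsurj : ∀ y : ℝ, p < y → y < q → ∃ s, f s = y := by
    intro y h1 h2
    have h3 : 0 < (y - p) / (q - p) := div_pos (sub_pos.2 h1) hd
    have h4 : (y - p) / (q - p) < 1 := (div_lt_one hd).2 (by linarith)
    obtain ⟨s, hs⟩ := exists_coe_eq e (x := 2 * ((y - p) / (q - p)) - 1) (by linarith)
      (by linarith)
    refine ⟨s, ?_⟩
    simp only [f, hs]
    field_simp
    ring
  exact ⟨StrictMono.orderIsoOfSurjective
    (fun s => (⟨⟨f s, p.2.1.trans (hf s).1.le, (hf s).2.le.trans q.2.2⟩, hf s⟩ : Set.Ioo p q))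
    (fun s s' hs => hmono hs)
    (fun y => by
      obtain ⟨s, hs⟩ := hsurj y y.2.1 y.2.2
      exact ⟨s, Subtype.ext (Subtype.ext hs)⟩)⟩

/-- Order automorphisms of the unit interval, as homeomorphisms. -/
noncomputable def orderAutToHomeoPlus : (I ≃o I) →* HomeoPlus where
  toFun f := ⟨f.toHomeomorph, f.strictMono⟩
  map_one' := rfl
  map_mul' _ _ := rfl

theorem orderAutToHomeoPlus_apply (f : I ≃o I) (x : I) :
    (orderAutToHomeoPlus f : I ≃ₜ I) x = f x := rfl

theorem orderAutToHomeoPlus_injective : Function.Injective orderAutToHomeoPlus := by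
  intro f g h
  ext x
  rw [← orderAutToHomeoPlus_apply f, h, orderAutToHomeoPlus_apply]

/-- An increasing map has no points of period two, so `f` and `f ^ 2` have the same support. -/
theorem homeoSupport_orderAutToHomeoPlus {f : I ≃o I} {p q : I} (hf : IsBump (f ^ 2) p q) :
    homeoSupport (orderAutToHomeoPlus f) = Set.Ioo p q := by
  ext x
  simp only [homeoSupport, Set.mem_ofPred_eq, orderAutToHomeoPlus_apply]
  constructor
  · intro hx
    by_contra hcon
    refine hx (apply_eq_of_sq_apply_eq ?_)
    rcases le_or_gt x p with hp | hp
    · exact hf.apply_of_le x hp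
    · exact hf.apply_of_ge x (not_lt.1 fun hq => hcon ⟨hp, hq⟩)
  · intro hx hfx
    have := hf.lt_apply x hx.1 hx.2
    rw [pow_two, RelIso.mul_apply, hfx, hfx] at this
    exact lt_irrefl _ this

theorem isTwoChain_Ioo {p α b r : I} (hpα : p < α) (hαb : α < b) (hbr : b < r) :
    IsTwoChain (Set.Ioo p b) (Set.Ioo α r) := by
  refine ⟨⟨p, b, hpα.trans hαb, rfl⟩, ⟨α, r, hαb.trans hbr, rfl⟩, ?_, ?_, ?_⟩
  · obtain ⟨x, h1, h2⟩ := exists_between hαb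
    exact ⟨x, ⟨hpα.trans h1, h2⟩, h1, h2.trans hbr⟩
  · exact ⟨Set.inter_subset_left, fun h => lt_irrefl _ (h ⟨hpα, hαb⟩).2.1⟩
  · exact ⟨Set.inter_subset_right, fun h => lt_irrefl _ (h ⟨hαb, hbr⟩).1.2⟩

/-- Bumps move points to the right, so the criterion for decreasing maps is applied to the inverses,
which generate the same group. -/
theorem IsBump.nonempty_closure_mulEquiv_thompsonF {A B : X ≃o X} {p α b r : X}
    (hA : IsBump A p b) (hB : IsBump B α r) (hpα : p < α) (hαb : α < b) (hbr : b < r)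
    (hfast : B (A α) = b) : Nonempty (Subgroup.closure {A, B} ≃* ThompsonF) := by
  have hBb : B⁻¹ b = A α := by rw [← hfast]; exact B.symm_apply_apply _
  have hlt : ∀ {h : X ≃o X} {x}, x < h x → h⁻¹ x < x := by
    intro h x hx
    have := h⁻¹.strictMono hx
    rwa [show h⁻¹ (h x) = x from h.symm_apply_apply x] at this
  obtain ⟨e⟩ := nonempty_mulEquiv_thompsonF (A := A⁻¹) (B := B⁻¹) (y₀ := α) (α := α) (b := b)
    (fun z hz => inv_apply_eq_of_apply_eq (hA.apply_of_ge z hz))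
    (fun z hz => inv_apply_eq_of_apply_eq (hB.apply_of_le z hz))
    hA.inv_apply_le hB.inv_apply_le (by rw [hBb]; exact A.symm_apply_apply α)
    (hlt (hB.lt_apply b hαb hbr)) le_rfl (hlt (hA.lt_apply α hpα hαb))
  have hcl : Subgroup.closure {A⁻¹, B⁻¹} = Subgroup.closure {A, B} := by
    rw [← Subgroup.closure_inv {A, B}, Set.inv_insert, Set.inv_singleton]
  exact ⟨(MulEquiv.subgroupCongr hcl.symm).trans e⟩

end Construction

/-! ### The square root without PL actions -/

theorem corollary1p8 :
    ∃ G : Subgroup HomeoPlus, IsSquareRootOfF G ∧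
      ∀ (M : Type*) [TopologicalSpace M] [T2Space M] [CompactSpace M]
        [ChartedSpace ℝ≥0 M] [HasGroupoid M plGroupoid],
        ¬ ∃ ρ : G →* (M ≃ₜ M), Function.Injective ρ ∧ ∀ g : G, IsPLHomeo (ρ g) := by
  obtain ⟨f, g, α, b, hα, hαb, hb, hf, hg, hfast, u, hu, t, ht, htu, hum⟩ :=
    exists_square_roots unitInterval_nonempty_orderIso_Ioo (zero_lt_one (α := I))
  set E := orderAutToHomeoPlus with hE
  have himage : ∀ x y : I ≃o I, Subgroup.closure {E x, E y} = (Subgroup.closure {x, y}).map E := by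
    intro x y
    rw [MonoidHom.map_closure, Set.image_pair]
  refine ⟨Subgroup.closure {E f, E g}, ⟨E f, E g, rfl, ?_, ?_⟩, ?_⟩
  · rw [homeoSupport_orderAutToHomeoPlus hf, homeoSupport_orderAutToHomeoPlus hg]
    exact isTwoChain_Ioo hα hαb hb
  · obtain ⟨e⟩ := hf.nonempty_closure_mulEquiv_thompsonF hg hα hαb hb hfast
    rw [← map_pow, ← map_pow, himage]
    exact ⟨((Subgroup.closure {f ^ 2, g ^ 2}).equivMapOfInjective E
      orderAutToHomeoPlus_injective).symm.trans e⟩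
  · rintro M _ _ _ _ _ ⟨ρ, hρ, hPL⟩
    have hmem : ∀ {x}, x ∈ Subgroup.closure {f, g} → E x ∈ Subgroup.closure {E f, E g} := by
      intro x hx
      rw [himage]
      exact Subgroup.mem_map_of_mem E hx
    let u' : Subgroup.closure {E f, E g} := ⟨E u, hmem hu⟩
    let t' : Subgroup.closure {E f, E g} := ⟨E t, hmem ht⟩
    have htu' : t' * u' * t'⁻¹ = u' ^ 2 := by
      apply Subtype.ext
      change E t * E u * (E t)⁻¹ = E u ^ 2
      rw [← map_inv, ← map_mul, ← map_mul, htu, map_pow]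
    obtain ⟨m, hm, hone⟩ := exists_pow_eq_one_of_conj_eq_sq (S := ρ.range)
      (by rintro _ ⟨h, rfl⟩; exact hPL h) ⟨u', rfl⟩ ⟨t', rfl⟩
      (by rw [← map_inv, ← map_mul, ← map_mul, htu', map_pow])
    rw [← map_pow, map_eq_one_iff ρ hρ] at hone
    refine hum m hm (orderAutToHomeoPlus_injective ?_)
    rw [map_one, map_pow]
    exact congrArg Subtype.val hone
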